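/- Let $N\ge 5$, $2^*:=\frac{2N}{N-2}$, and let $f:\mathbb{R}\to\mathbb{R}$, $F(s):=\int_0^s f(t)\,\mathrm{d}t$, satisfy: $(f_1)$ $f\in\mathcal{C}^{1,\alpha}_{\mathrm{loc}}(\mathbb{R})$ for some $\alpha\in\big(\frac{N}{2(N-2)},1\big]$, and there are $a_1>0$ and $2<p<2^*<q$ such that, for $\kappa=-1,0,1$ and with $f^{(-1)}:=F$, $f^{(0)}:=f$, $f^{(1)}:=f'$, one has $|f^{(\kappa)}(s)|\le a_1|s|^{p-(\kappa+1)}$ if $|s|\ge1$ and $|f^{(\kappa)}(s)|\le a_1|s|^{q-(\kappa+1)}$ if $|s|\le 1$; $(f_2)$ there is $\theta>2$ such that $0\le\theta F(s)\le f(s)s<f'(s)s^2$ for all $s>0$; $(f_3)$ $f$ is odd. Let $G$ be a closed subgroup of the group $O(N)$ of linear isometries of $\mathbb{R}^N$ and let $\phi:G\to\mathbb{Z}_2=\{-1,1\}$ be a continuous homomorphism satisfying $(A_\phi)$ if $\phi$ is surjective, there exists $\zeta\in\mathbb{R}^N$ such that $(\ker\phi)\zeta\ne G\zeta$. Let $D^{1,2}(\mathbb{R}^N)=\{u\in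 L^{2^*}(\mathbb{R}^N):\nabla u\in L^2(\mathbb{R}^N,\mathbb{R}^N)\}$ (weak gradient), with norm $\|u\|=\big(\int_{\mathbb{R}^N}|\nabla u|^2\big)^{1/2}$. For $u,v\in D^{1,2}(\mathbb{R}^N)$ set $J(u):=\frac12\|u\|^2-\int_{\mathbb{R}^N}F(u)$ and $J'(u)v:=\int_{\mathbb{R}^N}\nabla u\cdot\nabla v-\int_{\mathbb{R}^N}f(u)v$. For a closed subgroup $K$ of $O(N)$ and a continuous homomorphism $\psi:K\to\mathbb{Z}_2$ let $D^{1,2}(\mathbb{R}^N)^\psi$ be the set of all $u\in D^{1,2}(\mathbb{R}^N)$ such that, for every $g\in K$, $u(gx)=\psi(g)u(x)$ for a.e. $x\in\mathbb{R}^N$, and let $$\mathcal{N}^\psi:=\{u\in D^{1,2}(\mathbb{R}^N)^\psi:u\ne0,\ J'(u)u=0\},\qquad c^\psi:=\inf_{u\in\mathcal{N}^\psi}J(u).$$ For $\xi\in\mathbb{R}^N$ let $G_\xi:=\{g\in G:g\xi=\xi\}$, let $\phi|G_\xi$ be the restriction of $\phi$ to $G_\xi$, and let $|G/G_\xi|\in\mathbb{N}\cup\{\infty\}$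 be the cardinality of $G/G_\xi$. If $$c^{\phi}<|G/G_\xi|\,c^{\phi|G_\xi}\qquad\text{for every }\xi\in\mathbb{R}^N\text{ with }G_\xi\ne G$$ (the right-hand side being read in the extended reals), then $c^\phi$ is attained by $J$ on $\mathcal{N}^\phi$, that is, there exists $u\in\mathcal{N}^\phi$ with $J(u)=c^\phi$. -/

import Mathlib

open MeasureTheory
open scoped ContDiff

noncomputable section

namespace ScalarField

/-- The Euclidean space `ℝ^N`, with its Euclidean norm and Lebesgue measure. -/
abbrev Eucl (N : ℕ) := EuclideanSpace ℝ (Fin N)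

/-- The group `O(N)` of linear isometries of `ℝ^N`. -/
abbrev OGroup (N : ℕ) := Eucl N ≃ₗᵢ[ℝ] Eucl N

/-- The usual topology of `O(N)`, as a subset of the space of linear endomorphisms of `ℝ^N`. -/
instance (N : ℕ) : TopologicalSpace (OGroup N) :=
  TopologicalSpace.induced (fun g => (g.toContinuousLinearEquiv : Eucl N →L[ℝ] Eucl N))
    inferInstance

/-! ### Group actions -/

/-- The orbit `Gx = {gx : g ∈ G}`. -/
def orbit {N : ℕ} (G : Subgroup (OGroup N)) (x : Eucl N) : Set (Eucl N) :=
  {y | ∃ g ∈ G, y = g x}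

/-- The isotropy group `G_x = {g ∈ G : gx = x}`, as a subgroup of `O(N)`. -/
def isotropy {N : ℕ} (G : Subgroup (OGroup N)) (x : Eucl N) : Subgroup (OGroup N) where
  carrier := {g | g ∈ G ∧ g x = x}
  mul_mem' := by
    rintro a b ⟨ha, hax⟩ ⟨hb, hbx⟩
    exact ⟨G.mul_mem ha hb, by show a (b x) = x; rw [hbx, hax]⟩
  one_mem' := ⟨G.one_mem, rfl⟩
  inv_mem' := by
    rintro a ⟨ha, hax⟩
    refine ⟨G.inv_mem ha, ?_⟩
    show a.symm x = x
    rw [LinearIsometryEquiv.symm_apply_eq, hax]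

theorem isotropy_le {N : ℕ} (G : Subgroup (OGroup N)) (x : Eucl N) : isotropy G x ≤ G :=
  fun _ hg => hg.1

/-- The restriction `φ|G_ξ` of `φ : G → {1, -1}` to an isotropy group. -/
def restrictIsotropy {N : ℕ} {G : Subgroup (OGroup N)} (φ : G →* ℤˣ) (ξ : Eucl N) :
    isotropy G ξ →* ℤˣ :=
  φ.comp (Subgroup.inclusion (isotropy_le G ξ))

/-- Assumption `(A_φ)`: if `φ` is surjective, some `ζ` satisfies `(ker φ)ζ ≠ Gζ`. -/
def AssumptionA {N : ℕ} {G : Subgroup (OGroup N)} (φ : G →* ℤˣ) : Prop :=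
  Function.Surjective φ → ∃ ζ : Eucl N, orbit (φ.ker.map G.subtype) ζ ≠ orbit G ζ

/-- The cardinality `|G/G_ξ|`, possibly infinite, as an extended real number. -/
def orbitIndex {N : ℕ} (G : Subgroup (OGroup N)) (ξ : Eucl N) : EReal :=
  ((ENat.toENNReal (ENat.card (G ⧸ (isotropy G ξ).subgroupOf G)) : ENNReal) : EReal)

/-! ### The space `D^{1,2}(ℝ^N)` -/

/-- The critical Sobolev exponent `2^* = 2N/(N-2)`. -/
def critExp (N : ℕ) : ℝ := 2 * (N : ℝ) / ((N : ℝ) - 2)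

/-- The space `L^{2^*}(ℝ^N)` of classes of functions modulo equality almost everywhere. -/
abbrev LCrit (N : ℕ) := Lp ℝ (ENNReal.ofReal (critExp N)) (volume : Measure (Eucl N))

/-- `g` is a weak gradient of `u`: integration by parts holds against all test functions. -/
def IsWeakGradient {N : ℕ} (u : Eucl N → ℝ) (g : Eucl N → Eucl N) : Prop :=
  ∀ ψ : Eucl N → ℝ, ContDiff ℝ ∞ ψ → HasCompactSupport ψ → ∀ v : Eucl N,
    ∫ x, u x * fderiv ℝ ψ x v = -∫ x, inner ℝ (g x) v * ψ x

/-- `D^{1,2}(ℝ^N)`: the functions in `L^{2^*}` whose weak gradient is in `L^2`. -/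
def D12 (N : ℕ) : Set (LCrit N) :=
  {u | ∃ g : Lp (Eucl N) 2 (volume : Measure (Eucl N)), IsWeakGradient u g}

open Classical in
/-- The weak gradient of `u ∈ D^{1,2}(ℝ^N)`; it is unique by `grad_eq`. -/
def grad {N : ℕ} (u : LCrit N) : Lp (Eucl N) 2 (volume : Measure (Eucl N)) :=
  if h : ∃ g : Lp (Eucl N) 2 (volume : Measure (Eucl N)), IsWeakGradient u g then h.choose else 0

theorem isWeakGradient_grad {N : ℕ} {u : LCrit N} (hu : u ∈ D12 N) :
    IsWeakGradient u (grad u) := by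
  have h : ∃ g : Lp (Eucl N) 2 (volume : Measure (Eucl N)), IsWeakGradient u g := hu
  rw [grad, dif_pos h]
  exact h.choose_spec

/-- Weak gradients in `L^2` are unique. -/
theorem grad_eq {N : ℕ} {u : LCrit N} {g : Lp (Eucl N) 2 (volume : Measure (Eucl N))}
    (hg : IsWeakGradient u g) : grad u = g := by
  have hg' : IsWeakGradient u (grad u) := isWeakGradient_grad ⟨g, hg⟩
  have hloc : ∀ (k : Lp (Eucl N) 2 (volume : Measure (Eucl N))) (v : Eucl N),
      LocallyIntegrable (fun x => inner ℝ (k x) v) volume := fun k v =>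
    ((Lp.memLp k).inner_const v).locallyIntegrable (by norm_num)
  have key : ∀ v : Eucl N,
      (fun x => inner ℝ (grad u x) v) =ᵐ[volume] fun x => inner ℝ (g x) v := by
    intro v
    refine ae_eq_of_integral_contDiff_smul_eq (hloc _ v) (hloc _ v) ?_
    intro ψ hψ hc
    have h := neg_injective ((hg' ψ hψ hc v).symm.trans (hg ψ hψ hc v))
    simpa [mul_comm] using h
  apply Lp.ext
  have hall : ∀ᵐ x, ∀ i : Fin N, inner ℝ (grad u x) (EuclideanSpace.single i (1 : ℝ)) =
      inner ℝ (g x) (EuclideanSpace.single i (1 : ℝ)) := ae_all_iff.2 fun i => key _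
  filter_upwards [hall] with x hx
  ext i
  simpa [EuclideanSpace.inner_single_right] using hx i

/-- The norm `‖u‖ = (∫ |∇u|²)^{1/2}` of `D^{1,2}(ℝ^N)`. -/
def normD {N : ℕ} (u : LCrit N) : ℝ := Real.sqrt (∫ x, ‖grad u x‖ ^ 2)

/-- The scalar product `⟨u, v⟩ = ∫ ∇u · ∇v` of `D^{1,2}(ℝ^N)`. -/
def innerD {N : ℕ} (u v : LCrit N) : ℝ := ∫ x, inner ℝ (grad u x) (grad v x)

/-- The classes in `D^{1,2}(ℝ^N)` of `φ`-equivariant functions: `u(gx) = φ(g)u(x)` for every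
`g ∈ G` and almost every `x`. -/
def D12Equiv {N : ℕ} {G : Subgroup (OGroup N)} (φ : G →* ℤˣ) : Set (LCrit N) :=
  {u | u ∈ D12 N ∧ ∀ g : G, ∀ᵐ x : Eucl N, u ((g : OGroup N) x) = ((φ g : ℤ) : ℝ) * u x}

/-! ### The nonlinearity -/

/-- The primitive `F(s) = ∫_0^s f(t) dt`. -/
def primF (f : ℝ → ℝ) (s : ℝ) : ℝ := ∫ t in (0 : ℝ)..s, f t

/-- Assumption `(f₁)`: `f` is of class `C^{1,α}_loc` with `N/(2(N-2)) < α ≤ 1`, and `F`, `f`, `f'`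
are subcritical at infinity and supercritical at the origin. -/
def AssumptionF1 (N : ℕ) (f : ℝ → ℝ) : Prop :=
  (∃ α : ℝ, (N : ℝ) / (2 * ((N : ℝ) - 2)) < α ∧ α ≤ 1 ∧ ContDiff ℝ 1 f ∧
    ∀ R : ℝ, ∃ C : ℝ, ∀ s t : ℝ, |s| ≤ R → |t| ≤ R →
      |deriv f s - deriv f t| ≤ C * |s - t| ^ α) ∧
  ∃ a p q : ℝ, 0 < a ∧ 2 < p ∧ p < critExp N ∧ critExp N < q ∧ ∀ s : ℝ,
    (1 ≤ |s| → |primF f s| ≤ a * |s| ^ p ∧ |f s| ≤ a * |s| ^ (p - 1) ∧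
      |deriv f s| ≤ a * |s| ^ (p - 2)) ∧
    (|s| ≤ 1 → |primF f s| ≤ a * |s| ^ q ∧ |f s| ≤ a * |s| ^ (q - 1) ∧
      |deriv f s| ≤ a * |s| ^ (q - 2))

/-- Assumption `(f₂)`: for some `θ > 2`, `0 ≤ θF(s) ≤ f(s)s < f'(s)s²` for all `s > 0`. -/
def AssumptionF2 (f : ℝ → ℝ) : Prop :=
  ∃ θ : ℝ, 2 < θ ∧ ∀ s : ℝ, 0 < s →
    0 ≤ θ * primF f s ∧ θ * primF f s ≤ f s * s ∧ f s * s < deriv f s * s ^ 2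

/-- Assumption `(f₃)`: `f` is odd. -/
def AssumptionF3 (f : ℝ → ℝ) : Prop := ∀ s : ℝ, f (-s) = -f s

/-! ### The variational problem -/

/-- The energy `J(u) = ½‖u‖² - ∫ F(u)`. -/
def energyJ {N : ℕ} (f : ℝ → ℝ) (u : LCrit N) : ℝ :=
  1 / 2 * normD u ^ 2 - ∫ x, primF f (u x)

/-- The derivative `J'(u)v = ∫ ∇u · ∇v - ∫ f(u)v`. -/
def derivJ {N : ℕ} (f : ℝ → ℝ) (u v : LCrit N) : ℝ :=
  innerD u v - ∫ x, f (u x) * v x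

/-- The Nehari set `𝒩^φ` of nonzero `φ`-equivariant `u ∈ D^{1,2}(ℝ^N)` with `J'(u)u = 0`. -/
def nehari {N : ℕ} (f : ℝ → ℝ) {G : Subgroup (OGroup N)} (φ : G →* ℤˣ) : Set (LCrit N) :=
  {u | u ∈ D12Equiv φ ∧ u ≠ 0 ∧ derivJ f u u = 0}

/-- The least energy `c^φ`, the infimum of `J` on `𝒩^φ`, taken in the extended reals. -/
def leastEnergy {N : ℕ} (f : ℝ → ℝ) {G : Subgroup (OGroup N)} (φ : G →* ℤˣ) : EReal :=
  ⨅ u ∈ nehari f φ, ((energyJ f u : ℝ) : EReal)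

end ScalarField

end

open ScalarField

/-! The map u ↦ ∇u identifies D^{1,2} with a closed subspace `gradSpace` of L², a Hilbert space
which the Sobolev inequality maps continuously into L^{2*} (`potential`). There J has a locally
Lipschitz gradient `gradJ`. It commutes with rigid motions and, f being odd, with u ↦ -u, so it
preserves the space of φ-equivariant functions (`gradJ_mem_equivSpace`).

A minimizing sequence u_k on the Nehari set yields a Palais-Smale sequence w_k of equivariant
functions at the level c = c^φ, without any manifold structure (`exists_palaisSmale`). The ray
through u_k, pushed by one gradient step, still joins 0 to negative energy, so it crosses the Nehari
set, where the energy is at least c. Energies on the unpushed ray do not exceed J(u_k) → c. Hence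
the step gained almost nothing at the crossing parameter, and the gradient is small at that point of
the ray.

As c > 0, the sequence does not vanish: mollified at a fixed scale, w_k exceeds a fixed η in
absolute value at points y_k (`exists_lt_abs_mollify`). Among the subspaces to which a subsequence
of y_k stays within bounded distance, take W of least dimension, and ξ_k ∈ W near y_k. By
minimality, every isometry not fixing W pointwise moves ξ_k to infinity (`exists_subspace_near`).
Let K be the pointwise stabilizer of W in G. The translates w_k(· + ξ_k) have, along a subsequence,
a weak limit v which is nonzero, critical and equivariant under K. By equivariance w_k resembles a
rotated copy of ±v near each gξ_k, and copies for different cosets of K drift apart, so m J(v) ≤ c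
whenever there are m distinct cosets (`exists_profile`, `exists_profile_stabilizer`). Since J(v) >
0, the quotient G/K is finite.

If K = G, then v lies on the Nehari set and J(v) ≤ c, so v is a minimizer. Otherwise, W not being a
finite union of proper subspaces, some ζ ∈ W has G_ζ = K (`exists_isotropy_subgroupOf_eq`), and
|G/G_ζ| c^{φ|G_ζ} ≤ |G/K| J(v) ≤ c contradicts the strict inequality. -/

noncomputable section

open Filter Topology Metric
open scoped ENNReal NNReal

namespace ScalarField

section

open scoped Convolution

/-! ### Jensen's inequality for averages -/

section Averaging

variable {X Z : Type*} [MeasurableSpace X] [MeasurableSpace Z]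

/-- Jensen's inequality for powers and the lower Lebesgue integral. -/
theorem rpow_lintegral_le {ν : Measure Z} [IsProbabilityMeasure ν] {k : Z → ℝ≥0∞}
    (hk : AEMeasurable k ν) {p : ℝ} (hp : 1 ≤ p) :
    (∫⁻ z, k z ∂ν) ^ p ≤ ∫⁻ z, k z ^ p ∂ν := by
  have h := eLpNorm_le_eLpNorm_of_exponent_le (μ := ν) (f := k) (p := 1) (q := ENNReal.ofReal p)
    (by simpa using ENNReal.ofReal_le_ofReal hp) hk.aestronglyMeasurable
  have hp0 : 0 < p := by linarith
  rw [eLpNorm_one_eq_lintegral_enorm, eLpNorm_eq_lintegral_rpow_enorm_toReal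
    (by simpa using hp0) (by simp), ENNReal.toReal_ofReal hp0.le] at h
  simp only [enorm_eq_self] at h
  calc _ ≤ ((∫⁻ z, k z ^ p ∂ν) ^ (1 / p)) ^ p := ENNReal.rpow_le_rpow h hp0.le
    _ = _ := by rw [← ENNReal.rpow_mul, one_div_mul_cancel hp0.ne', ENNReal.rpow_one]

/-- Averages of functions bounded in `L^p` obey the same bound. -/
theorem lintegral_rpow_lintegral_le {μ : Measure X} {ν : Measure Z} [SFinite μ]
    [IsProbabilityMeasure ν] {k : X → Z → ℝ≥0∞} (hk : Measurable (Function.uncurry k)) {p : ℝ}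
    (hp : 1 ≤ p) {B : ℝ≥0∞} (hB : ∀ᵐ z ∂ν, ∫⁻ x, k x z ^ p ∂μ ≤ B) :
    ∫⁻ x, (∫⁻ z, k x z ∂ν) ^ p ∂μ ≤ B := by
  calc ∫⁻ x, (∫⁻ z, k x z ∂ν) ^ p ∂μ ≤ ∫⁻ x, ∫⁻ z, k x z ^ p ∂ν ∂μ :=
        lintegral_mono fun x => rpow_lintegral_le (hk.of_uncurry_left).aemeasurable hp
    _ = ∫⁻ z, ∫⁻ x, k x z ^ p ∂μ ∂ν := lintegral_lintegral_swap (hk.pow_const p).aemeasurable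
    _ ≤ ∫⁻ _, B ∂ν := lintegral_mono_ae hB
    _ = B := by simp

end Averaging

/-! ### Mollification and weak gradients -/

section Mollifier

variable {N : ℕ}

/-- A sequence of smooth bump functions whose supports shrink to the origin. -/
def bump (N n : ℕ) : ContDiffBump (0 : Eucl N) where
  -- The ratio of the two radii is 2 for every n; a bounded ratio is what almost everywhere
  -- convergence of the mollifications requires.
  rIn := 1 / (2 * ((n : ℝ) + 1))
  rOut := 1 / ((n : ℝ) + 1)
  rIn_pos := by positivity
  rIn_lt_rOut := by
    apply one_div_lt_one_div_of_lt <;> nlinarith [(Nat.cast_nonneg n : (0 : ℝ) ≤ n)]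

/-- The normalized bump functions. -/
def rho (N n : ℕ) : Eucl N → ℝ := (bump N n).normed volume

theorem bump_rOut (n : ℕ) : (bump N n).rOut = 1 / ((n : ℝ) + 1) := rfl

theorem rho_nonneg (n : ℕ) (x : Eucl N) : 0 ≤ rho N n x := (bump N n).nonneg_normed x

theorem contDiff_rho (n : ℕ) : ContDiff ℝ ∞ (rho N n) := (bump N n).contDiff_normed

theorem continuous_rho (n : ℕ) : Continuous (rho N n) := (bump N n).continuous_normed

theorem hasCompactSupport_rho (n : ℕ) : HasCompactSupport (rho N n) :=
  (bump N n).hasCompactSupport_normed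

theorem integrable_rho (n : ℕ) : Integrable (rho N n) := (bump N n).integrable_normed

theorem integral_rho (n : ℕ) : ∫ z, rho N n z = 1 := (bump N n).integral_normed

theorem rho_eq_zero {n : ℕ} {x : Eucl N} (hx : 1 / ((n : ℝ) + 1) ≤ ‖x‖) : rho N n x = 0 := by
  have h : x ∉ Function.support (rho N n) := by
    rw [rho, (bump N n).support_normed_eq, bump_rOut]
    simpa using hx
  simpa using h

/-- The probability measure with density the normalized bump function. -/
def rhoMeasure (N n : ℕ) : Measure (Eucl N) :=
  volume.withDensity fun x => ENNReal.ofReal (rho N n x)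

theorem measurable_ofReal_rho (n : ℕ) : Measurable fun x => ENNReal.ofReal (rho N n x) :=
  (continuous_rho n).measurable.ennreal_ofReal

instance (n : ℕ) : IsProbabilityMeasure (rhoMeasure N n) where
  measure_univ := by
    rw [rhoMeasure, withDensity_apply _ MeasurableSet.univ, Measure.restrict_univ,
      ← ofReal_integral_eq_lintegral_ofReal (integrable_rho n) (ae_of_all _ (rho_nonneg n)),
      integral_rho, ENNReal.ofReal_one]

theorem lintegral_rhoMeasure (n : ℕ) (k : Eucl N → ℝ≥0∞) (hk : Measurable k) :
    ∫⁻ z, k z ∂rhoMeasure N n = ∫⁻ z, ENNReal.ofReal (rho N n z) * k z := by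
  rw [rhoMeasure, lintegral_withDensity_eq_lintegral_mul _ (measurable_ofReal_rho n) hk]
  rfl

theorem ae_rhoMeasure_norm_le (n : ℕ) : ∀ᵐ z ∂rhoMeasure N n, ‖z‖ ≤ 1 / ((n : ℝ) + 1) := by
  rw [rhoMeasure, ae_withDensity_iff (measurable_ofReal_rho n)]
  refine ae_of_all _ fun z hz => ?_
  by_contra! h
  exact hz (by rw [rho_eq_zero h.le, ENNReal.ofReal_zero])

/-- The mollification of a function. -/
def mollify (n : ℕ) (u : Eucl N → ℝ) : Eucl N → ℝ :=
  rho N n ⋆[ContinuousLinearMap.lsmul ℝ ℝ, volume] u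

theorem mollify_apply (n : ℕ) (u : Eucl N → ℝ) (x : Eucl N) :
    mollify n u x = ∫ z, rho N n z * u (x - z) := rfl

theorem mollify_apply' (n : ℕ) (u : Eucl N → ℝ) (x : Eucl N) :
    mollify n u x = ∫ y, rho N n (x - y) * u y := by
  rw [mollify_apply, ← integral_sub_left_eq_self _ volume x]
  simp

/-- With the bump as a probability density, mollification is an average of translates, so Jensen's
inequality gives its L^p bounds. -/
theorem enorm_mollify_le (n : ℕ) {u : Eucl N → ℝ} (hu : Measurable u) (x : Eucl N) :
    ‖mollify n u x‖ₑ ≤ ∫⁻ z, ‖u (x - z)‖ₑ ∂rhoMeasure N n := by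
  rw [lintegral_rhoMeasure n _ (by fun_prop), mollify_apply]
  refine (enorm_integral_le_lintegral_enorm _).trans (le_of_eq ?_)
  refine lintegral_congr fun z => ?_
  rw [enorm_mul, Real.enorm_of_nonneg (rho_nonneg n z)]

theorem integrable_rho_mul (n : ℕ) {u : Eucl N → ℝ} (hu : LocallyIntegrable u) (x : Eucl N) :
    Integrable fun z => rho N n z * u (x - z) := by
  have := (hasCompactSupport_rho n).convolutionExists_left (ContinuousLinearMap.lsmul ℝ ℝ)
    (continuous_rho n) hu x
  exact this

theorem contDiff_mollify (n : ℕ) {u : Eucl N → ℝ} (hu : LocallyIntegrable u) :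
    ContDiff ℝ ∞ (mollify n u) :=
  (hasCompactSupport_rho n).contDiff_convolution_left _ (contDiff_rho n) hu

theorem ae_tendsto_mollify {u : Eucl N → ℝ} (hu : LocallyIntegrable u) :
    ∀ᵐ x, Tendsto (fun n => mollify n u x) atTop (𝓝 (u x)) := by
  refine ContDiffBump.ae_convolution_tendsto_right_of_locallyIntegrable (φ := bump N) (K := 2)
    tendsto_one_div_add_atTop_nhds_zero_nat (Eventually.of_forall fun n => ?_) hu
  simp only [bump]
  apply le_of_eq; field_simp

theorem enorm_mollify_sub_le (n : ℕ) {u : Eucl N → ℝ} (hu : Measurable u)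
    (hul : LocallyIntegrable u) (x : Eucl N) :
    ‖mollify n u x - u x‖ₑ ≤ ∫⁻ z, ‖u (x - z) - u x‖ₑ ∂rhoMeasure N n := by
  have h : mollify n u x - u x = ∫ z, rho N n z * (u (x - z) - u x) := by
    simp only [mul_sub]
    rw [integral_sub (integrable_rho_mul n hul x) ((integrable_rho n).mul_const _),
      integral_mul_const, integral_rho, one_mul, mollify_apply]
  rw [lintegral_rhoMeasure n _ (by fun_prop), h]
  refine (enorm_integral_le_lintegral_enorm _).trans (le_of_eq ?_)
  refine lintegral_congr fun z => ?_
  rw [enorm_mul, Real.enorm_of_nonneg (rho_nonneg n z)]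

/-- The derivative of a mollification is the mollification of the weak gradient. -/
theorem fderiv_mollify_apply (n : ℕ) {u : Eucl N → ℝ} {g : Eucl N → Eucl N}
    (hu : LocallyIntegrable u) (hg : IsWeakGradient u g) (x v : Eucl N) :
    fderiv ℝ (mollify n u) x v = ∫ z, rho N n z * inner ℝ (g (x - z)) v := by
  have hρ : ContDiff ℝ 1 (rho N n) := (contDiff_rho n).of_le (by norm_num)
  have h1 := (hasCompactSupport_rho n).hasFDerivAt_convolution_left
    (ContinuousLinearMap.lsmul ℝ ℝ) hρ hu x
  have hex : ConvolutionExistsAt (fderiv ℝ (rho N n)) u x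
      (ContinuousLinearMap.precompL (Eucl N) (ContinuousLinearMap.lsmul ℝ ℝ)) volume :=
    HasCompactSupport.convolutionExists_left _ ((hasCompactSupport_rho n).fderiv ℝ)
      (hρ.continuous_fderiv one_ne_zero) hu x
  change HasFDerivAt (mollify n u) _ x at h1
  rw [h1.fderiv, convolution_def, ContinuousLinearMap.integral_apply hex]
  simp only [ContinuousLinearMap.precompL_apply, ContinuousLinearMap.lsmul_apply, smul_eq_mul]
  rw [← integral_sub_left_eq_self _ volume x,
    ← integral_sub_left_eq_self (fun z => rho N n z * inner ℝ (g (x - z)) v) volume x]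
  -- The test function is the reflected bump; the sign from differentiating the reflection cancels
  -- the one from integrating by parts.
  have h2 := hg (fun y => rho N n (x - y)) ((contDiff_rho n).comp (contDiff_const.sub contDiff_id))
    ((hasCompactSupport_rho n).comp_homeomorph (Homeomorph.subLeft x)) v
  have h3 : ∀ y, fderiv ℝ (fun y => rho N n (x - y)) y v = - fderiv ℝ (rho N n) (x - y) v := by
    intro y
    have := ((hρ.differentiable one_ne_zero) (x - y)).hasFDerivAt.comp y
      ((hasFDerivAt_const x y).sub (hasFDerivAt_id y))
    have h4 : HasFDerivAt (fun y => rho N n (x - y)) _ y := this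
    rw [h4.fderiv]
    simp
  simp only [h3, mul_neg, integral_neg, neg_inj] at h2
  simp only [sub_sub_cancel]
  rw [show (∫ y, fderiv ℝ (rho N n) (x - y) v * u y) = ∫ y, u y * fderiv ℝ (rho N n) (x - y) v by
    simp only [mul_comm], h2]
  simp only [mul_comm]

theorem enorm_fderiv_mollify_le (n : ℕ) {u : Eucl N → ℝ} {g : Eucl N → Eucl N}
    (hu : LocallyIntegrable u) (hgm : Measurable g) (hg : IsWeakGradient u g) (x : Eucl N) :
    ‖fderiv ℝ (mollify n u) x‖ₑ ≤ ∫⁻ z, ‖g (x - z)‖ₑ ∂rhoMeasure N n := by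
  by_cases htop : ∫⁻ z, ‖g (x - z)‖ₑ ∂rhoMeasure N n = ⊤
  · rw [htop]; exact le_top
  rw [← ofReal_norm]
  refine ENNReal.ofReal_le_of_le_toReal (ContinuousLinearMap.opNorm_le_bound _
    ENNReal.toReal_nonneg fun v => ?_)
  rw [fderiv_mollify_apply n hu hg]
  have h : ‖∫ z, rho N n z * inner ℝ (g (x - z)) v‖ₑ ≤
      (∫⁻ z, ‖g (x - z)‖ₑ ∂rhoMeasure N n) * ‖v‖ₑ := by
    rw [lintegral_rhoMeasure n _ (by fun_prop), ← lintegral_mul_const' _ _ (by simp)]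
    refine (enorm_integral_le_lintegral_enorm _).trans (lintegral_mono fun z => ?_)
    rw [enorm_mul, Real.enorm_of_nonneg (rho_nonneg n z), mul_assoc]
    gcongr
    simpa [enorm_eq_nnnorm, ← ENNReal.coe_mul] using nnnorm_inner_le_nnnorm (𝕜 := ℝ) (g (x - z)) v
  have := ENNReal.toReal_mono (ENNReal.mul_ne_top htop (by simp)) h
  simpa using this

theorem lintegral_rpow_fderiv_mollify_le (n : ℕ) {u : Eucl N → ℝ} {g : Eucl N → Eucl N}
    (hu : LocallyIntegrable u) (hgm : Measurable g) (hg : IsWeakGradient u g) {p : ℝ}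
    (hp : 1 ≤ p) :
    ∫⁻ x, ‖fderiv ℝ (mollify n u) x‖ₑ ^ p ≤ ∫⁻ x, ‖g x‖ₑ ^ p := by
  refine (lintegral_mono fun x => ENNReal.rpow_le_rpow
    (enorm_fderiv_mollify_le n hu hgm hg x) (by linarith)).trans ?_
  refine lintegral_rpow_lintegral_le (k := fun x z => ‖g (x - z)‖ₑ) (by fun_prop) hp
    (ae_of_all _ fun z => le_of_eq ?_)
  exact lintegral_sub_right_eq_self (fun x => ‖g x‖ₑ ^ p) z

theorem lintegral_rpow_mollify_le (n : ℕ) {u : Eucl N → ℝ} (hu : Measurable u) {p : ℝ}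
    (hp : 1 ≤ p) :
    ∫⁻ x, ‖mollify n u x‖ₑ ^ p ≤ ∫⁻ x, ‖u x‖ₑ ^ p := by
  refine (lintegral_mono fun x => ENNReal.rpow_le_rpow
    (enorm_mollify_le n hu x) (by linarith)).trans ?_
  refine lintegral_rpow_lintegral_le (k := fun x z => ‖u (x - z)‖ₑ) (by fun_prop) hp
    (ae_of_all _ fun z => le_of_eq ?_)
  exact lintegral_sub_right_eq_self (fun x => ‖u x‖ₑ ^ p) z

end Mollifier

end

section

open scoped Convolution

/-- Fatou's lemma, in the form that passes uniform bounds to almost everywhere limits. -/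
theorem lintegral_le_of_ae_tendsto {X : Type*} [MeasurableSpace X] {μ : Measure X}
    {F : ℕ → X → ℝ≥0∞} {F₀ : X → ℝ≥0∞} (hF : ∀ n, AEMeasurable (F n) μ)
    (h : ∀ᵐ x ∂μ, Tendsto (fun n => F n x) atTop (𝓝 (F₀ x))) {B : ℝ≥0∞}
    (hB : ∀ n, ∫⁻ x, F n x ∂μ ≤ B) : ∫⁻ x, F₀ x ∂μ ≤ B := by
  calc ∫⁻ x, F₀ x ∂μ = ∫⁻ x, liminf (fun n => F n x) atTop ∂μ :=
        lintegral_congr_ae (h.mono fun x hx => hx.liminf_eq.symm)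
    _ ≤ liminf (fun n => ∫⁻ x, F n x ∂μ) atTop := lintegral_liminf_le' hF
    _ ≤ B := liminf_le_of_le (by isBoundedDefault) fun b hb => by
        obtain ⟨n, hn⟩ := hb.exists
        exact hn.trans (hB n)

/-! ### The critical exponent -/

section CritExp

variable {N : ℕ} [hN : Fact (5 ≤ N)]

include hN in
theorem five_le_cast : (5 : ℝ) ≤ N := by exact_mod_cast hN.out

variable (N) in
theorem two_lt_critExp : 2 < critExp N := by
  have := five_le_cast (N := N)
  rw [critExp, lt_div_iff₀ (by linarith)]; linarith

variable (N) in
theorem critExp_pos : 0 < critExp N := by linarith [two_lt_critExp N]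

variable (N) in
theorem inv_critExp : (critExp N)⁻¹ = 2⁻¹ - (N : ℝ)⁻¹ := by
  have := five_le_cast (N := N)
  have : (N : ℝ) - 2 ≠ 0 := by linarith
  rw [critExp]; field_simp

instance : Fact (1 ≤ ENNReal.ofReal (critExp N)) :=
  ⟨by simpa using ENNReal.ofReal_le_ofReal (by linarith [two_lt_critExp N] : 1 ≤ critExp N)⟩

/-- The relation 1/2* + 1/N = 1/2 pairs a function in L^{2*} with the gradient of a cutoff in L^N to
give a product in L². -/
instance : ENNReal.HolderTriple (ENNReal.ofReal (critExp N)) N 2 := ⟨by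
  have h5 := five_le_cast (N := N)
  have h := inv_critExp N
  rw [← ENNReal.ofReal_inv_of_pos (critExp_pos N), h, ← ENNReal.ofReal_natCast,
    ← ENNReal.ofReal_inv_of_pos (by linarith), ← ENNReal.ofReal_add _ (by positivity)]
  · simp [ENNReal.ofReal_inv_of_pos]
  · rw [← h]; exact inv_nonneg.2 (critExp_pos N).le⟩

end CritExp

/-! ### The Sobolev inequality for smooth functions -/

section Sobolev

variable {N : ℕ} [hN : Fact (5 ≤ N)]

variable (N) in
/-- The Gagliardo-Nirenberg-Sobolev inequality for functions with compact support. -/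
theorem exists_eLpNorm_le_of_hasCompactSupport :
    ∃ C : ℝ≥0, ∀ U : Eucl N → ℝ, ContDiff ℝ 1 U → HasCompactSupport U →
      eLpNorm U (ENNReal.ofReal (critExp N)) volume ≤ C * eLpNorm (fderiv ℝ U) 2 volume := by
  refine ⟨eLpNormLESNormFDerivOfEqInnerConst (volume : Measure (Eucl N)) 2, fun U hU hc => ?_⟩
  have h5 := five_le_cast (N := N)
  have := eLpNorm_le_eLpNorm_fderiv_of_eq_inner (μ := (volume : Measure (Eucl N))) hU hc
    (p := 2) (p' := (critExp N).toNNReal) (by norm_num)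
    (by simp; linarith [hN.out]) (by
      rw [Real.coe_toNNReal _ (critExp_pos N).le, inv_critExp]; simp)
  exact_mod_cast this

variable (N) in
/-- A smooth function equal to `1` on the unit ball and supported in the ball of radius `2`. -/
def cutoffBump : ContDiffBump (0 : Eucl N) := ⟨1, 2, by norm_num, by norm_num⟩

/-- The rescaled cutoff functions. -/
def cutoff (n : ℕ) (x : Eucl N) : ℝ := cutoffBump N (((n : ℝ) + 1)⁻¹ • x)

omit hN in
theorem contDiff_cutoff (n : ℕ) : ContDiff ℝ ∞ (cutoff (N := N) n) :=
  (cutoffBump N).contDiff.comp (contDiff_const_smul _)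

omit hN in
theorem cutoff_eq_one {n : ℕ} {x : Eucl N} (hx : ‖x‖ ≤ (n : ℝ) + 1) : cutoff n x = 1 := by
  refine (cutoffBump N).one_of_mem_closedBall ?_
  have : (0 : ℝ) < n + 1 := by positivity
  simp only [mem_closedBall_zero_iff, norm_smul, norm_inv, Real.norm_of_nonneg this.le, cutoffBump]
  rwa [inv_mul_le_iff₀ this, mul_one]

omit hN in
theorem cutoff_eq_zero {n : ℕ} {x : Eucl N} (hx : 2 * ((n : ℝ) + 1) ≤ ‖x‖) : cutoff n x = 0 := by
  refine (cutoffBump N).zero_of_le_dist ?_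
  have : (0 : ℝ) < n + 1 := by positivity
  simp only [dist_zero_right, norm_smul, norm_inv, Real.norm_of_nonneg this.le, cutoffBump]
  rwa [le_inv_mul_iff₀ this, mul_comm]

omit hN in
theorem hasCompactSupport_cutoff (n : ℕ) : HasCompactSupport (cutoff (N := N) n) :=
  HasCompactSupport.intro (isCompact_closedBall 0 (2 * ((n : ℝ) + 1))) fun x hx =>
    cutoff_eq_zero (by simpa using (le_of_lt (by simpa using hx)))

omit hN in
theorem abs_cutoff_le (n : ℕ) (x : Eucl N) : |cutoff n x| ≤ 1 :=
  (abs_of_nonneg (cutoffBump N).nonneg).trans_le (cutoffBump N).le_one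

omit hN in
variable (N) in
theorem exists_norm_fderiv_cutoff_le :
    ∃ K : ℝ, 0 ≤ K ∧ ∀ n (x : Eucl N), ‖fderiv ℝ (cutoff n) x‖ ≤ K / ((n : ℝ) + 1) := by
  obtain ⟨K, hK⟩ := ((cutoffBump N).hasCompactSupport.fderiv ℝ).exists_bound_of_continuous
    ((cutoffBump N).contDiff.continuous_fderiv (n := 1) one_ne_zero)
  refine ⟨K, (norm_nonneg _).trans (hK 0), fun n x => ?_⟩
  have hd : DifferentiableAt ℝ (cutoffBump N) (((n : ℝ) + 1)⁻¹ • x) :=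
    ((cutoffBump N).contDiff.differentiable (n := 1) one_ne_zero) _
  have h := hd.hasFDerivAt.comp x ((hasFDerivAt_id x).const_smul ((n : ℝ) + 1)⁻¹)
  have h' : HasFDerivAt (cutoff n) _ x := h
  rw [h'.fderiv]
  have : (0 : ℝ) < n + 1 := by positivity
  rw [div_eq_mul_inv]
  refine (ContinuousLinearMap.opNorm_comp_le _ _).trans ?_
  refine mul_le_mul (hK _) ?_ (norm_nonneg _) ((norm_nonneg _).trans (hK 0))
  refine (norm_smul_le _ _).trans ?_
  rw [norm_inv, Real.norm_of_nonneg this.le]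
  exact mul_le_of_le_one_right (by positivity) ContinuousLinearMap.norm_id_le

omit hN in
theorem fderiv_cutoff_eq_zero {n : ℕ} {x : Eucl N}
    (hx : ‖x‖ < (n : ℝ) + 1 ∨ 2 * ((n : ℝ) + 1) < ‖x‖) : fderiv ℝ (cutoff n) x = 0 := by
  rcases hx with hx | hx
  · have : cutoff n =ᶠ[𝓝 x] fun _ => (1 : ℝ) := by
      filter_upwards [(isOpen_lt continuous_norm continuous_const).mem_nhds hx] with y hy
      exact cutoff_eq_one (le_of_lt hy)
    rw [this.fderiv_eq]; simp
  · have : cutoff n =ᶠ[𝓝 x] fun _ => (0 : ℝ) := by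
      filter_upwards [(isOpen_lt continuous_const continuous_norm).mem_nhds hx] with y hy
      exact cutoff_eq_zero (le_of_lt hy)
    rw [this.fderiv_eq]; simp

variable (N) in
/-- The gradients of the rescaled cutoff functions are bounded in `L^N`. -/
theorem exists_eLpNorm_fderiv_cutoff_le :
    ∃ M : ℝ≥0∞, M ≠ ⊤ ∧ ∀ n, eLpNorm (fderiv ℝ (cutoff (N := N) n)) N volume ≤ M := by
  obtain ⟨K, hK0, hK⟩ := exists_norm_fderiv_cutoff_le N
  have h5 := five_le_cast (N := N)
  have hN0 : N ≠ 0 := by have := hN.out; omega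
  -- The L^N norm of a gradient is scale invariant: the size K/(n+1) is compensated by the radius
  -- 2(n+1) of the support, which leaves 2K.
  refine ⟨ENNReal.ofReal (2 * K) * volume (closedBall (0 : Eucl N) 1) ^ (1 / (N : ℝ)),
    ENNReal.mul_ne_top ENNReal.ofReal_ne_top (ENNReal.rpow_ne_top_of_nonneg (by positivity)
      (isCompact_closedBall _ _).measure_lt_top.ne), fun n => ?_⟩
  have hn : (0 : ℝ) < n + 1 := by positivity
  calc eLpNorm (fderiv ℝ (cutoff (N := N) n)) N volume
      ≤ eLpNorm ((closedBall (0 : Eucl N) (2 * ((n : ℝ) + 1))).indicator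
          fun _ => K / ((n : ℝ) + 1)) N volume := by
        refine eLpNorm_mono fun x => ?_
        by_cases hx : x ∈ closedBall (0 : Eucl N) (2 * ((n : ℝ) + 1))
        · rw [Set.indicator_of_mem hx]
          exact (hK n x).trans (le_abs_self _)
        · rw [fderiv_cutoff_eq_zero (Or.inr (by simpa using hx))]; simp
    _ = ENNReal.ofReal (2 * K) * volume (closedBall (0 : Eucl N) 1) ^ (1 / (N : ℝ)) := by
        rw [eLpNorm_indicator_const measurableSet_closedBall (by exact_mod_cast hN0) (by simp),
          Measure.addHaar_closedBall _ _ (by positivity), finrank_euclideanSpace_fin,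
          ENNReal.mul_rpow_of_nonneg _ _ (by positivity), ← mul_assoc,
          Real.enorm_of_nonneg (by positivity)]
        congr 1
        · rw [ENNReal.toReal_natCast, ENNReal.ofReal_rpow_of_nonneg (by positivity) (by positivity),
            ← ENNReal.ofReal_mul (by positivity), one_div, Real.pow_rpow_inv_natCast (by positivity) hN0]
          congr 1; field_simp
        · rw [Measure.addHaar_unitClosedBall_eq_addHaar_unitBall]; simp

omit hN in
theorem tendsto_eLpNorm_indicator_tail {p : ℝ≥0∞} (hp0 : p ≠ 0) (hp : p ≠ ⊤) {U : Eucl N → ℝ}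
    (hU : MemLp U p volume) :
    Tendsto (fun n : ℕ => eLpNorm ({x : Eucl N | (n : ℝ) + 1 ≤ ‖x‖}.indicator U) p volume)
      atTop (𝓝 0) := by
  have hms : ∀ n : ℕ, MeasurableSet {x : Eucl N | (n : ℝ) + 1 ≤ ‖x‖} := fun n =>
    measurableSet_le measurable_const measurable_norm
  simp only [eLpNorm_eq_lintegral_rpow_enorm_toReal hp0 hp]
  have hpos : 0 < p.toReal := ENNReal.toReal_pos hp0 hp
  have h : Tendsto (fun n : ℕ => ∫⁻ x, ‖{x : Eucl N | (n : ℝ) + 1 ≤ ‖x‖}.indicator U x‖ₑ ^ p.toReal)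
      atTop (𝓝 (∫⁻ _ : Eucl N, 0)) := by
    refine tendsto_lintegral_of_dominated_convergence' (fun x => ‖U x‖ₑ ^ p.toReal)
      (fun n => ((hU.1.indicator (hms n)).enorm.pow_const _)) (fun n => ae_of_all _ fun x => ?_)
      (lintegral_rpow_enorm_lt_top_of_eLpNorm_lt_top hp0 hp hU.2).ne (ae_of_all _ fun x => ?_)
    · exact ENNReal.rpow_le_rpow (enorm_indicator_le_enorm_self _ _) hpos.le
    · obtain ⟨m, hm⟩ := exists_nat_gt ‖x‖
      refine tendsto_const_nhds.congr' ?_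
      filter_upwards [eventually_ge_atTop m] with n hn
      have : (m : ℝ) ≤ n := by exact_mod_cast hn
      rw [Set.indicator_of_notMem]
      · simp [hpos]
      · simp only [Set.mem_ofPred_eq, not_le]; linarith
  have h2 := (ENNReal.continuous_rpow_const (y := 1 / p.toReal)).tendsto 0 |>.comp (by simpa using h)
  simpa [Function.comp_def, hpos, ENNReal.zero_rpow_of_pos, hp0, hp] using h2

variable (N) in
/-- The Sobolev inequality for smooth functions in `L^{2^*}`. -/
theorem exists_eLpNorm_le_of_contDiff :
    ∃ C : ℝ≥0, ∀ U : Eucl N → ℝ, ContDiff ℝ 1 U →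
      MemLp U (ENNReal.ofReal (critExp N)) volume →
      eLpNorm U (ENNReal.ofReal (critExp N)) volume ≤ C * eLpNorm (fderiv ℝ U) 2 volume := by
  obtain ⟨C, hC⟩ := exists_eLpNorm_le_of_hasCompactSupport N
  obtain ⟨M, hM, hM'⟩ := exists_eLpNorm_fderiv_cutoff_le N
  refine ⟨C, fun U hU hUr => ?_⟩
  have hr0 : ENNReal.ofReal (critExp N) ≠ 0 := by simpa using critExp_pos N
  have hcut : ∀ n, ContDiff ℝ 1 (cutoff (N := N) n) := fun n =>
    (contDiff_cutoff n).of_le (by norm_num)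
  set T : ℕ → ℝ≥0∞ := fun n =>
    eLpNorm ({x : Eucl N | (n : ℝ) + 1 ≤ ‖x‖}.indicator U) (ENNReal.ofReal (critExp N)) volume
  have hT : Tendsto T atTop (𝓝 0) := tendsto_eLpNorm_indicator_tail hr0 (by simp) hUr
  -- In the product rule the cross term lives where ‖x‖ ≥ n + 1, so Hölder's inequality bounds it by
  -- M times the tail of U in L^{2*}, which tends to 0.
  have key : ∀ n, eLpNorm (fun x => cutoff n x * U x) (ENNReal.ofReal (critExp N)) volume ≤
      C * (eLpNorm (fderiv ℝ U) 2 volume + T n * M) := by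
    intro n
    refine (hC _ ((hcut n).mul hU) ((hasCompactSupport_cutoff n).mul_right)).trans ?_
    gcongr
    have hfd : fderiv ℝ (fun x => cutoff n x * U x) = (fun x => cutoff n x • fderiv ℝ U x) +
        {x : Eucl N | (n : ℝ) + 1 ≤ ‖x‖}.indicator U • fderiv ℝ (cutoff n) := by
      funext x
      rw [show (fun x => cutoff n x * U x) = cutoff n * U from rfl,
        fderiv_mul ((hcut n).differentiable one_ne_zero x) (hU.differentiable one_ne_zero x)]
      simp only [Pi.add_apply, Pi.smul_apply', add_right_inj]
      by_cases hx : (n : ℝ) + 1 ≤ ‖x‖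
      · rw [Set.indicator_of_mem (by exact hx)]
      · rw [fderiv_cutoff_eq_zero (Or.inl (not_le.1 hx))]; simp
    have hdU := (hU.continuous_fderiv one_ne_zero).aestronglyMeasurable (μ := volume)
    have hdc := ((hcut n).continuous_fderiv one_ne_zero).aestronglyMeasurable (μ := volume)
    have hi : AEStronglyMeasurable ({x : Eucl N | (n : ℝ) + 1 ≤ ‖x‖}.indicator U) volume :=
      hU.continuous.aestronglyMeasurable.indicator
        (measurableSet_le measurable_const measurable_norm)
    rw [hfd]
    refine (eLpNorm_add_le ((hcut n).continuous.aestronglyMeasurable.smul hdU)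
      (hi.smul hdc) (by norm_num)).trans ?_
    gcongr
    · refine eLpNorm_mono fun x => ?_
      rw [Pi.smul_apply', norm_smul]
      exact mul_le_of_le_one_left (norm_nonneg _) (abs_cutoff_le n x)
    · refine (eLpNorm_smul_le_mul_eLpNorm (p := ENNReal.ofReal (critExp N)) (q := N) (r := 2)
        hdc hi).trans ?_
      gcongr
      exact hM' n
  refine (Lp.eLpNorm_lim_le_liminf_eLpNorm (f := fun n x => cutoff n x * U x)
    (fun n => ((hcut n).mul hU).continuous.aestronglyMeasurable) U
    (ae_of_all _ fun x => ?_)).trans ?_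
  · obtain ⟨m, hm⟩ := exists_nat_gt ‖x‖
    refine tendsto_const_nhds.congr' ?_
    filter_upwards [eventually_ge_atTop m] with n hn
    have : (m : ℝ) ≤ n := by exact_mod_cast hn
    rw [cutoff_eq_one (by linarith), one_mul]
  · have hlim : Tendsto (fun n => (C : ℝ≥0∞) * (eLpNorm (fderiv ℝ U) 2 volume + T n * M)) atTop
        (𝓝 (C * (eLpNorm (fderiv ℝ U) 2 volume + 0 * M))) := by
      refine ENNReal.Tendsto.const_mul (tendsto_const_nhds.add
        (ENNReal.Tendsto.mul_const hT (Or.inr hM))) (Or.inr (by simp))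
    rw [zero_mul, add_zero] at hlim
    rw [← hlim.liminf_eq]
    exact liminf_le_liminf (Eventually.of_forall key)

end Sobolev

end

section

open scoped Convolution

/-! ### The Sobolev inequality and translation estimates for weak gradients -/

section WeakSobolev

theorem eLpNorm_le_eLpNorm_of_lintegral_le {X E E' : Type*} [MeasurableSpace X] {μ : Measure X}
    [NormedAddCommGroup E] [NormedAddCommGroup E'] {f : X → E} {g : X → E'} {p : ℝ} (hp : 0 < p)
    (h : ∫⁻ x, ‖f x‖ₑ ^ p ∂μ ≤ ∫⁻ x, ‖g x‖ₑ ^ p ∂μ) :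
    eLpNorm f (ENNReal.ofReal p) μ ≤ eLpNorm g (ENNReal.ofReal p) μ := by
  rw [eLpNorm_eq_lintegral_rpow_enorm_toReal (by simpa) (by simp),
    eLpNorm_eq_lintegral_rpow_enorm_toReal (by simpa) (by simp), ENNReal.toReal_ofReal hp.le]
  exact ENNReal.rpow_le_rpow h (by positivity)

variable {N : ℕ} [hN : Fact (5 ≤ N)]

variable (N) in
/-- The Sobolev inequality for functions in `L^{2^*}` with weak gradient in `L^2`. -/
theorem exists_eLpNorm_le_of_isWeakGradient :
    ∃ C : ℝ≥0, ∀ (u : Eucl N → ℝ) (g : Eucl N → Eucl N), Measurable u → Measurable g →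
      MemLp u (ENNReal.ofReal (critExp N)) volume → IsWeakGradient u g →
      eLpNorm u (ENNReal.ofReal (critExp N)) volume ≤ C * eLpNorm g 2 volume := by
  obtain ⟨C, hC⟩ := exists_eLpNorm_le_of_contDiff N
  have hr1 : 1 ≤ critExp N := by linarith [two_lt_critExp N]
  refine ⟨C, fun u g hum hgm hu hg => ?_⟩
  have hul : LocallyIntegrable u := hu.locallyIntegrable Fact.out
  have hcd : ∀ n, ContDiff ℝ 1 (mollify n u) := fun n =>
    (contDiff_mollify n hul).of_le (by norm_num)
  refine Lp.eLpNorm_le_of_ae_tendsto (u := atTop) (f := fun n => mollify n u)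
    (Eventually.of_forall fun n => ?_) (fun n => (hcd n).continuous.aestronglyMeasurable)
    (ae_tendsto_mollify hul)
  have hmem : MemLp (mollify n u) (ENNReal.ofReal (critExp N)) volume :=
    ⟨(hcd n).continuous.aestronglyMeasurable, (eLpNorm_le_eLpNorm_of_lintegral_le
      (critExp_pos N) (lintegral_rpow_mollify_le n hum hr1)).trans_lt hu.2⟩
  refine (hC _ (hcd n) hmem).trans ?_
  gcongr
  have := eLpNorm_le_eLpNorm_of_lintegral_le two_pos
    (lintegral_rpow_fderiv_mollify_le n hul hgm hg one_le_two)
  simpa using this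

omit hN in
/-- Translations of a smooth function move it in `L^2` by at most the size of its gradient. -/
theorem lintegral_sub_translate_le_of_contDiff {U : Eucl N → ℝ} (hU : ContDiff ℝ 1 U)
    (h : Eucl N) :
    ∫⁻ x, ‖U (x - h) - U x‖ₑ ^ (2 : ℝ) ≤ ‖h‖ₑ ^ (2 : ℝ) * ∫⁻ x, ‖fderiv ℝ U x‖ₑ ^ (2 : ℝ) := by
  have hfc := hU.continuous_fderiv one_ne_zero
  -- The increment is the integral of the derivative along a segment, that is, an average over t in
  -- the unit interval, to which Jensen's inequality applies.
  have hprob : IsProbabilityMeasure (volume.restrict (Set.Ioc (0 : ℝ) 1)) := ⟨by simp⟩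
  have hpt : ∀ x, ‖U (x - h) - U x‖ₑ ≤
      ‖h‖ₑ * ∫⁻ t, ‖fderiv ℝ U (x - t • h)‖ₑ ∂volume.restrict (Set.Ioc (0 : ℝ) 1) := by
    intro x
    have hd : ∀ t : ℝ, HasDerivAt (fun t : ℝ => U (x - t • h)) (fderiv ℝ U (x - t • h) (-h)) t := by
      intro t
      have h1 : HasDerivAt (fun t : ℝ => x - t • h) (-h) t := by
        simpa using ((hasDerivAt_id t).smul_const h).const_sub x
      exact ((hU.differentiable one_ne_zero) _).hasFDerivAt.comp_hasDerivAt t h1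
    have hcont : Continuous fun t : ℝ => fderiv ℝ U (x - t • h) (-h) := by fun_prop
    have := intervalIntegral.integral_eq_sub_of_hasDerivAt (fun t _ => hd t)
      (hcont.intervalIntegrable 0 1)
    simp only [one_smul, zero_smul, sub_zero] at this
    rw [← this, intervalIntegral.integral_of_le zero_le_one, ← lintegral_const_mul' _ _ (by simp)]
    refine (enorm_integral_le_lintegral_enorm _).trans (lintegral_mono fun t => ?_)
    rw [mul_comm]
    simpa [enorm_eq_nnnorm, ← ENNReal.coe_mul] using (fderiv ℝ U (x - t • h)).le_opNNNorm (-h)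
  calc ∫⁻ x, ‖U (x - h) - U x‖ₑ ^ (2 : ℝ)
      ≤ ∫⁻ x, ‖h‖ₑ ^ (2 : ℝ) * (∫⁻ t, ‖fderiv ℝ U (x - t • h)‖ₑ
          ∂volume.restrict (Set.Ioc (0 : ℝ) 1)) ^ (2 : ℝ) := by
        refine lintegral_mono fun x => ?_
        rw [← ENNReal.mul_rpow_of_nonneg _ _ zero_le_two]
        exact ENNReal.rpow_le_rpow (hpt x) zero_le_two
    _ = ‖h‖ₑ ^ (2 : ℝ) * ∫⁻ x, (∫⁻ t, ‖fderiv ℝ U (x - t • h)‖ₑ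
          ∂volume.restrict (Set.Ioc (0 : ℝ) 1)) ^ (2 : ℝ) :=
        lintegral_const_mul' _ _ (by simp)
    _ ≤ _ := by
        refine mul_le_mul_right ?_ _
        refine lintegral_rpow_lintegral_le (k := fun x (t : ℝ) => ‖fderiv ℝ U (x - t • h)‖ₑ) ?_
          one_le_two (ae_of_all _ fun t => le_of_eq ?_)
        · exact Continuous.measurable (by unfold Function.uncurry; fun_prop)
        · exact lintegral_sub_right_eq_self (fun x => ‖fderiv ℝ U x‖ₑ ^ (2 : ℝ)) (t • h)

omit hN in
/-- Translations of a function move it in `L^2` by at most the size of its weak gradient. -/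
theorem lintegral_sub_translate_le {u : Eucl N → ℝ} {g : Eucl N → Eucl N}
    (hu : LocallyIntegrable u) (hgm : Measurable g) (hg : IsWeakGradient u g) (h : Eucl N) :
    ∫⁻ x, ‖u (x - h) - u x‖ₑ ^ (2 : ℝ) ≤ ‖h‖ₑ ^ (2 : ℝ) * ∫⁻ x, ‖g x‖ₑ ^ (2 : ℝ) := by
  have hcd : ∀ n, ContDiff ℝ 1 (mollify n u) := fun n =>
    (contDiff_mollify n hu).of_le (by norm_num)
  refine lintegral_le_of_ae_tendsto
    (F := fun n x => ‖mollify n u (x - h) - mollify n u x‖ₑ ^ (2 : ℝ)) (fun n => ?_) ?_ fun n => ?_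
  · have := (hcd n).continuous
    exact Continuous.aemeasurable (by fun_prop)
  · have h1 := ae_tendsto_mollify hu
    have h2 : ∀ᵐ x, Tendsto (fun n => mollify n u (x - h)) atTop (𝓝 (u (x - h))) :=
      (measurePreserving_sub_right volume h).quasiMeasurePreserving.ae h1
    filter_upwards [h1, h2] with x hx1 hx2
    exact ((ENNReal.continuous_rpow_const (y := 2)).tendsto _).comp
      ((continuous_enorm.tendsto _).comp (hx2.sub hx1))
  · refine (lintegral_sub_translate_le_of_contDiff (hcd n) h).trans ?_
    exact mul_le_mul_right (lintegral_rpow_fderiv_mollify_le n hu hgm hg one_le_two) _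

omit hN in
/-- Mollification is close to the identity in `L^2` on functions with bounded weak gradient. -/
theorem lintegral_mollify_sub_le (n : ℕ) {u : Eucl N → ℝ} {g : Eucl N → Eucl N}
    (hum : Measurable u) (hu : LocallyIntegrable u) (hgm : Measurable g)
    (hg : IsWeakGradient u g) :
    ∫⁻ x, ‖mollify n u x - u x‖ₑ ^ (2 : ℝ) ≤
      ENNReal.ofReal (1 / ((n : ℝ) + 1)) ^ (2 : ℝ) * ∫⁻ x, ‖g x‖ₑ ^ (2 : ℝ) := by
  refine (lintegral_mono fun x => ENNReal.rpow_le_rpow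
    (enorm_mollify_sub_le n hum hu x) zero_le_two).trans ?_
  -- The mollification error is an average of translation increments with ‖z‖ ≤ 1/(n+1).
  refine lintegral_rpow_lintegral_le (k := fun x z => ‖u (x - z) - u x‖ₑ) (by fun_prop) one_le_two ?_
  filter_upwards [ae_rhoMeasure_norm_le n] with z hz
  refine (lintegral_sub_translate_le hu hgm hg z).trans ?_
  gcongr
  rw [← ofReal_norm]
  exact ENNReal.ofReal_le_ofReal hz

end WeakSobolev

end

/-! ### Weak gradients under rigid motions -/

section

open scoped Convolution

/-- The space `L^2(ℝ^N; ℝ^N)`. -/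
abbrev LGrad (N : ℕ) := Lp (Eucl N) 2 (volume : Measure (Eucl N))

theorem IsWeakGradient.congr {N : ℕ} {u u' : Eucl N → ℝ} {g g' : Eucl N → Eucl N}
    (h : IsWeakGradient u g) (hu : u =ᵐ[volume] u') (hg : g =ᵐ[volume] g') :
    IsWeakGradient u' g' := by
  intro ψ hψ hc v
  have h1 : (fun x => u x * fderiv ℝ ψ x v) =ᵐ[volume] fun x => u' x * fderiv ℝ ψ x v := by
    filter_upwards [hu] with x hx; rw [hx]
  have h2 : (fun x => inner ℝ (g x) v * ψ x) =ᵐ[volume] fun x => inner ℝ (g' x) v * ψ x := by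
    filter_upwards [hg] with x hx; rw [hx]
  rw [← integral_congr_ae h1, h ψ hψ hc v, integral_congr_ae h2]

/-- Composition with a rigid motion rotates the weak gradient. -/
theorem IsWeakGradient.comp_rigid {N : ℕ} {u : Eucl N → ℝ} {g : Eucl N → Eucl N}
    (h : IsWeakGradient u g) (A : OGroup N) (b : Eucl N) :
    IsWeakGradient (fun x => u (A x + b)) (fun x => A.symm (g (A x + b))) := by
  intro ψ hψ hc v
  let e : Eucl N ≃ᵐ Eucl N := (A.toHomeomorph.trans (Homeomorph.addRight b)).toMeasurableEquiv
  have he : MeasurePreserving e volume volume :=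
    (measurePreserving_add_right volume b).comp A.measurePreserving
  have hex : ∀ x, e x = A x + b := fun x => rfl
  -- The test function is transported by the inverse motion, so that its derivative along A v
  -- corresponds to that of ψ along v.
  let χ : Eucl N → ℝ := fun y => ψ (A.symm (y - b))
  have hχe : ∀ x, χ (A x + b) = ψ x := fun x => by simp [χ]
  have hχ : ContDiff ℝ ∞ χ :=
    hψ.comp (A.symm.contDiff.comp (contDiff_id.sub contDiff_const))
  have hχc : HasCompactSupport χ :=
    hc.comp_homeomorph ((Homeomorph.subRight b).trans A.symm.toHomeomorph)
  have hd : ∀ x, fderiv ℝ χ (A x + b) (A v) = fderiv ℝ ψ x v := by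
    intro x
    have h1 : ψ = fun x => χ (A x + b) := by funext x; rw [hχe]
    have h2 : HasFDerivAt (fun x => A x + b) (A.toContinuousLinearEquiv : Eucl N →L[ℝ] Eucl N) x :=
      (A.toContinuousLinearEquiv.hasFDerivAt).add_const b
    have hχ1 : ContDiff ℝ 1 χ := hχ.of_le (by norm_num)
    have h3 := ((hχ1.differentiable one_ne_zero) (A x + b)).hasFDerivAt.comp x h2
    rw [show χ ∘ (fun x => A x + b) = ψ from h1.symm] at h3
    rw [h3.fderiv]; rfl
  have := h χ hχ hχc (A v)
  rw [← he.integral_comp' (fun y => u y * fderiv ℝ χ y (A v)),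
    ← he.integral_comp' (fun y => inner ℝ (g y) (A v) * χ y)] at this
  simp only [hex, hd, hχe] at this
  rw [this]
  simp only [← LinearIsometryEquiv.inner_map_map A.symm (_ : Eucl N) (A v), A.symm_apply_apply]

/-! ### D^{1,2} as a Hilbert space with an action of rigid motions -/

section Space

variable {N : ℕ} [hN : Fact (5 ≤ N)]

instance {p : ℝ≥0∞} : Fact (1 ≤ ENNReal.conjExponent p) := ⟨by simp [ENNReal.conjExponent]⟩

/-- Integration against a function in the conjugate Lebesgue space. -/
theorem exists_clm_integral_mul {w : Eucl N → ℝ}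
    (hw : MemLp w (ENNReal.conjExponent (ENNReal.ofReal (critExp N))) volume) :
    ∃ A : LCrit N →L[ℝ] ℝ, ∀ u : LCrit N, A u = ∫ x, u x * w x := by
  refine ⟨((ContinuousLinearMap.mul ℝ ℝ).lpPairing volume _ _).flip (hw.toLp w), fun u => ?_⟩
  rw [ContinuousLinearMap.flip_apply, ContinuousLinearMap.lpPairing_eq_integral]
  refine integral_congr_ae ?_
  filter_upwards [hw.coeFn_toLp] with x hx
  rw [hx]; rfl

omit hN in
theorem exists_clm_integral_inner {w : Eucl N → Eucl N} (hw : MemLp w 2 volume) :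
    ∃ B : LGrad N →L[ℝ] ℝ, ∀ g : LGrad N, B g = ∫ x, inner ℝ (g x) (w x) := by
  refine ⟨innerSL ℝ (hw.toLp w), fun g => ?_⟩
  rw [innerSL_apply_apply, real_inner_comm, L2.inner_def]
  refine integral_congr_ae ?_
  filter_upwards [hw.coeFn_toLp] with x hx
  rw [hx]

/-- Being a weak gradient is a family of continuous linear conditions. -/
theorem exists_clm_isWeakGradient {ψ : Eucl N → ℝ} (hψ : ContDiff ℝ ∞ ψ) (hc : HasCompactSupport ψ)
    (v : Eucl N) : ∃ A : LCrit N × LGrad N →L[ℝ] ℝ, ∀ z : LCrit N × LGrad N,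
      A z = (∫ x, z.1 x * fderiv ℝ ψ x v) + ∫ x, inner ℝ (z.2 x) v * ψ x := by
  have hψ1 : ContDiff ℝ 1 ψ := hψ.of_le (by norm_num)
  have h1 : Continuous fun x => fderiv ℝ ψ x v :=
    (hψ1.continuous_fderiv one_ne_zero).clm_apply continuous_const
  obtain ⟨A, hA⟩ := exists_clm_integral_mul (N := N)
    (h1.memLp_of_hasCompactSupport (hc.fderiv_apply ℝ v))
  obtain ⟨B, hB⟩ := exists_clm_integral_inner (N := N) (w := fun x => ψ x • v)
    ((hψ.continuous.smul continuous_const).memLp_of_hasCompactSupport hc.smul_right)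
  refine ⟨A.comp (.fst ℝ _ _) + B.comp (.snd ℝ _ _), fun z => ?_⟩
  simp [hA, hB, inner_smul_right, mul_comm]

variable (N) in
/-- The pairs `(u, ∇u)` with `u ∈ L^{2^*}` and `∇u ∈ L^2`. -/
def gradGraph : Submodule ℝ (LCrit N × LGrad N) where
  carrier := {z | IsWeakGradient z.1 z.2}
  add_mem' := by
    intro z z' hz hz' ψ hψ hc v
    obtain ⟨A, hA⟩ := exists_clm_isWeakGradient hψ hc v
    have h := hz ψ hψ hc v
    have h' := hz' ψ hψ hc v
    rw [← add_eq_zero_iff_eq_neg, ← hA] at h h' ⊢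
    rw [map_add, h, h', add_zero]
  zero_mem' := by
    intro ψ hψ hc v
    obtain ⟨A, hA⟩ := exists_clm_isWeakGradient hψ hc v
    rw [← add_eq_zero_iff_eq_neg, ← hA, map_zero]
  smul_mem' := by
    intro c z hz ψ hψ hc v
    obtain ⟨A, hA⟩ := exists_clm_isWeakGradient hψ hc v
    have h := hz ψ hψ hc v
    rw [← add_eq_zero_iff_eq_neg, ← hA] at h ⊢
    rw [map_smul, h, smul_zero]

theorem mem_gradGraph {z : LCrit N × LGrad N} : z ∈ gradGraph N ↔ IsWeakGradient z.1 z.2 := Iff.rfl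

/-- Each test function and direction asks one continuous linear functional to vanish, and this
survives limits. -/
theorem isClosed_gradGraph : IsClosed (gradGraph N : Set (LCrit N × LGrad N)) := by
  refine IsSeqClosed.isClosed fun s z hs hz ψ hψ hc v => ?_
  obtain ⟨A, hA⟩ := exists_clm_isWeakGradient hψ hc v
  rw [← add_eq_zero_iff_eq_neg, ← hA]
  refine tendsto_nhds_unique ((A.continuous.tendsto z).comp hz) ?_
  refine tendsto_const_nhds.congr fun n => ?_
  have h := hs n ψ hψ hc v
  rw [← add_eq_zero_iff_eq_neg, ← hA] at h
  exact h.symm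

variable (N) in
theorem exists_norm_le_of_isWeakGradient :
    ∃ C : ℝ, 0 ≤ C ∧ ∀ (u : LCrit N) (g : LGrad N), IsWeakGradient u g → ‖u‖ ≤ C * ‖g‖ := by
  obtain ⟨C, hC⟩ := exists_eLpNorm_le_of_isWeakGradient N
  refine ⟨C, C.2, fun u g h => ?_⟩
  have := hC u g (Lp.stronglyMeasurable u).measurable (Lp.stronglyMeasurable g).measurable
    (Lp.memLp u) h
  rw [Lp.norm_def, Lp.norm_def]
  have h2 := ENNReal.toReal_mono (ENNReal.mul_ne_top (by simp) (Lp.eLpNorm_ne_top g)) this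
  simpa using h2

/-- A function in `L^{2^*}` is determined by its weak gradient. -/
theorem eq_of_isWeakGradient {u u' : LCrit N} {g : LGrad N} (h : IsWeakGradient u g)
    (h' : IsWeakGradient u' g) : u = u' := by
  obtain ⟨C, -, hC⟩ := exists_norm_le_of_isWeakGradient N
  have h0 : (u, g) - (u', g) ∈ gradGraph N :=
    (gradGraph N).sub_mem (mem_gradGraph.2 h) (mem_gradGraph.2 h')
  have := hC _ _ (mem_gradGraph.1 h0)
  simpa [sub_eq_zero] using this

variable (N) in
/-- `D^{1,2}(ℝ^N)` as a Hilbert space: the space of weak gradients in `L^2`. -/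
def gradSpace : Submodule ℝ (LGrad N) := (gradGraph N).map (LinearMap.snd ℝ (LCrit N) (LGrad N))

theorem mem_gradSpace {g : LGrad N} : g ∈ gradSpace N ↔ ∃ u : LCrit N, IsWeakGradient u g := by
  simp [gradSpace, mem_gradGraph]

/-- The function with a given weak gradient, as a linear map. -/
def potentialLM : gradSpace N →ₗ[ℝ] LCrit N where
  toFun x := (mem_gradSpace.1 x.2).choose
  map_add' x y := by
    have hx := (mem_gradSpace.1 x.2).choose_spec
    have hy := (mem_gradSpace.1 y.2).choose_spec
    have h0 := (gradGraph N).add_mem (mem_gradGraph (z := (_, _)).2 hx)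
      (mem_gradGraph (z := (_, _)).2 hy)
    exact eq_of_isWeakGradient (mem_gradSpace.1 (x + y).2).choose_spec (mem_gradGraph.1 h0)
  map_smul' c x := by
    have hx := (mem_gradSpace.1 x.2).choose_spec
    have h0 := (gradGraph N).smul_mem c (mem_gradGraph (z := (_, _)).2 hx)
    exact eq_of_isWeakGradient (mem_gradSpace.1 (c • x).2).choose_spec (mem_gradGraph.1 h0)

theorem isWeakGradient_potentialLM (x : gradSpace N) : IsWeakGradient (potentialLM x) (x : LGrad N) :=
  (mem_gradSpace.1 x.2).choose_spec

/-- The function with a given weak gradient. -/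
def potential : gradSpace N →L[ℝ] LCrit N :=
  potentialLM.mkContinuousOfExistsBound (by
    obtain ⟨C, -, hC⟩ := exists_norm_le_of_isWeakGradient N
    exact ⟨C, fun x => hC _ _ (isWeakGradient_potentialLM x)⟩)

theorem isWeakGradient_potential (x : gradSpace N) : IsWeakGradient (potential x) (x : LGrad N) :=
  isWeakGradient_potentialLM x

attribute [irreducible] potential

theorem grad_potential (x : gradSpace N) : grad (potential x) = x :=
  grad_eq (isWeakGradient_potential x)

theorem potential_mem_D12 (x : gradSpace N) : potential x ∈ D12 N := ⟨x, isWeakGradient_potential x⟩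

theorem potential_injective : Function.Injective (potential (N := N)) := fun x y h => by
  ext1
  rw [← grad_potential x, h, grad_potential]

theorem potential_mk {u : LCrit N} {g : LGrad N} (h : IsWeakGradient u g) :
    potential ⟨g, mem_gradSpace.2 ⟨u, h⟩⟩ = u :=
  eq_of_isWeakGradient (isWeakGradient_potential ⟨g, mem_gradSpace.2 ⟨u, h⟩⟩) h

theorem exists_potential_eq {u : LCrit N} (hu : u ∈ D12 N) : ∃ x : gradSpace N, potential x = u :=
  ⟨_, potential_mk (isWeakGradient_grad hu)⟩

theorem cauchySeq_potential {x : ℕ → gradSpace N} (hx : CauchySeq x) :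
    CauchySeq fun n => potential (x n) := by
  have h := (potential (N := N)).uniformContinuous
  exact h.comp_cauchySeq hx

/-- If gradients converge in L², the Sobolev inequality makes their potentials Cauchy in L^{2*}, and
the limit pair stays in the closed graph. This gives the completeness used for Riesz representation
and weak compactness. -/
theorem isClosed_gradSpace : IsClosed (gradSpace N : Set (LGrad N)) := by
  refine IsSeqClosed.isClosed fun s g hs hg => ?_
  have hx : CauchySeq fun n => (⟨s n, hs n⟩ : gradSpace N) :=
    isUniformEmbedding_subtype_val.isUniformInducing.cauchy_map_iff.1 hg.cauchySeq
  obtain ⟨u, hu⟩ := cauchySeq_tendsto_of_complete (cauchySeq_potential hx)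
  have : (u, g) ∈ gradGraph N := by
    refine isClosed_gradGraph.mem_of_tendsto (hu.prodMk_nhds hg) (Eventually.of_forall fun n => ?_)
    exact mem_gradGraph.2 (isWeakGradient_potential _)
  exact mem_gradSpace.2 ⟨u, mem_gradGraph.1 this⟩

instance : CompleteSpace (gradSpace N) := isClosed_gradSpace.completeSpace_coe

theorem inner_gradSpace (x y : gradSpace N) :
    inner ℝ x y = ∫ z, inner ℝ ((x : LGrad N) z) ((y : LGrad N) z) := by
  rw [Submodule.coe_inner, L2.inner_def]

theorem innerD_potential (x y : gradSpace N) : innerD (potential x) (potential y) = inner ℝ x y := by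
  rw [innerD, grad_potential, grad_potential, inner_gradSpace]

theorem normD_potential (x : gradSpace N) : normD (potential x) = ‖x‖ := by
  rw [normD, grad_potential, ← Real.sqrt_sq (norm_nonneg x), ← real_inner_self_eq_norm_sq,
    inner_gradSpace]
  simp only [real_inner_self_eq_norm_sq]

omit hN in
theorem measurePreserving_rigid (A : OGroup N) (b : Eucl N) :
    MeasurePreserving (fun x : Eucl N => A x + b) volume volume :=
  (measurePreserving_add_right volume b).comp A.measurePreserving

theorem exists_rigid (A : OGroup N) (b : Eucl N) (x : gradSpace N) : ∃ y : gradSpace N,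
    (potential y =ᵐ[volume] fun z => potential x (A z + b)) ∧
      ((y : LGrad N) =ᵐ[volume] fun z => A.symm ((x : LGrad N) (A z + b))) := by
  have hT := measurePreserving_rigid A b
  obtain ⟨u, hu⟩ : ∃ u : LCrit N, u =ᵐ[volume] fun z => potential x (A z + b) :=
    ⟨Lp.compMeasurePreserving _ hT (potential x), Lp.coeFn_compMeasurePreserving _ hT⟩
  obtain ⟨h, hh⟩ : ∃ h : LGrad N, h =ᵐ[volume] fun z => (x : LGrad N) (A z + b) :=
    ⟨Lp.compMeasurePreserving _ hT (x : LGrad N), Lp.coeFn_compMeasurePreserving _ hT⟩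
  obtain ⟨g, hg⟩ : ∃ g : LGrad N, g =ᵐ[volume] fun z => A.symm ((x : LGrad N) (A z + b)) := by
    refine ⟨(A.symm.toContinuousLinearEquiv : Eucl N →L[ℝ] Eucl N).compLp h, ?_⟩
    filter_upwards [hh, (A.symm.toContinuousLinearEquiv : Eucl N →L[ℝ] Eucl N).coeFn_compLp h]
      with z hz hz'
    rw [hz', hz]; rfl
  have hw : IsWeakGradient u g :=
    ((isWeakGradient_potential x).comp_rigid A b).congr hu.symm hg.symm
  refine ⟨⟨g, mem_gradSpace.2 ⟨u, hw⟩⟩, ?_, hg⟩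
  have := potential_mk hw
  rwa [this]

/-- The action of rigid motions on `D^{1,2}(ℝ^N)` by composition. -/
def rigid (A : OGroup N) (b : Eucl N) (x : gradSpace N) : gradSpace N := (exists_rigid A b x).choose

theorem potential_rigid (A : OGroup N) (b : Eucl N) (x : gradSpace N) :
    potential (rigid A b x) =ᵐ[volume] fun z => potential x (A z + b) :=
  (exists_rigid A b x).choose_spec.1

theorem inner_rigid_rigid (A : OGroup N) (b : Eucl N) (x y : gradSpace N) :
    inner ℝ (rigid A b x) (rigid A b y) = inner ℝ x y := by
  let e : Eucl N ≃ᵐ Eucl N := (A.toHomeomorph.trans (Homeomorph.addRight b)).toMeasurableEquiv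
  have he : MeasurePreserving e volume volume := measurePreserving_rigid A b
  rw [inner_gradSpace x, ← he.integral_comp', inner_gradSpace]
  refine integral_congr_ae ?_
  filter_upwards [(exists_rigid A b x).choose_spec.2, (exists_rigid A b y).choose_spec.2]
    with z hz hz'
  rw [rigid, rigid, hz, hz', LinearIsometryEquiv.inner_map_map]
  rfl

theorem norm_rigid (A : OGroup N) (b : Eucl N) (x : gradSpace N) : ‖rigid A b x‖ = ‖x‖ := by
  rw [norm_eq_sqrt_real_inner, inner_rigid_rigid, ← norm_eq_sqrt_real_inner]

theorem rigid_rigid_symm (A : OGroup N) (b : Eucl N) (x : gradSpace N) :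
    rigid A b (rigid A.symm (-(A.symm b)) x) = x := by
  refine potential_injective (Lp.ext ?_)
  have h := (measurePreserving_rigid A b).quasiMeasurePreserving.ae
    (potential_rigid A.symm (-(A.symm b)) x)
  filter_upwards [potential_rigid A b (rigid A.symm (-(A.symm b)) x), h] with z hz hz'
  rw [hz, hz']
  simp

/-- The adjoint of an invertible isometry is its inverse; this moves a rigid motion onto the test
element in `gradJ_rigid`. -/
theorem inner_rigid_left (A : OGroup N) (b : Eucl N) (x y : gradSpace N) :
    inner ℝ (rigid A b x) y = inner ℝ x (rigid A.symm (-(A.symm b)) y) := by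
  conv_lhs => rw [← rigid_rigid_symm A b y]
  rw [inner_rigid_rigid]

end Space

end

/-! ### Pointwise inequalities for the nonlinearity -/

/-- The growth and monotonicity properties of the nonlinearity used in the variational argument. -/
structure IsAdmissible (r A p q θ : ℝ) (f : ℝ → ℝ) : Prop where
  two_lt_r : 2 < r
  A_pos : 0 < A
  two_lt_p : 2 < p
  p_lt_r : p < r
  r_lt_q : r < q
  two_lt_theta : 2 < θ
  differentiable : Differentiable ℝ f
  odd : ∀ s, f (-s) = -f s
  abs_deriv_le : ∀ s, |deriv f s| ≤ A * |s| ^ (r - 2)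
  abs_mul_le_of_one_le : ∀ s, 1 ≤ |s| → |f s * s| ≤ A * |s| ^ p
  abs_mul_le_of_le_one : ∀ s, |s| ≤ 1 → |f s * s| ≤ A * |s| ^ q
  theta_mul_nonneg : ∀ s, 0 < s → 0 ≤ θ * primF f s
  theta_mul_le : ∀ s, 0 < s → θ * primF f s ≤ f s * s
  mul_lt : ∀ s, 0 < s → f s * s < deriv f s * s ^ 2

theorem exists_isAdmissible {N : ℕ} [Fact (5 ≤ N)] {f : ℝ → ℝ} (hf1 : AssumptionF1 N f)
    (hf2 : AssumptionF2 f) (hf3 : AssumptionF3 f) :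
    ∃ A p q θ, IsAdmissible (critExp N) A p q θ f := by
  obtain ⟨⟨α, -, -, hC, -⟩, a, p, q, ha, hp, hpr, hrq, hb⟩ := hf1
  obtain ⟨θ, hθ, h2⟩ := hf2
  have hr := two_lt_critExp N
  have hmul : ∀ s e : ℝ, 2 < e → |f s| ≤ a * |s| ^ (e - 1) → |f s * s| ≤ a * |s| ^ e := by
    intro s e he h
    rw [abs_mul]
    calc |f s| * |s| ≤ a * |s| ^ (e - 1) * |s| := by gcongr
      _ = a * |s| ^ e := by
        rw [mul_assoc]
        congr 1
        conv_lhs => rw [← Real.rpow_one |s|, ← Real.rpow_mul (abs_nonneg s), one_mul]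
        rw [← Real.rpow_add_of_nonneg (abs_nonneg s) (by linarith) (by linarith), sub_add_cancel]
  refine ⟨a, p, q, θ, hr, ha, hp, hpr, hrq, hθ, hC.differentiable one_ne_zero, hf3, fun s => ?_,
    fun s hs => hmul s p hp ((hb s).1 hs).2.1, fun s hs => hmul s q (by linarith) ((hb s).2 hs).2.1,
    fun s hs => (h2 s hs).1, fun s hs => (h2 s hs).2.1, fun s hs => (h2 s hs).2.2⟩
  -- Since p < r < q, with r the critical exponent, the bounds at infinity and at the origin are
  -- both dominated by the single power r - 2.
  rcases le_total 1 |s| with hs | hs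
  · refine ((hb s).1 hs).2.2.trans ?_
    gcongr
  · refine ((hb s).2 hs).2.2.trans ?_
    gcongr ?_ * ?_
    exact Real.rpow_le_rpow_of_exponent_ge' (abs_nonneg s) hs (by linarith) (by linarith)

namespace IsAdmissible

variable {r A p q θ : ℝ} {f : ℝ → ℝ} (hf : IsAdmissible r A p q θ f)

include hf

theorem continuous : Continuous f := hf.differentiable.continuous

theorem zero : f 0 = 0 := by have := hf.odd 0; simp at this; linarith

theorem hasDerivAt_primF (s : ℝ) : HasDerivAt (primF f) (f s) s :=
  intervalIntegral.integral_hasDerivAt_right (hf.continuous.intervalIntegrable _ _)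
    (hf.continuous.stronglyMeasurableAtFilter _ _) hf.continuous.continuousAt

theorem continuous_primF : Continuous (primF f) :=
  continuous_iff_continuousAt.2 fun s => (hf.hasDerivAt_primF s).continuousAt

omit hf in
theorem primF_zero : primF f 0 = 0 := by simp [primF]

theorem primF_neg (s : ℝ) : primF f (-s) = primF f s := by
  rw [primF, primF, ← neg_zero, ← intervalIntegral.integral_comp_neg]
  simp only [hf.odd, intervalIntegral.integral_neg, neg_zero]
  rw [intervalIntegral.integral_symm, neg_neg] 

theorem primF_abs (s : ℝ) : primF f |s| = primF f s := by
  rcases abs_choice s with h | h <;> rw [h]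
  exact hf.primF_neg s

theorem mul_abs (s : ℝ) : f |s| * |s| = f s * s := by
  rcases abs_choice s with h | h <;> rw [h]
  rw [hf.odd]; ring

theorem abs_sub_le_of_abs_le {M a b : ℝ} (ha : |a| ≤ M) (hb : |b| ≤ M) :
    |f a - f b| ≤ A * M ^ (r - 2) * |a - b| := by
  have := (convex_closedBall (0 : ℝ) M).norm_image_sub_le_of_norm_deriv_le (f := f)
    (C := A * M ^ (r - 2)) (fun x _ => hf.differentiable x) (fun x hx => ?_)
    (x := b) (y := a) (by simpa using hb) (by simpa using ha)
  · simpa using this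
  · have hx' : |x| ≤ M := by simpa using hx
    refine (hf.abs_deriv_le x).trans ?_
    have := hf.A_pos
    have := hf.two_lt_r
    gcongr

theorem abs_sub_le (a b : ℝ) : |f a - f b| ≤ A * |a - b| * (|a| + |b|) ^ (r - 2) := by
  refine (hf.abs_sub_le_of_abs_le (M := |a| + |b|) (by simp) (by simp)).trans (le_of_eq (by ring))

theorem abs_le (a : ℝ) : |f a| ≤ A * |a| * |a| ^ (r - 2) := by
  simpa [hf.zero] using hf.abs_sub_le a 0

/-- The mean value inequality for F(s) - f(a)s, whose derivative f(s) - f(a) is itself Lipschitz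
small near a. This is the Taylor remainder behind the second-order bound on the energy. -/
theorem abs_primF_sub_le (a b : ℝ) :
    |primF f b - primF f a - f a * (b - a)| ≤ A * |b - a| * |b - a| * (|a| + |b|) ^ (r - 2) := by
  have hd : ∀ s, HasDerivAt (fun s => primF f s - f a * s) (f s - f a) s := fun s =>
    ((hf.hasDerivAt_primF s).sub ((hasDerivAt_id s).const_mul (f a))).congr_deriv (by simp)
  have := (convex_segment a b).norm_image_sub_le_of_norm_hasDerivWithin_le
    (f := fun s => primF f s - f a * s) (C := A * (|a| + |b|) ^ (r - 2) * |b - a|)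
    (fun s _ => (hd s).hasDerivWithinAt) (fun s hs => ?_) (left_mem_segment ℝ a b)
    (right_mem_segment ℝ a b)
  · rw [Real.norm_eq_abs, Real.norm_eq_abs] at this
    calc _ = |primF f b - f a * b - (primF f a - f a * a)| := by congr 1; ring
      _ ≤ _ := this
      _ = _ := by ring
  · have hA := hf.A_pos
    rw [segment_eq_uIcc] at hs
    have h1 : |s| ≤ |a| + |b| := by
      have := Set.mem_uIcc.1 hs
      rw [abs_le']
      rcases this with ⟨h1, h2⟩ | ⟨h1, h2⟩ <;> constructor <;>
        linarith [le_abs_self a, le_abs_self b, neg_le_abs a, neg_le_abs b, abs_nonneg a, abs_nonneg b]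
    have h2 : |s - a| ≤ |b - a| := by
      rw [abs_sub_comm b a, abs_sub_comm s a]
      rw [abs_sub_comm a s, abs_sub_comm a b]
      exact Set.abs_sub_left_of_mem_uIcc hs
    rw [Real.norm_eq_abs]
    refine (hf.abs_sub_le_of_abs_le (M := |a| + |b|) h1 (by simp)).trans ?_
    gcongr

theorem abs_primF_le (a : ℝ) : |primF f a| ≤ A * |a| * |a| * |a| ^ (r - 2) := by
  simpa [hf.zero, primF_zero] using hf.abs_primF_sub_le 0 a

theorem primF_nonneg (s : ℝ) : 0 ≤ primF f s := by
  rw [← hf.primF_abs]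
  rcases (abs_nonneg s).eq_or_lt with h | h
  · rw [← h, primF_zero]
  · exact nonneg_of_mul_nonneg_right (hf.theta_mul_nonneg _ h) (by linarith [hf.two_lt_theta])

theorem theta_mul_primF_le (s : ℝ) : θ * primF f s ≤ f s * s := by
  rw [← hf.primF_abs, ← hf.mul_abs]
  rcases (abs_nonneg s).eq_or_lt with h | h
  · rw [← h, primF_zero]; simp
  · exact hf.theta_mul_le _ h

theorem mul_nonneg (s : ℝ) : 0 ≤ f s * s :=
  (_root_.mul_nonneg (by linarith [hf.two_lt_theta]) (hf.primF_nonneg s)).trans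
    (hf.theta_mul_primF_le s)

theorem two_mul_primF_le (s : ℝ) : 2 * primF f s ≤ f s * s :=
  (mul_le_mul_of_nonneg_right hf.two_lt_theta.le (hf.primF_nonneg s)).trans
    (hf.theta_mul_primF_le s)

theorem deriv_pos {s : ℝ} (hs : 0 < s) : 0 < deriv f s :=
  pos_of_mul_pos_left ((hf.mul_nonneg s).trans_lt (hf.mul_lt s hs)) (by positivity)

theorem strictMonoOn : StrictMonoOn f (Set.Ici 0) :=
  strictMonoOn_of_deriv_pos (convex_Ici 0) hf.continuous.continuousOn fun x hx =>
    hf.deriv_pos (by simpa using hx)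

theorem mul_pos {s : ℝ} (hs : s ≠ 0) : 0 < f s * s := by
  rw [← hf.mul_abs]
  have h : 0 < |s| := abs_pos.2 hs
  have := hf.strictMonoOn (Set.mem_Ici.2 le_rfl) (Set.mem_Ici.2 h.le) h
  rw [hf.zero] at this
  exact _root_.mul_pos this h

/-- The quotient `f(s)/s` is increasing on the positive half-line. -/
theorem strictMonoOn_div : StrictMonoOn (fun s => f s / s) (Set.Ioi 0) := by
  have hd : ∀ x : ℝ, 0 < x → HasDerivAt (fun s => f s / s) ((deriv f x * x - f x) / x ^ 2) x := by
    intro x hx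
    exact ((hf.differentiable x).hasDerivAt.div (hasDerivAt_id x) hx.ne').congr_deriv (by simp)
  refine strictMonoOn_of_deriv_pos (convex_Ioi 0)
    (fun x hx => (hd x hx).continuousAt.continuousWithinAt) fun x hx => ?_
  have hx : 0 < x := by simpa using hx
  rw [(hd x hx).deriv]
  have := hf.mul_lt x hx
  refine div_pos ?_ (by positivity)
  nlinarith

/-- Along rays, the energy density is maximal at `1` once the Nehari identity is used. -/
theorem fiber_le (s : ℝ) {t : ℝ} (ht : 0 ≤ t) :
    1 / 2 * t ^ 2 * (f s * s) - primF f (t * s) ≤ 1 / 2 * (f s * s) - primF f s := by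
  have key : ∀ a : ℝ, 0 < a → 1 / 2 * t ^ 2 * (f a * a) - primF f (t * a) ≤
      1 / 2 * (f a * a) - primF f a := by
    intro a ha
    let k : ℝ → ℝ := fun t => 1 / 2 * t ^ 2 * (f a * a) - primF f (t * a)
    -- For t > 0 this derivative is t a² (f(a)/a - f(ta)/(ta)); as f(s)/s increases, it is
    -- nonnegative before t = 1 and nonpositive after.
    have hk : ∀ t, HasDerivAt k (t * (f a * a) - f (t * a) * a) t := by
      intro t
      have h1 := (((hasDerivAt_id t).pow 2).const_mul (1 / 2)).mul_const (f a * a)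
      have h2 := (hf.hasDerivAt_primF (t * a)).comp t ((hasDerivAt_id t).mul_const a)
      refine (h1.sub h2).congr_deriv ?_
      simp only [id]; ring
    have hkc : Continuous k := continuous_iff_continuousAt.2 fun t => (hk t).continuousAt
    have hk1 : k 1 = 1 / 2 * (f a * a) - primF f a := by simp [k]
    change k t ≤ _
    rw [← hk1]
    rcases le_total t 1 with h | h
    · refine monotoneOn_of_deriv_nonneg (convex_Icc 0 1) hkc.continuousOn
        (fun x _ => (hk x).differentiableAt.differentiableWithinAt) (fun x hx => ?_)
        (Set.mem_Icc.2 ⟨ht, h⟩) (Set.mem_Icc.2 ⟨zero_le_one, le_rfl⟩) h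
      rw [interior_Icc] at hx
      rw [(hk x).deriv]
      have h3 := hf.strictMonoOn_div.monotoneOn (Set.mem_Ioi.2 (_root_.mul_pos hx.1 ha)) ha
        (mul_le_of_le_one_left ha.le hx.2.le)
      rw [div_le_div_iff₀ (_root_.mul_pos hx.1 ha) ha] at h3
      nlinarith
    · refine antitoneOn_of_deriv_nonpos (convex_Ici 1) hkc.continuousOn
        (fun x _ => (hk x).differentiableAt.differentiableWithinAt) (fun x hx => ?_)
        (Set.mem_Ici.2 le_rfl) (Set.mem_Ici.2 h) h
      rw [interior_Ici] at hx
      have hx1 : 1 < x := hx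
      rw [(hk x).deriv]
      have h3 := hf.strictMonoOn_div.monotoneOn ha (Set.mem_Ioi.2 (_root_.mul_pos (by linarith) ha))
        (le_mul_of_one_le_left ha.le hx1.le)
      rw [div_le_div_iff₀ ha (_root_.mul_pos (by linarith) ha)] at h3
      nlinarith
  rcases (abs_nonneg s).eq_or_lt with h | h
  · have : s = 0 := abs_eq_zero.1 h.symm
    simp [this]
  · have := key |s| h
    rwa [hf.mul_abs, hf.primF_abs, ← abs_of_nonneg ht, ← abs_mul, hf.primF_abs,
      abs_of_nonneg ht] at this

/-- Since f increases on the half-line, its integral over [a, 2a] is at least a f(a). This bounds F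
from below by the quantity f(s)s, which the Nehari identity controls. -/
theorem mul_le_primF_two_mul (s : ℝ) : f s * s ≤ primF f (2 * s) := by
  rw [← hf.mul_abs, ← hf.primF_abs (2 * s), abs_mul, abs_two]
  set a := |s|
  have ha : 0 ≤ a := abs_nonneg s
  have h1 : primF f (2 * a) = primF f a + ∫ t in a..(2 * a), f t :=
    (intervalIntegral.integral_add_adjacent_intervals (hf.continuous.intervalIntegrable _ _)
      (hf.continuous.intervalIntegrable _ _)).symm
  have h2 : ∫ _ in a..(2 * a), f a ≤ ∫ t in a..(2 * a), f t := by
    refine intervalIntegral.integral_mono_on (by linarith) (by simp)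
      (hf.continuous.intervalIntegrable _ _) fun x hx => ?_
    exact hf.strictMonoOn.monotoneOn ha (ha.trans hx.1) hx.1
  rw [intervalIntegral.integral_const, smul_eq_mul] at h2
  have := hf.primF_nonneg a
  nlinarith

/-- The inequality θF(x) ≤ f(x)x says exactly that F(x)x^{-θ} has nonnegative derivative for x > 0.
-/
theorem rpow_mul_primF_le (s : ℝ) {t : ℝ} (ht : 1 ≤ t) : t ^ θ * primF f s ≤ primF f (t * s) := by
  have hθ := hf.two_lt_theta
  rw [← hf.primF_abs s, ← hf.primF_abs (t * s), abs_mul, abs_of_nonneg (by linarith : 0 ≤ t)]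
  rcases (abs_nonneg s).eq_or_lt with h | h
  · rw [← h, mul_zero, primF_zero, mul_zero]
  set a := |s|
  have hd : ∀ x : ℝ, 0 < x → HasDerivAt (fun x => primF f x * x ^ (-θ))
      (f x * x ^ (-θ) + primF f x * (-θ * x ^ (-θ - 1))) x := fun x hx =>
    (hf.hasDerivAt_primF x).mul (Real.hasDerivAt_rpow_const (Or.inl hx.ne'))
  have hmono : MonotoneOn (fun x => primF f x * x ^ (-θ)) (Set.Ioi 0) := by
    refine monotoneOn_of_deriv_nonneg (convex_Ioi 0)
      (fun x hx => (hd x hx).continuousAt.continuousWithinAt)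
      (fun x hx => (hd x (by simpa using hx)).differentiableAt.differentiableWithinAt)
      fun x hx => ?_
    have hx : 0 < x := by simpa using hx
    rw [(hd x hx).deriv, show x ^ (-θ) = x ^ (-θ - 1) * x by
      rw [← Real.rpow_add_one hx.ne', sub_add_cancel]]
    have := hf.theta_mul_le x hx
    have h1 : 0 < x ^ (-θ - 1) := by positivity
    nlinarith
  have h1 := hmono (Set.mem_Ioi.2 h) (Set.mem_Ioi.2 (_root_.mul_pos (by linarith) h))
    (le_mul_of_one_le_left h.le ht)
  simp only at h1
  have hta : 0 < t := by linarith
  rw [Real.mul_rpow hta.le h.le, Real.rpow_neg hta.le, Real.rpow_neg h.le] at h1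
  have hA : 0 < a ^ θ := by positivity
  have hT : 0 < t ^ θ := by positivity
  field_simp at h1
  linarith

theorem rpow_mul_mul_le (s : ℝ) {t : ℝ} (ht : 1 ≤ t) : t ^ θ * (f s * s) ≤ primF f (2 * t * s) := by
  have hT : 0 < t ^ θ := by have : 0 < t := by linarith
                            positivity
  calc t ^ θ * (f s * s) ≤ t ^ θ * primF f (2 * s) := by
        gcongr; exact hf.mul_le_primF_two_mul s
    _ ≤ primF f (t * (2 * s)) := hf.rpow_mul_primF_le _ ht
    _ = _ := by congr 1; ring

/-- The power of the nonlinearity is an arbitrarily small multiple of the critical one away from an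
error quadratic in the distance to a small number. -/
theorem exists_abs_mul_le {κ : ℝ} (hκ : 0 < κ) :
    ∃ K η : ℝ, 0 < K ∧ 0 < η ∧ ∀ w m : ℝ, |m| ≤ η → |f w * w| ≤ κ * |w| ^ r + K * |w - m| ^ (2 : ℝ) := by
  have hA := hf.A_pos
  have hp := hf.two_lt_p
  have hpr := hf.p_lt_r
  have hrq := hf.r_lt_q
  -- Below x the power q, and above Λ the power p, is at most κ times the critical one; only the
  -- range between them needs the quadratic term.
  obtain ⟨x, hxκ, hx0, hx1⟩ : ∃ x : ℝ, A * x ^ (q - r) < κ ∧ 0 < x ∧ x < 1 := by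
    have h1 : Tendsto (fun x : ℝ => A * x ^ (q - r)) (𝓝[>] 0) (𝓝 (A * 0 ^ (q - r))) :=
      ((Real.continuousAt_rpow_const 0 (q - r) (Or.inr (by linarith))).tendsto.const_mul A).mono_left
        nhdsWithin_le_nhds
    rw [Real.zero_rpow (by linarith), mul_zero] at h1
    obtain ⟨x, hx, hx'⟩ := ((h1.eventually_lt_const hκ).and
      (Ioo_mem_nhdsGT (zero_lt_one' ℝ))).exists
    exact ⟨x, hx, hx'.1, hx'.2⟩
  obtain ⟨Λ, hΛκ, hΛ1⟩ : ∃ Λ : ℝ, A * Λ ^ (p - r) < κ ∧ 1 ≤ Λ := by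
    have h1 := (tendsto_rpow_neg_atTop (y := r - p) (by linarith)).const_mul A
    rw [mul_zero, neg_sub] at h1
    exact ((h1.eventually_lt_const hκ).and (eventually_ge_atTop 1)).exists
  have hΛ0 : 0 < Λ := by linarith
  -- In the middle range |f(w)w| ≤ A Λ^{p-2}|w|², and |m| ≤ x/2 < |w|/2 gives |w| ≤ 2|w - m|, hence
  -- the factor 4.
  refine ⟨4 * (A * Λ ^ (p - 2)), x / 2, by positivity, by positivity, fun w m hm => ?_⟩
  have hsplit : ∀ e e' : ℝ, 0 < e' → 0 < |w| → |w| ^ e = |w| ^ (e - e') * |w| ^ e' := by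
    intro e e' _ hw
    rw [← Real.rpow_add hw, sub_add_cancel]
  rcases (abs_nonneg w).eq_or_lt with hw | hw
  · have : w = 0 := abs_eq_zero.1 hw.symm
    rw [this, mul_zero, abs_zero]
    positivity
  rcases le_or_gt |w| x with hwx | hwx
  · refine (hf.abs_mul_le_of_le_one w (by linarith)).trans ?_
    have h1 : A * |w| ^ q ≤ κ * |w| ^ r := by
      rw [hsplit q r (by linarith [hf.two_lt_r]) hw, ← mul_assoc]
      gcongr
      refine le_trans ?_ hxκ.le
      gcongr
    have h2 : 0 ≤ 4 * (A * Λ ^ (p - 2)) * |w - m| ^ (2 : ℝ) := by positivity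
    linarith
  have hwm : |w| ^ (2 : ℝ) ≤ 4 * |w - m| ^ (2 : ℝ) := by
    have h1 : |w| ≤ 2 * |w - m| := by
      have := abs_sub_abs_le_abs_sub w m
      linarith
    calc |w| ^ (2 : ℝ) ≤ (2 * |w - m|) ^ (2 : ℝ) := by gcongr
      _ = _ := by rw [Real.mul_rpow (by norm_num) (abs_nonneg _)]; norm_num
  rcases le_or_gt Λ |w| with hwΛ | hwΛ
  · refine (hf.abs_mul_le_of_one_le w (hΛ1.trans hwΛ)).trans ?_
    have h1 : A * |w| ^ p ≤ κ * |w| ^ r := by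
      rw [hsplit p r (by linarith [hf.two_lt_r]) hw, ← mul_assoc]
      gcongr
      refine le_trans ?_ hΛκ.le
      exact mul_le_mul_of_nonneg_left
        (Real.rpow_le_rpow_of_nonpos hΛ0 hwΛ (by linarith)) hA.le
    have h2 : 0 ≤ 4 * (A * Λ ^ (p - 2)) * |w - m| ^ (2 : ℝ) := by positivity
    linarith
  · have h1 : |f w * w| ≤ A * Λ ^ (p - 2) * |w| ^ (2 : ℝ) := by
      rcases le_total 1 |w| with h | h
      · refine (hf.abs_mul_le_of_one_le w h).trans ?_
        rw [hsplit p 2 two_pos hw, ← mul_assoc]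
        gcongr
      · refine (hf.abs_mul_le_of_le_one w h).trans ?_
        have h3 : (1 : ℝ) ≤ Λ ^ (p - 2) := Real.one_le_rpow hΛ1 (by linarith)
        calc A * |w| ^ q ≤ A * |w| ^ (2 : ℝ) := by
              have := Real.rpow_le_rpow_of_exponent_ge hw h (by linarith : 2 ≤ q)
              gcongr
          _ ≤ A * Λ ^ (p - 2) * |w| ^ (2 : ℝ) := by
              gcongr
              exact le_mul_of_one_le_right hA.le h3
    have h2 : A * Λ ^ (p - 2) * |w| ^ (2 : ℝ) ≤ A * Λ ^ (p - 2) * (4 * |w - m| ^ (2 : ℝ)) := by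
      gcongr
    have h3 : 0 ≤ κ * |w| ^ r := by positivity
    linarith

end IsAdmissible

/-! ### Hölder's inequality at critical growth -/

variable {N : ℕ} [hN : Fact (5 ≤ N)]

/-- Hölder's inequality for three functions, with weights 1/r, 1/r and (r-2)/r. -/
theorem lintegral_mul_mul_rpow_le {X : Type*} [MeasurableSpace X] {μ : Measure X} {r : ℝ}
    (hr : 2 < r) {d h m : X → ℝ≥0∞} (hd : AEMeasurable d μ) (hh : AEMeasurable h μ)
    (hm : AEMeasurable m μ) :
    ∫⁻ x, d x * h x * m x ^ (r - 2) ∂μ ≤ (∫⁻ x, d x ^ r ∂μ) ^ (1 / r) *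
      (∫⁻ x, h x ^ r ∂μ) ^ (1 / r) * ((∫⁻ x, m x ^ r ∂μ) ^ (1 / r)) ^ (r - 2) := by
  have hr0 : r ≠ 0 := by linarith
  have H := ENNReal.lintegral_prod_norm_pow_le (μ := μ) (Finset.univ : Finset (Fin 3))
    (f := ![fun x => d x ^ r, fun x => h x ^ r, fun x => m x ^ r])
    (p := ![1 / r, 1 / r, (r - 2) / r])
    (by intro i _; fin_cases i <;> simp <;> fun_prop)
    (by simp [Fin.sum_univ_three]; field_simp; ring)
    (by intro i _; have := hr0; have h2 : 0 ≤ r - 2 := by linarith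
        fin_cases i <;> simp <;> positivity)
  simp only [Fin.prod_univ_three, Matrix.cons_val_zero, Matrix.cons_val_one, Matrix.cons_val,
    ← ENNReal.rpow_mul] at H
  rw [← ENNReal.rpow_mul, show 1 / r * (r - 2) = (r - 2) / r by ring]
  simpa [mul_one_div_cancel hr0, mul_inv_cancel₀ hr0, mul_div_cancel₀ _ hr0] using H

/-- Hölder's inequality in the form used for the critical growth. -/
theorem integrable_and_abs_integral_le {φ : Eucl N → ℝ} (hφ : AEStronglyMeasurable φ volume)
    {A : ℝ} (hA : 0 ≤ A) (d h m m' : LCrit N)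
    (hb : ∀ᵐ x, |φ x| ≤ A * |d x| * |h x| * (|m x| + |m' x|) ^ (critExp N - 2)) :
    Integrable φ ∧ |∫ x, φ x| ≤ A * ‖d‖ * ‖h‖ * (‖m‖ + ‖m'‖) ^ (critExp N - 2) := by
  set r := critExp N with hr
  have hr2 : 2 < r := two_lt_critExp N
  have hr0 : ENNReal.ofReal r ≠ 0 := by simpa using critExp_pos N
  have hrt : (ENNReal.ofReal r).toReal = r := ENNReal.toReal_ofReal (by linarith)
  have hnorm : ∀ u : Eucl N → ℝ, (∫⁻ x, ‖u x‖ₑ ^ r) ^ (1 / r) = eLpNorm u (ENNReal.ofReal r) volume := by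
    intro u
    rw [eLpNorm_eq_lintegral_rpow_enorm_toReal hr0 (by simp), hrt]
  have hd := Lp.aestronglyMeasurable d
  have hh := Lp.aestronglyMeasurable h
  have hm := Lp.aestronglyMeasurable m
  have hm' := Lp.aestronglyMeasurable m'
  have hsum : eLpNorm (fun x => |m x| + |m' x|) (ENNReal.ofReal r) volume ≤
      eLpNorm m (ENNReal.ofReal r) volume + eLpNorm m' (ENNReal.ofReal r) volume := by
    refine (eLpNorm_add_le hm.norm hm'.norm Fact.out).trans (le_of_eq ?_)
    rw [eLpNorm_norm, eLpNorm_norm]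
  have key : ∫⁻ x, ‖φ x‖ₑ ≤ ENNReal.ofReal (A * ‖d‖ * ‖h‖ * (‖m‖ + ‖m'‖) ^ (r - 2)) := by
    calc ∫⁻ x, ‖φ x‖ₑ ≤ ∫⁻ x, ENNReal.ofReal A *
          (‖d x‖ₑ * ‖h x‖ₑ * ‖|m x| + |m' x|‖ₑ ^ (r - 2)) := by
          refine lintegral_mono_ae (hb.mono fun x hx => ?_)
          have h0 : 0 ≤ |m x| + |m' x| := by positivity
          rw [← ofReal_norm, ← ofReal_norm, ← ofReal_norm, ← ofReal_norm,
            ENNReal.ofReal_rpow_of_nonneg (norm_nonneg _) (by linarith),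
            ← ENNReal.ofReal_mul (norm_nonneg _), ← ENNReal.ofReal_mul (by positivity),
            ← ENNReal.ofReal_mul hA, Real.norm_of_nonneg h0]
          refine ENNReal.ofReal_le_ofReal (hx.trans (le_of_eq ?_))
          simp only [Real.norm_eq_abs]; ring
      _ = ENNReal.ofReal A * ∫⁻ x, ‖d x‖ₑ * ‖h x‖ₑ * ‖|m x| + |m' x|‖ₑ ^ (r - 2) :=
          lintegral_const_mul' _ _ (by simp)
      _ ≤ ENNReal.ofReal A * (eLpNorm d (ENNReal.ofReal r) volume *
            eLpNorm h (ENNReal.ofReal r) volume *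
            (eLpNorm m (ENNReal.ofReal r) volume +
              eLpNorm m' (ENNReal.ofReal r) volume) ^ (r - 2)) := by
          refine mul_le_mul_right ((lintegral_mul_mul_rpow_le hr2 hd.enorm hh.enorm
            (hm.norm.add hm'.norm).enorm).trans ?_) _
          have := hnorm (fun x => |m x| + |m' x|)
          simp only [Pi.add_apply, Real.norm_eq_abs]
          rw [hnorm, hnorm, this]
          gcongr
      _ = _ := by
          rw [Lp.norm_def, Lp.norm_def, Lp.norm_def, Lp.norm_def,
            ← ENNReal.toReal_add (Lp.eLpNorm_ne_top _) (Lp.eLpNorm_ne_top _),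
            ENNReal.toReal_rpow, mul_assoc A, mul_assoc A, ENNReal.ofReal_mul hA, ← ENNReal.toReal_mul,
            ← ENNReal.toReal_mul, ENNReal.ofReal_toReal]
          exact ENNReal.mul_ne_top
            (ENNReal.mul_ne_top (Lp.eLpNorm_ne_top _) (Lp.eLpNorm_ne_top _))
            (ENNReal.rpow_ne_top_of_nonneg (by linarith)
              (ENNReal.add_ne_top.2 ⟨Lp.eLpNorm_ne_top _, Lp.eLpNorm_ne_top _⟩))
  refine ⟨⟨hφ, key.trans_lt ENNReal.ofReal_lt_top⟩, ?_⟩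
  have h1 := (enorm_integral_le_lintegral_enorm φ).trans key
  rw [← ofReal_norm, ENNReal.ofReal_le_ofReal_iff (by positivity)] at h1
  exact h1

/-! ### The energy and its gradient -/

section Functional

variable {A p q θ : ℝ} {f : ℝ → ℝ} (hf : IsAdmissible (critExp N) A p q θ f)

include hf

omit hN in
theorem IsAdmissible.aestronglyMeasurable_comp (u : LCrit N) :
    AEStronglyMeasurable (fun x => f (u x)) volume :=
  hf.continuous.comp_aestronglyMeasurable (Lp.aestronglyMeasurable u)

omit hN in
theorem IsAdmissible.aestronglyMeasurable_primF_comp (u : LCrit N) :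
    AEStronglyMeasurable (fun x => primF f (u x)) volume :=
  hf.continuous_primF.comp_aestronglyMeasurable (Lp.aestronglyMeasurable u)

theorem IsAdmissible.integrable_primF (u : LCrit N) : Integrable fun x => primF f (u x) := by
  refine (integrable_and_abs_integral_le (hf.aestronglyMeasurable_primF_comp u) hf.A_pos.le u u u 0
    ?_).1
  filter_upwards [Lp.coeFn_zero ℝ (ENNReal.ofReal (critExp N)) (volume : Measure (Eucl N))] with x hx
  rw [hx]
  simpa using hf.abs_primF_le (u x)

theorem IsAdmissible.integrable_and_abs_integral_mul_le (u h : LCrit N) :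
    (Integrable fun x => f (u x) * h x) ∧
      |∫ x, f (u x) * h x| ≤ A * ‖u‖ * ‖h‖ * ‖u‖ ^ (critExp N - 2) := by
  have := integrable_and_abs_integral_le (φ := fun x => f (u x) * h x)
    ((hf.aestronglyMeasurable_comp u).mul (Lp.aestronglyMeasurable h)) hf.A_pos.le u h u 0 ?_
  · simpa using this
  filter_upwards [Lp.coeFn_zero ℝ (ENNReal.ofReal (critExp N)) (volume : Measure (Eucl N))] with x hx
  rw [hx, abs_mul]
  have := mul_le_mul_of_nonneg_right (hf.abs_le (u x)) (abs_nonneg (h x))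
  simp only [Pi.zero_apply, abs_zero, add_zero]
  linarith

theorem IsAdmissible.integrable_mul (u h : LCrit N) : Integrable fun x => f (u x) * h x :=
  (hf.integrable_and_abs_integral_mul_le u h).1

theorem IsAdmissible.abs_integral_sub_mul_le (u v h : LCrit N) :
    |(∫ x, f (u x) * h x) - ∫ x, f (v x) * h x| ≤
      A * ‖u - v‖ * ‖h‖ * (‖u‖ + ‖v‖) ^ (critExp N - 2) := by
  rw [← integral_sub (hf.integrable_mul u h) (hf.integrable_mul v h)]
  refine (integrable_and_abs_integral_le ((hf.integrable_mul u h).sub (hf.integrable_mul v h)).1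
    hf.A_pos.le (u - v) h u v ?_).2
  filter_upwards [Lp.coeFn_sub u v] with x hx
  rw [hx, Pi.sub_apply, Pi.sub_apply, ← sub_mul, abs_mul]
  have := mul_le_mul_of_nonneg_right (hf.abs_sub_le (u x) (v x)) (abs_nonneg (h x))
  linarith

theorem IsAdmissible.abs_integral_primF_sub_le (u h : LCrit N) :
    |(∫ x, primF f ((u + h) x)) - (∫ x, primF f (u x)) - ∫ x, f (u x) * h x| ≤
      A * ‖h‖ * ‖h‖ * (‖u‖ + ‖u + h‖) ^ (critExp N - 2) := by
  have hi := ((hf.integrable_primF (u + h)).sub (hf.integrable_primF u)).sub (hf.integrable_mul u h)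
  rw [← integral_sub (hf.integrable_primF (u + h)) (hf.integrable_primF u),
    ← integral_sub (f := fun x => primF f ((u + h) x) - primF f (u x))
      ((hf.integrable_primF (u + h)).sub (hf.integrable_primF u)) (hf.integrable_mul u h)]
  refine (integrable_and_abs_integral_le hi.1 hf.A_pos.le h h u (u + h) ?_).2
  filter_upwards [Lp.coeFn_add u h] with x hx
  have := hf.abs_primF_sub_le (u x) (u x + h x)
  simp only [Pi.sub_apply, hx, Pi.add_apply]
  simpa using this

variable {X : Type*} [NormedAddCommGroup X] [InnerProductSpace ℝ X] (ι : X →L[ℝ] LCrit N)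

/-- The functional y ↦ ∫ f(u)y is bounded by Hölder's inequality, hence represented by an element of
the Hilbert space. -/
theorem IsAdmissible.exists_gradient [CompleteSpace X] (x : X) :
    ∃ g : X, ∀ y, inner ℝ g y = inner ℝ x y - ∫ z, f (ι x z) * ι y z := by
  let L : X →ₗ[ℝ] ℝ :=
    { toFun := fun y => ∫ z, f (ι x z) * ι y z
      map_add' := fun y y' => by
        rw [map_add, ← integral_add (hf.integrable_mul _ _) (hf.integrable_mul _ _)]
        refine integral_congr_ae ?_
        filter_upwards [Lp.coeFn_add (ι y) (ι y')] with z hz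
        rw [hz, Pi.add_apply, mul_add]
      map_smul' := fun c y => by
        rw [map_smul, RingHom.id_apply, smul_eq_mul, ← integral_const_mul]
        refine integral_congr_ae ?_
        filter_upwards [Lp.coeFn_smul c (ι y)] with z hz
        rw [hz, Pi.smul_apply, smul_eq_mul]; ring }
  have hL : ∃ C : ℝ, ∀ y, ‖L y‖ ≤ C * ‖y‖ := by
    refine ⟨A * ‖ι x‖ * ‖ι‖ * ‖ι x‖ ^ (critExp N - 2), fun y => ?_⟩
    refine ((hf.integrable_and_abs_integral_mul_le (ι x) (ι y)).2).trans ?_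
    have h1 := ι.le_opNorm y
    have h2 : 0 ≤ A * ‖ι x‖ * ‖ι x‖ ^ (critExp N - 2) := by
      have := hf.A_pos; positivity
    calc _ = A * ‖ι x‖ * ‖ι x‖ ^ (critExp N - 2) * ‖ι y‖ := by ring
      _ ≤ A * ‖ι x‖ * ‖ι x‖ ^ (critExp N - 2) * (‖ι‖ * ‖y‖) := by gcongr
      _ = _ := by ring
  refine ⟨x - (InnerProductSpace.toDual ℝ X).symm (L.mkContinuousOfExistsBound hL), fun y => ?_⟩
  rw [inner_sub_left, InnerProductSpace.toDual_symm_apply]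
  rfl

/-- The energy on a Hilbert space mapped continuously into `L^{2^*}`. -/
def energyX (f : ℝ → ℝ) (x : X) : ℝ := 1 / 2 * ‖x‖ ^ 2 - ∫ z, primF f (ι x z)

omit hf

section Gradient

variable [CompleteSpace X]

/-- The gradient of the energy. -/
def gradJ (hf : IsAdmissible (critExp N) A p q θ f) (x : X) : X := (hf.exists_gradient ι x).choose

theorem inner_gradJ (hf : IsAdmissible (critExp N) A p q θ f) (x y : X) :
    inner ℝ (gradJ ι hf x) y = inner ℝ x y - ∫ z, f (ι x z) * ι y z :=
  (hf.exists_gradient ι x).choose_spec y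

/-- The difference of the gradients is tested against itself, and one factor of its norm cancels. -/
theorem norm_gradJ_sub_le (hf : IsAdmissible (critExp N) A p q θ f) (x y : X) :
    ‖gradJ ι hf x - gradJ ι hf y‖ ≤
      (1 + A * ‖ι‖ ^ 2 * (‖ι x‖ + ‖ι y‖) ^ (critExp N - 2)) * ‖x - y‖ := by
  set M := (‖ι x‖ + ‖ι y‖) ^ (critExp N - 2)
  have hM : 0 ≤ M := by positivity
  have hA := hf.A_pos
  set g := gradJ ι hf x - gradJ ι hf y with hg
  have h1 : ‖g‖ * ‖g‖ ≤ (1 + A * ‖ι‖ ^ 2 * M) * ‖x - y‖ * ‖g‖ := by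
    have h0 : inner ℝ g g = inner ℝ (x - y) g -
        ((∫ z, f (ι x z) * ι g z) - ∫ z, f (ι y z) * ι g z) := by
      conv_lhs => rw [hg]
      rw [inner_sub_left, inner_gradJ, inner_gradJ, inner_sub_left]; ring
    rw [← real_inner_self_eq_norm_mul_norm, h0]
    have h2 := real_inner_le_norm (x - y) g
    have h3 := (neg_abs_le _).trans' (neg_le_neg (hf.abs_integral_sub_mul_le (ι x) (ι y) (ι g)))
    have h4 : A * ‖ι x - ι y‖ * ‖ι g‖ * M ≤ A * (‖ι‖ * ‖x - y‖) * (‖ι‖ * ‖g‖) * M := by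
      rw [← map_sub]
      gcongr
      · exact ι.le_opNorm _
      · exact ι.le_opNorm _
    linarith
  rcases (norm_nonneg g).eq_or_lt with h | h
  · rw [← h]; positivity
  · exact le_of_mul_le_mul_right h1 h

/-- The quadratic part expands exactly, and the potential part has the Taylor remainder of
`abs_integral_primF_sub_le`. This makes gradient steps quantitative without a second derivative. -/
theorem energyX_add_le (hf : IsAdmissible (critExp N) A p q θ f) (x h : X) :
    energyX ι f (x + h) ≤ energyX ι f x + inner ℝ (gradJ ι hf x) h +
      (1 / 2 + A * ‖ι‖ ^ 2 * (‖ι x‖ + ‖ι (x + h)‖) ^ (critExp N - 2)) * ‖h‖ ^ 2 := by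
  rw [energyX, energyX, inner_gradJ, norm_add_sq_real]
  have h1 := (neg_abs_le _).trans' (neg_le_neg (hf.abs_integral_primF_sub_le (ι x) (ι h)))
  rw [← map_add] at h1
  set M := (‖ι x‖ + ‖ι (x + h)‖) ^ (critExp N - 2)
  have hM : 0 ≤ M := by positivity
  have hA := hf.A_pos
  have h4 : A * ‖ι h‖ * ‖ι h‖ * M ≤ A * (‖ι‖ * ‖h‖) * (‖ι‖ * ‖h‖) * M := by
    gcongr
    · exact ι.le_opNorm _
    · exact ι.le_opNorm _
  linarith

end Gradient

end Functional

/-! ### The geometry of the Nehari set and Palais-Smale sequences -/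

section MountainPass

variable {N : ℕ} [hN : Fact (5 ≤ N)] {A p q θ : ℝ} {f : ℝ → ℝ}
  (hf : IsAdmissible (critExp N) A p q θ f) {X : Type*} [NormedAddCommGroup X]
  [InnerProductSpace ℝ X] (ι : X →L[ℝ] LCrit N)

include hf

/-- Subtracting half the Nehari functional cancels the norm and leaves a pointwise nonnegative
density. On the Nehari set, and in the limit along Palais-Smale sequences, the energy is thus a
local quantity. -/
theorem energyX_sub_eq (x : X) :
    energyX ι f x - 1 / 2 * (‖x‖ ^ 2 - ∫ z, f (ι x z) * ι x z) =
      ∫ z, (1 / 2 * (f (ι x z) * ι x z) - primF f (ι x z)) := by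
  rw [integral_sub ((hf.integrable_mul _ _).const_mul _) (hf.integrable_primF _),
    integral_const_mul, energyX]
  ring

theorem energyX_eq_of_nehari {x : X} (hx : ‖x‖ ^ 2 = ∫ z, f (ι x z) * ι x z) :
    energyX ι f x = ∫ z, (1 / 2 * (f (ι x z) * ι x z) - primF f (ι x z)) := by
  have h := energyX_sub_eq hf ι x
  rw [hx, sub_self, mul_zero, sub_zero] at h
  exact h

theorem half_nehari_le_energyX (x : X) :
    1 / 2 * (‖x‖ ^ 2 - ∫ z, f (ι x z) * ι x z) ≤ energyX ι f x := by
  have h := energyX_sub_eq hf ι x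
  have : 0 ≤ ∫ z, (1 / 2 * (f (ι x z) * ι x z) - primF f (ι x z)) :=
    integral_nonneg fun z => by
      have := hf.two_mul_primF_le (ι x z)
      simp only [Pi.zero_apply]; linarith
  linarith

theorem energyX_le (x : X) : energyX ι f x ≤ 1 / 2 * ‖x‖ ^ 2 := by
  have : 0 ≤ ∫ z, primF f (ι x z) := integral_nonneg fun z => hf.primF_nonneg _
  rw [energyX]; linarith

/-- This is where θ > 2 bounds minimizing sequences. -/
theorem mul_norm_sq_le_energyX_of_nehari {x : X} (hx : ‖x‖ ^ 2 = ∫ z, f (ι x z) * ι x z) :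
    (1 / 2 - 1 / θ) * ‖x‖ ^ 2 ≤ energyX ι f x := by
  have hθ := hf.two_lt_theta
  have h : θ * ∫ z, primF f (ι x z) ≤ ∫ z, f (ι x z) * ι x z := by
    rw [← integral_const_mul]
    exact integral_mono ((hf.integrable_primF _).const_mul _) (hf.integrable_mul _ _)
      fun z => hf.theta_mul_primF_le _
  rw [← hx] at h
  have h2 : ∫ z, primF f (ι x z) ≤ 1 / θ * ‖x‖ ^ 2 := by
    rw [one_div, le_inv_mul_iff₀ (by linarith)]; exact h
  rw [energyX]; linarith

/-- Replacing ‖x‖² by the integral of f(u)u reduces the claim to the pointwise inequality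
`fiber_le`. -/
theorem energyX_smul_le_of_nehari {x : X} (hx : ‖x‖ ^ 2 = ∫ z, f (ι x z) * ι x z) {t : ℝ}
    (ht : 0 ≤ t) : energyX ι f (t • x) ≤ energyX ι f x := by
  have hae : ∀ᵐ z, ι (t • x) z = t * ι x z := by
    rw [map_smul]
    filter_upwards [Lp.coeFn_smul t (ι x)] with z hz
    rw [hz, Pi.smul_apply, smul_eq_mul]
  have h1 : energyX ι f (t • x) =
      ∫ z, (1 / 2 * t ^ 2 * (f (ι x z) * ι x z) - primF f (ι (t • x) z)) := by
    rw [integral_sub ((hf.integrable_mul _ _).const_mul _) (hf.integrable_primF _),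
      integral_const_mul, ← hx, energyX, norm_smul, mul_pow, Real.norm_eq_abs, sq_abs]
    ring
  rw [h1, energyX_eq_of_nehari hf ι hx]
  refine integral_mono_ae (((hf.integrable_mul _ _).const_mul _).sub (hf.integrable_primF _))
    (((hf.integrable_mul _ _).const_mul _).sub (hf.integrable_primF _)) (hae.mono fun z hz => ?_)
  simp only [hz]
  exact hf.fiber_le (ι x z) ht

theorem energyX_two_mul_smul_le (x : X) {t : ℝ} (ht : 1 ≤ t) :
    energyX ι f ((2 * t) • x) ≤ 2 * t ^ 2 * ‖x‖ ^ 2 - t ^ θ * ∫ z, f (ι x z) * ι x z := by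
  have h : ∫ z, t ^ θ * (f (ι x z) * ι x z) ≤ ∫ z, primF f (ι ((2 * t) • x) z) := by
    refine integral_mono_ae ((hf.integrable_mul _ _).const_mul _) (hf.integrable_primF _) ?_
    rw [map_smul]
    filter_upwards [Lp.coeFn_smul (2 * t) (ι x)] with z hz
    rw [hz, Pi.smul_apply, smul_eq_mul]
    exact hf.rpow_mul_mul_le _ ht
  rw [integral_const_mul] at h
  rw [energyX, norm_smul, mul_pow, Real.norm_eq_abs, sq_abs]
  linarith

/-- On the Nehari set the energy at (2t)x is at most (2t² - t^θ)‖x‖², and the sign of the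
coefficient does not depend on x, so one T serves all rays. -/
theorem exists_energyX_smul_neg :
    ∃ T : ℝ, 0 ≤ T ∧ ∀ x : X, x ≠ 0 → ‖x‖ ^ 2 = (∫ z, f (ι x z) * ι x z) →
      energyX ι f (T • x) < 0 := by
  have hθ := hf.two_lt_theta
  obtain ⟨t, ht, ht1⟩ := (((tendsto_rpow_atTop (y := θ - 2) (by linarith)).eventually_gt_atTop 2).and
    (eventually_ge_atTop 1)).exists
  refine ⟨2 * t, by linarith, fun x hx h => ?_⟩
  refine (energyX_two_mul_smul_le hf ι x ht1).trans_lt ?_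
  rw [← h, ← sub_mul]
  have hx2 : 0 < ‖x‖ ^ 2 := by positivity
  have h1 : t ^ θ = t ^ (θ - 2) * t ^ 2 := by
    rw [← Real.rpow_natCast, ← Real.rpow_add (by linarith)]; congr 1; push_cast; ring
  have h2 : 0 < t ^ 2 := by positivity
  rw [h1]
  nlinarith [mul_pos h2 hx2, mul_lt_mul_of_pos_right ht (mul_pos h2 hx2)]

/-- The nonlinear term is O(‖x‖^{2*}) with 2* > 2, hence negligible against ‖x‖² near 0. In
particular the Nehari set stays away from the origin. -/
theorem exists_half_norm_sq_le_nehari :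
    ∃ ρ : ℝ, 0 < ρ ∧ ∀ x : X, ‖x‖ ≤ ρ →
      1 / 2 * ‖x‖ ^ 2 ≤ ‖x‖ ^ 2 - ∫ z, f (ι x z) * ι x z := by
  have hA := hf.A_pos
  have hr := two_lt_critExp N
  have h1 : Tendsto (fun s : ℝ => A * ‖ι‖ ^ 2 * (‖ι‖ * s) ^ (critExp N - 2)) (𝓝[>] 0)
      (𝓝 (A * ‖ι‖ ^ 2 * (‖ι‖ * 0) ^ (critExp N - 2))) := by
    refine (ContinuousAt.tendsto ?_).mono_left nhdsWithin_le_nhds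
    refine continuousAt_const.mul ?_
    exact (continuousAt_const.mul continuousAt_id).rpow_const (Or.inr (by linarith))
  rw [mul_zero, Real.zero_rpow (by linarith), mul_zero] at h1
  obtain ⟨ρ, hρ, hρ0⟩ := ((h1.eventually_lt_const (by norm_num : (0 : ℝ) < 1 / 2)).and
    self_mem_nhdsWithin).exists
  refine ⟨ρ, hρ0, fun x hx => ?_⟩
  have h2 := (le_abs_self _).trans (hf.integrable_and_abs_integral_mul_le (ι x) (ι x)).2
  have h3 : A * ‖ι x‖ * ‖ι x‖ * ‖ι x‖ ^ (critExp N - 2) ≤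
      A * (‖ι‖ * ‖x‖) * (‖ι‖ * ‖x‖) * (‖ι‖ * ρ) ^ (critExp N - 2) := by
    have := ι.le_opNorm x
    have h4 : ‖ι x‖ ≤ ‖ι‖ * ρ := this.trans (by gcongr)
    have h5 : (0 : ℝ) < ρ := hρ0
    gcongr
  have h6 : A * ‖ι‖ ^ 2 * (‖ι‖ * ρ) ^ (critExp N - 2) * ‖x‖ ^ 2 ≤ 1 / 2 * ‖x‖ ^ 2 := by gcongr
  linarith

theorem exists_pos_le_energyX_of_nehari :
    ∃ m : ℝ, 0 < m ∧ ∀ x : X, x ≠ 0 → ‖x‖ ^ 2 = (∫ z, f (ι x z) * ι x z) → m ≤ energyX ι f x := by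
  obtain ⟨ρ, hρ, hρ'⟩ := exists_half_norm_sq_le_nehari hf ι
  have hθ := hf.two_lt_theta
  have h1 : 0 < 1 / 2 - 1 / θ := by
    rw [sub_pos]; exact one_div_lt_one_div_of_lt two_pos hθ
  refine ⟨(1 / 2 - 1 / θ) * ρ ^ 2, by positivity, fun x hx h => ?_⟩
  refine le_trans ?_ (mul_norm_sq_le_energyX_of_nehari hf ι h)
  have h2 : ρ ≤ ‖x‖ := by
    by_contra! h3
    have := hρ' x h3.le
    rw [← h, sub_self] at this
    have : 0 < ‖x‖ ^ 2 := by positivity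
    linarith
  gcongr

variable [CompleteSpace X]

omit hf in
theorem inner_gradJ_self (hf : IsAdmissible (critExp N) A p q θ f) (x : X) :
    inner ℝ (gradJ ι hf x) x = ‖x‖ ^ 2 - ∫ z, f (ι x z) * ι x z := by
  rw [inner_gradJ, real_inner_self_eq_norm_sq]

theorem gradJ_zero : gradJ ι hf (0 : X) = 0 := by
  refine ext_inner_right ℝ fun y => ?_
  have h := (hf.integrable_and_abs_integral_mul_le (ι 0) (ι y)).2
  rw [map_zero, norm_zero, mul_zero, zero_mul, zero_mul] at h
  rw [inner_gradJ, inner_zero_left, map_zero, abs_nonpos_iff.1 h, sub_zero]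

theorem norm_gradJ_sub_le_of_norm_le {R : ℝ} {x y : X} (hx : ‖x‖ ≤ R) (hy : ‖y‖ ≤ R) :
    ‖gradJ ι hf x - gradJ ι hf y‖ ≤
      (1 + A * ‖ι‖ ^ 2 * (2 * (‖ι‖ * R)) ^ (critExp N - 2)) * ‖x - y‖ := by
  refine (norm_gradJ_sub_le ι hf x y).trans ?_
  have hA := hf.A_pos
  have hr := two_lt_critExp N
  have h1 : ‖ι x‖ ≤ ‖ι‖ * R := (ι.le_opNorm x).trans (by gcongr)
  have h2 : ‖ι y‖ ≤ ‖ι‖ * R := (ι.le_opNorm y).trans (by gcongr)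
  gcongr
  linarith

theorem continuous_gradJ : Continuous (gradJ ι hf) := by
  refine continuous_iff_continuousAt.2 fun x => ?_
  have h : LipschitzOnWith (1 + A * ‖ι‖ ^ 2 * (2 * (‖ι‖ * (‖x‖ + 1))) ^ (critExp N - 2)).toNNReal
      (gradJ ι hf) (ball 0 (‖x‖ + 1)) := by
    refine LipschitzOnWith.of_dist_le_mul fun y hy z hz => ?_
    have hA := hf.A_pos
    rw [dist_eq_norm, dist_eq_norm, Real.coe_toNNReal _ (by positivity)]
    exact norm_gradJ_sub_le_of_norm_le hf ι (by simpa using (mem_ball.1 hy).le)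
      (by simpa using (mem_ball.1 hz).le)
  exact h.continuousOn.continuousAt (isOpen_ball.mem_nhds (by simp))

/-- A gradient step decreases the energy, uniformly on bounded sets. -/
theorem exists_descent (R : ℝ) : ∃ s : ℝ, 0 < s ∧ ∀ x : X, ‖x‖ ≤ R →
    energyX ι f (x - s • gradJ ι hf x) ≤ energyX ι f x - s / 2 * ‖gradJ ι hf x‖ ^ 2 := by
  rcases lt_or_ge R 0 with hR | hR
  · exact ⟨1, one_pos, fun x hx => by linarith [norm_nonneg x]⟩
  have hA := hf.A_pos
  have hr := two_lt_critExp N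
  set L := 1 + A * ‖ι‖ ^ 2 * (2 * (‖ι‖ * R)) ^ (critExp N - 2)
  have hL : 0 ≤ L := by positivity
  set B := 1 / 2 + A * ‖ι‖ ^ 2 * (‖ι‖ * R + ‖ι‖ * (R + L * R)) ^ (critExp N - 2)
  have hB : 0 < B := by positivity
  -- As s ≤ 1 and the gradient is at most L R, the step stays in the ball where B bounds the
  -- quadratic coefficient; s ≤ 1/(2B) makes the quadratic loss at most half of the linear gain.
  refine ⟨min 1 (1 / (2 * B)), by positivity, fun x hx => ?_⟩
  set s := min 1 (1 / (2 * B))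
  have hs0 : 0 < s := by positivity
  have hs1 : s ≤ 1 := min_le_left _ _
  have hsB : s * B ≤ 1 / 2 := by
    have : s ≤ 1 / (2 * B) := min_le_right _ _
    rw [le_div_iff₀ (by positivity)] at this
    linarith
  set g := gradJ ι hf x
  have hg : ‖g‖ ≤ L * R := by
    have := norm_gradJ_sub_le_of_norm_le hf ι hx (by simpa using hR : ‖(0 : X)‖ ≤ R)
    rw [gradJ_zero, sub_zero, sub_zero] at this
    exact this.trans (by gcongr)
  have h1 := energyX_add_le ι hf x (-(s • g))
  rw [← sub_eq_add_neg, inner_neg_right, inner_smul_right, real_inner_self_eq_norm_sq, norm_neg,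
    norm_smul, mul_pow, Real.norm_of_nonneg hs0.le] at h1
  have h2 : 1 / 2 + A * ‖ι‖ ^ 2 * (‖ι x‖ + ‖ι (x - s • g)‖) ^ (critExp N - 2) ≤ B := by
    have h3 : ‖ι x‖ ≤ ‖ι‖ * R := (ι.le_opNorm x).trans (by gcongr)
    have h4 : ‖x - s • g‖ ≤ R + L * R := by
      refine (norm_sub_le _ _).trans (add_le_add hx ?_)
      rw [norm_smul, Real.norm_of_nonneg hs0.le]
      exact (mul_le_of_le_one_left (norm_nonneg _) hs1).trans hg
    have h5 : ‖ι (x - s • g)‖ ≤ ‖ι‖ * (R + L * R) := (ι.le_opNorm _).trans (by gcongr)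
    simp only [B]
    gcongr
  have h6 : (1 / 2 + A * ‖ι‖ ^ 2 * (‖ι x‖ + ‖ι (x - s • g)‖) ^ (critExp N - 2)) *
      (s ^ 2 * ‖g‖ ^ 2) ≤ B * (s ^ 2 * ‖g‖ ^ 2) := by gcongr
  have h7 : B * (s ^ 2 * ‖g‖ ^ 2) ≤ s / 2 * ‖g‖ ^ 2 := by
    have : 0 ≤ s * ‖g‖ ^ 2 := by positivity
    nlinarith
  linarith

/-- A path from the origin to a point of negative energy crosses the Nehari manifold. -/
theorem exists_nehari_of_path {T : ℝ} (hT : 0 ≤ T) {γ : ℝ → X} (hγ : Continuous γ)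
    (h0 : γ 0 = 0) (h1 : energyX ι f (γ T) < 0) :
    ∃ t ∈ Set.Icc 0 T, γ t ≠ 0 ∧ ‖γ t‖ ^ 2 = ∫ z, f (ι (γ t) z) * ι (γ t) z := by
  obtain ⟨ρ, hρ, hρ'⟩ := exists_half_norm_sq_le_nehari hf ι
  let Φ : X → ℝ := fun x => inner ℝ (gradJ ι hf x) x
  have hΦc : Continuous Φ := (continuous_gradJ hf ι).inner continuous_id
  have hΦ : ∀ x, Φ x = ‖x‖ ^ 2 - ∫ z, f (ι x z) * ι x z := inner_gradJ_self ι hf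
  -- The origin is a zero of Φ; the second term of the maximum excludes it by forcing norm at least
  -- ρ at any zero of Ψ.
  let Ψ : ℝ → ℝ := fun t => max (Φ (γ t)) (ρ ^ 2 - ‖γ t‖ ^ 2)
  have hΨ : Continuous Ψ :=
    (hΦc.comp hγ).max (continuous_const.sub (hγ.norm.pow 2))
  have hΨ0 : 0 ≤ Ψ 0 := by
    refine le_max_of_le_right ?_
    rw [h0, norm_zero]; nlinarith
  have hΨT : Ψ T ≤ 0 := by
    have h2 : Φ (γ T) < 0 := by
      have := half_nehari_le_energyX hf ι (γ T)
      rw [← hΦ] at this; linarith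
    have h3 : ρ < ‖γ T‖ := by
      by_contra! h4
      have := hρ' (γ T) h4
      rw [← hΦ] at this
      nlinarith [sq_nonneg ‖γ T‖]
    refine max_le h2.le ?_
    nlinarith
  obtain ⟨t, ht, hΨt⟩ := intermediate_value_Icc' hT hΨ.continuousOn ⟨hΨT, hΨ0⟩
  have h2 : Φ (γ t) ≤ 0 := (le_max_left _ _).trans hΨt.le
  have h3 : ρ ^ 2 - ‖γ t‖ ^ 2 ≤ 0 := (le_max_right _ _).trans hΨt.le
  have h4 : ρ ≤ ‖γ t‖ := by
    by_contra! h5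
    nlinarith [norm_nonneg (γ t)]
  have h5 : Φ (γ t) = 0 := by
    rcases max_choice (Φ (γ t)) (ρ ^ 2 - ‖γ t‖ ^ 2) with h | h
    · rw [← h]; exact hΨt
    · have h6 : ρ ^ 2 - ‖γ t‖ ^ 2 = 0 := by rw [← h]; exact hΨt
      have h7 : ‖γ t‖ ≤ ρ := by
        by_contra! h8
        nlinarith
      have := hρ' (γ t) h7
      rw [← hΦ] at this
      nlinarith [sq_nonneg ‖γ t‖]
  refine ⟨t, ht, norm_pos_iff.1 (hρ.trans_le h4), ?_⟩
  rw [hΦ] at h5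
  linarith

/-- Minimizing sequences on the Nehari manifold in an invariant subspace yield Palais-Smale
sequences in that subspace at the same level. -/
theorem exists_palaisSmale (S : Submodule ℝ X) (hS : ∀ x ∈ S, gradJ ι hf x ∈ S) {c : ℝ}
    (hc : ∀ x ∈ S, x ≠ 0 → ‖x‖ ^ 2 = (∫ z, f (ι x z) * ι x z) → c ≤ energyX ι f x)
    {u : ℕ → X} (huS : ∀ n, u n ∈ S) (hu0 : ∀ n, u n ≠ 0)
    (huN : ∀ n, ‖u n‖ ^ 2 = ∫ z, f (ι (u n) z) * ι (u n) z)
    (huc : Tendsto (fun n => energyX ι f (u n)) atTop (𝓝 c)) :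
    ∃ w : ℕ → X, (∀ n, w n ∈ S) ∧ (∃ R, ∀ n, ‖w n‖ ≤ R) ∧
      Tendsto (fun n => ‖gradJ ι hf (w n)‖) atTop (𝓝 0) ∧
      Tendsto (fun n => energyX ι f (w n)) atTop (𝓝 c) := by
  obtain ⟨T, hT, hTneg⟩ := exists_energyX_smul_neg hf ι
  obtain ⟨M, hM⟩ := huc.bddAbove_range
  have hM : ∀ n, energyX ι f (u n) ≤ M := fun n => hM ⟨n, rfl⟩
  have hθ := hf.two_lt_theta
  have hθ' : 0 < 1 / 2 - 1 / θ := by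
    rw [sub_pos]; exact one_div_lt_one_div_of_lt two_pos hθ
  set R := Real.sqrt (M / (1 / 2 - 1 / θ))
  have hR : ∀ n, ‖u n‖ ≤ R := fun n => by
    refine Real.le_sqrt_of_sq_le ?_
    rw [le_div_iff₀ hθ', mul_comm]
    exact (mul_norm_sq_le_energyX_of_nehari hf ι (huN n)).trans (hM n)
  obtain ⟨s, hs, hdesc⟩ := exists_descent hf ι (T * R)
  have hbound : ∀ n, ∀ t ∈ Set.Icc 0 T, ‖t • u n‖ ≤ T * R := fun n t ht => by
    rw [norm_smul, Real.norm_of_nonneg ht.1]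
    exact mul_le_mul ht.2 (hR n) (norm_nonneg _) hT
  have key : ∀ n, ∃ t ∈ Set.Icc 0 T, c ≤ energyX ι f (t • u n) -
      s / 2 * ‖gradJ ι hf (t • u n)‖ ^ 2 := by
    intro n
    -- The path is the ray through `u n` after one gradient step. It stays in S and ends at negative
    -- energy, so it meets the Nehari set, where the energy is at least c.
    let γ : ℝ → X := fun t => t • u n - s • gradJ ι hf (t • u n)
    have hγ : Continuous γ := by
      have h := continuous_gradJ hf ι
      have h2 : Continuous fun t : ℝ => t • u n := continuous_id.smul continuous_const
      exact h2.sub ((h.comp h2).const_smul s)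
    have hγT : energyX ι f (γ T) < 0 := by
      have h1 := hdesc _ (hbound n T ⟨hT, le_rfl⟩)
      have h2 := hTneg _ (hu0 n) (huN n)
      have h3 : 0 ≤ s / 2 * ‖gradJ ι hf (T • u n)‖ ^ 2 := by positivity
      linarith
    obtain ⟨t, ht, hne, hneh⟩ := exists_nehari_of_path hf ι hT hγ
      (by simp [γ, gradJ_zero]) hγT
    have hmem : t • u n ∈ S := S.smul_mem t (huS n)
    exact ⟨t, ht, (hc _ (S.sub_mem hmem (S.smul_mem s (hS _ hmem))) hne hneh).trans
      (hdesc _ (hbound n t ht))⟩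
  choose t ht hct using key
  have hup : ∀ n, energyX ι f (t n • u n) ≤ energyX ι f (u n) := fun n =>
    energyX_smul_le_of_nehari hf ι (huN n) (ht n).1
  refine ⟨fun n => t n • u n, fun n => S.smul_mem _ (huS n), ⟨T * R, fun n => hbound n _ (ht n)⟩,
    ?_, ?_⟩
  -- The squared gradient, times s/2, is at most the gap between the energy of `u n` and c.
  · have h1 : Tendsto (fun n => Real.sqrt (2 / s * (energyX ι f (u n) - c))) atTop (𝓝 0) := by
      have := (Real.continuous_sqrt.tendsto _).comp ((huc.sub_const c).const_mul (2 / s))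
      simpa [Function.comp_def] using this
    refine squeeze_zero (fun n => norm_nonneg _) (fun n => ?_) h1
    refine Real.le_sqrt_of_sq_le ?_
    have h2 := hct n
    have h3 := hup n
    rw [div_mul_eq_mul_div, le_div_iff₀ hs]
    linarith
  · refine tendsto_of_tendsto_of_tendsto_of_le_of_le tendsto_const_nhds huc (fun n => ?_) hup
    have : 0 ≤ s / 2 * ‖gradJ ι hf (t n • u n)‖ ^ 2 := by positivity
    have := hct n
    change c ≤ _
    linarith

end MountainPass

/-! ### Weak limits and local compactness -/

/-- Bounded sequences in a separable Hilbert space have weakly convergent subsequences. -/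
theorem exists_subseq_tendsto_inner {X : Type*} [NormedAddCommGroup X] [InnerProductSpace ℝ X]
    [CompleteSpace X] [TopologicalSpace.SeparableSpace X] {x : ℕ → X} {R : ℝ}
    (hx : ∀ n, ‖x n‖ ≤ R) :
    ∃ (x₀ : X) (σ : ℕ → ℕ), StrictMono σ ∧
      ∀ y, Tendsto (fun n => inner ℝ (x (σ n)) y) atTop (𝓝 (inner ℝ x₀ y)) := by
  let φ : ℕ → WeakDual ℝ X := fun n => StrongDual.toWeakDual (InnerProductSpace.toDual ℝ X (x n))
  have hφ : ∀ n, φ n ∈ WeakDual.toStrongDual ⁻¹' closedBall (0 : StrongDual ℝ X) R := fun n => by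
    have : ‖InnerProductSpace.toDual ℝ X (x n)‖ ≤ R := by
      rw [LinearIsometryEquiv.norm_map]; exact hx n
    simpa [φ] using this
  obtain ⟨φ₀, -, σ, hσ, hlim⟩ := WeakDual.isSeqCompact_closedBall ℝ X 0 R hφ
  refine ⟨(InnerProductSpace.toDual ℝ X).symm (WeakDual.toStrongDual φ₀), σ, hσ, fun y => ?_⟩
  rw [InnerProductSpace.toDual_symm_apply]
  have := ((WeakDual.eval_continuous y).tendsto φ₀).comp hlim
  exact this

section Compactness

variable {N : ℕ} [hN : Fact (5 ≤ N)]

theorem integral_abs_rpow_critExp (u : LCrit N) :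
    (Integrable fun x => |u x| ^ critExp N) ∧ ∫ x, |u x| ^ critExp N = ‖u‖ ^ critExp N := by
  have hr := critExp_pos N
  have h0 : ENNReal.ofReal (critExp N) ≠ 0 := by simpa using hr
  have hrt := ENNReal.toReal_ofReal hr.le
  have hi := (Lp.memLp u).integrable_norm_rpow h0 (by simp)
  have he := (Lp.memLp u).eLpNorm_eq_integral_rpow_norm h0 (by simp)
  rw [hrt] at hi he
  simp only [Real.norm_eq_abs] at hi he
  refine ⟨hi, ?_⟩
  have hnn : 0 ≤ ∫ x, |u x| ^ critExp N := integral_nonneg fun x => by positivity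
  rw [Lp.norm_def, he, ENNReal.toReal_ofReal (by positivity), ← Real.rpow_mul hnn,
    inv_mul_cancel₀ hr.ne', Real.rpow_one]

omit hN in
theorem lintegral_enorm_sq (g : LGrad N) : ∫⁻ x, ‖g x‖ₑ ^ (2 : ℝ) = ‖g‖ₑ ^ (2 : ℝ) := by
  rw [Lp.enorm_def, eLpNorm_eq_lintegral_rpow_enorm_toReal (by norm_num) (by norm_num),
    ← ENNReal.rpow_mul]
  simp

theorem locallyIntegrable_lcrit (u : LCrit N) : LocallyIntegrable u :=
  (Lp.memLp u).locallyIntegrable Fact.out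

omit hN in
theorem measurable_lp {E : Type*} [NormedAddCommGroup E] [MeasurableSpace E] [BorelSpace E]
    {p : ℝ≥0∞} (u : Lp E p (volume : Measure (Eucl N))) : Measurable u :=
  (Lp.stronglyMeasurable u).measurable

/-- Mollification is close to the identity in `L^2` on bounded sets of `D^{1,2}(ℝ^N)`. -/
theorem lintegral_mollify_potential_sub_le (n : ℕ) {R : ℝ} {x : gradSpace N} (hx : ‖x‖ ≤ R) :
    ∫⁻ z, ‖mollify n (potential x) z - potential x z‖ₑ ^ (2 : ℝ) ≤
      ENNReal.ofReal ((1 / ((n : ℝ) + 1) * R) ^ (2 : ℝ)) := by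
  have hR : 0 ≤ R := (norm_nonneg _).trans hx
  refine (lintegral_mollify_sub_le n (measurable_lp _) (locallyIntegrable_lcrit _)
    (measurable_lp (x : LGrad N)) (isWeakGradient_potential x)).trans ?_
  rw [lintegral_enorm_sq, ← ENNReal.mul_rpow_of_nonneg _ _ zero_le_two,
    ← ENNReal.ofReal_rpow_of_nonneg (by positivity) zero_le_two,
    ENNReal.ofReal_mul (by positivity)]
  gcongr
  rw [← ofReal_norm]
  exact ENNReal.ofReal_le_ofReal hx

/-- Mollifications of bounded sequences in `L^{2^*}` are uniformly bounded. -/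
theorem exists_abs_mollify_le (n : ℕ) : ∃ C : ℝ, 0 ≤ C ∧ ∀ (u : LCrit N) (y : Eucl N),
    |mollify n u y| ≤ C * ‖u‖ := by
  obtain ⟨K, hK⟩ := (hasCompactSupport_rho (N := N) n).exists_bound_of_continuous (continuous_rho n)
  have hK0 : 0 ≤ K := (norm_nonneg _).trans (hK 0)
  have hr := critExp_pos N
  have hr1 : 1 ≤ critExp N := by linarith [two_lt_critExp N]
  refine ⟨K ^ (1 / critExp N), by positivity, fun u y => ?_⟩
  have hum := measurable_lp u
  have h1 : ‖mollify n u y‖ₑ ^ critExp N ≤ ENNReal.ofReal K * ‖u‖ₑ ^ critExp N := by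
    calc ‖mollify n u y‖ₑ ^ critExp N
        ≤ (∫⁻ z, ‖u (y - z)‖ₑ ∂rhoMeasure N n) ^ critExp N :=
          ENNReal.rpow_le_rpow (enorm_mollify_le n hum y) hr.le
      _ ≤ ∫⁻ z, ‖u (y - z)‖ₑ ^ critExp N ∂rhoMeasure N n :=
          rpow_lintegral_le (by fun_prop) hr1
      _ = ∫⁻ z, ENNReal.ofReal (rho N n z) * ‖u (y - z)‖ₑ ^ critExp N :=
          lintegral_rhoMeasure n _ (by fun_prop)
      _ ≤ ∫⁻ z, ENNReal.ofReal K * ‖u (y - z)‖ₑ ^ critExp N := by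
          refine lintegral_mono fun z => ?_
          gcongr
          exact (le_abs_self _).trans (hK z)
      _ = ENNReal.ofReal K * ∫⁻ z, ‖u (y - z)‖ₑ ^ critExp N := lintegral_const_mul' _ _ (by simp)
      _ = ENNReal.ofReal K * ∫⁻ z, ‖u z‖ₑ ^ critExp N := by
          rw [lintegral_sub_left_eq_self (fun z => ‖u z‖ₑ ^ critExp N) y]
      _ = ENNReal.ofReal K * ‖u‖ₑ ^ critExp N := by
          rw [Lp.enorm_def, eLpNorm_eq_lintegral_rpow_enorm_toReal (by simpa using hr) (by simp),
            ← ENNReal.rpow_mul, ENNReal.toReal_ofReal hr.le, one_div_mul_cancel hr.ne',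
            ENNReal.rpow_one]
  rw [← ofReal_norm, ← ofReal_norm, ENNReal.ofReal_rpow_of_nonneg (norm_nonneg _) hr.le,
    ENNReal.ofReal_rpow_of_nonneg (norm_nonneg _) hr.le, ← ENNReal.ofReal_mul hK0,
    ENNReal.ofReal_le_ofReal_iff (by positivity)] at h1
  have h2 := Real.rpow_le_rpow (by positivity) h1 (by positivity : 0 ≤ 1 / critExp N)
  rw [Real.mul_rpow hK0 (by positivity), ← Real.rpow_mul (norm_nonneg _),
    ← Real.rpow_mul (norm_nonneg _), mul_one_div_cancel hr.ne', Real.rpow_one, Real.rpow_one] at h2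
  exact h2

/-- Mollifications of weakly convergent sequences converge pointwise. -/
theorem tendsto_mollify_potential (n : ℕ) (y : Eucl N) {x : ℕ → gradSpace N} {x₀ : gradSpace N}
    (hx : ∀ z, Tendsto (fun k => inner ℝ (x k) z) atTop (𝓝 (inner ℝ x₀ z))) :
    Tendsto (fun k => mollify n (potential (x k)) y) atTop (𝓝 (mollify n (potential x₀) y)) := by
  have hc : Continuous fun z => rho N n (y - z) := (continuous_rho n).comp (continuous_sub_left y)
  obtain ⟨B, hB⟩ := exists_clm_integral_mul (N := N)
    (hc.memLp_of_hasCompactSupport ((hasCompactSupport_rho n).comp_homeomorph (Homeomorph.subLeft y)))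
  have hm : ∀ x : gradSpace N, mollify n (potential x) y = inner ℝ x
      ((InnerProductSpace.toDual ℝ (gradSpace N)).symm (B.comp potential)) := by
    intro x
    rw [real_inner_comm, InnerProductSpace.toDual_symm_apply, ContinuousLinearMap.comp_apply, hB,
      mollify_apply']
    simp only [mul_comm]
  simp only [hm]
  exact hx _

/-- A local form of Rellich's theorem for sequences converging weakly to zero. -/
theorem tendsto_setLIntegral_potential {d : ℕ → gradSpace N} {R : ℝ} (hR : ∀ k, ‖d k‖ ≤ R)
    (hd : ∀ z, Tendsto (fun k => inner ℝ (d k) z) atTop (𝓝 0)) (ρ : ℝ) :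
    Tendsto (fun k => ∫⁻ z in ball 0 ρ, ‖potential (d k) z‖ₑ ^ (2 : ℝ)) atTop (𝓝 0) := by
  -- At a fixed scale, mollifications are uniformly bounded and converge pointwise, so dominated
  -- convergence applies on a ball.
  have hmol : ∀ n, Tendsto (fun k => ∫⁻ z in ball 0 ρ, ‖mollify n (potential (d k)) z‖ₑ ^ (2 : ℝ))
      atTop (𝓝 0) := by
    intro n
    obtain ⟨C, hC0, hC⟩ := exists_abs_mollify_le (N := N) n
    have := tendsto_lintegral_of_dominated_convergence' (μ := volume.restrict (ball (0 : Eucl N) ρ))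
      (F := fun k z => ‖mollify n (potential (d k)) z‖ₑ ^ (2 : ℝ)) (f := fun _ => 0)
      (fun _ => ENNReal.ofReal (C * (‖potential (N := N)‖ * R)) ^ (2 : ℝ)) (fun k => ?_)
      (fun k => ae_of_all _ fun z => ?_) ?_ (ae_of_all _ fun z => ?_)
    · simpa using this
    · have := (contDiff_mollify n (locallyIntegrable_lcrit (potential (d k)))).continuous
      exact Continuous.aemeasurable (by fun_prop)
    · refine ENNReal.rpow_le_rpow ?_ zero_le_two
      rw [← ofReal_norm]
      refine ENNReal.ofReal_le_ofReal ((hC _ _).trans ?_)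
      gcongr
      exact (potential.le_opNorm _).trans (by gcongr; exact hR k)
    · rw [lintegral_const]
      refine ENNReal.mul_ne_top (by finiteness) ?_
      rw [Measure.restrict_apply_univ]
      exact measure_ball_lt_top.ne
    · have h0 : Tendsto (fun k => mollify n (potential (d k)) z) atTop (𝓝 0) := by
        have := tendsto_mollify_potential n z (x := d) (x₀ := 0) (by simpa using hd)
        simpa [mollify_apply', map_zero, integral_congr_ae
          (show (fun y => rho N n (z - y) * (0 : LCrit N) y) =ᵐ[volume] fun _ => (0 : ℝ) by
            filter_upwards [Lp.coeFn_zero ℝ (ENNReal.ofReal (critExp N))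
              (volume : Measure (Eucl N))] with y hy
            rw [hy, Pi.zero_apply, mul_zero])] using this
      have := (ENNReal.continuous_rpow_const (y := 2)).tendsto _ |>.comp
        ((continuous_enorm.tendsto _).comp h0)
      simpa [Function.comp_def] using this
  rw [ENNReal.tendsto_nhds_zero]
  intro ε hε
  have h1 : Tendsto (fun n : ℕ => 2 * ENNReal.ofReal ((1 / ((n : ℝ) + 1) * R) ^ (2 : ℝ))) atTop
      (𝓝 0) := by
    have h2 : Tendsto (fun n : ℕ => (1 / ((n : ℝ) + 1) * R) ^ (2 : ℝ)) atTop (𝓝 0) := by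
      have := (tendsto_one_div_add_atTop_nhds_zero_nat (𝕜 := ℝ)).mul_const R
      rw [zero_mul] at this
      have := this.rpow_const (p := 2) (Or.inr zero_le_two)
      simpa using this
    have := ENNReal.Tendsto.const_mul (a := 2) (ENNReal.tendsto_ofReal h2) (Or.inr (by simp))
    simpa using this
  have hε2 : 0 < ε / 2 := ENNReal.half_pos hε.ne'
  -- The scale n is fixed before k: the mollification error in L² is small uniformly in k.
  obtain ⟨n, hn⟩ := ((ENNReal.tendsto_nhds_zero.1 h1) (ε / 2) hε2).exists
  have h3 : Tendsto (fun k => 2 * ∫⁻ z in ball 0 ρ, ‖mollify n (potential (d k)) z‖ₑ ^ (2 : ℝ))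
      atTop (𝓝 0) := by
    have := ENNReal.Tendsto.const_mul (a := 2) (hmol n) (Or.inr (by simp))
    simpa using this
  filter_upwards [(ENNReal.tendsto_nhds_zero.1 h3) (ε / 2) hε2] with k hk
  have hmeas : Measurable fun z => ‖mollify n (potential (d k)) z‖ₑ ^ (2 : ℝ) := by
    have := (contDiff_mollify n (locallyIntegrable_lcrit (potential (d k)))).continuous
    exact Continuous.measurable (by fun_prop)
  calc ∫⁻ z in ball 0 ρ, ‖potential (d k) z‖ₑ ^ (2 : ℝ)
      ≤ ∫⁻ z in ball 0 ρ, (2 * ‖mollify n (potential (d k)) z - potential (d k) z‖ₑ ^ (2 : ℝ) +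
          2 * ‖mollify n (potential (d k)) z‖ₑ ^ (2 : ℝ)) := by
        refine lintegral_mono fun z => ?_
        set a := mollify n (potential (d k)) z
        set b := potential (d k) z
        have h4 : ‖b‖ₑ ≤ ‖a - b‖ₑ + ‖a‖ₑ := by
          have := enorm_sub_le (E := ℝ) (a := a) (b := a - b)
          rw [sub_sub_cancel] at this
          rwa [add_comm] at this
        refine (ENNReal.rpow_le_rpow h4 zero_le_two).trans ?_
        refine (ENNReal.rpow_add_le_mul_rpow_add_rpow _ _ one_le_two).trans (le_of_eq ?_)
        norm_num [mul_add]
    _ = 2 * (∫⁻ z in ball 0 ρ, ‖mollify n (potential (d k)) z - potential (d k) z‖ₑ ^ (2 : ℝ)) +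
          2 * ∫⁻ z in ball 0 ρ, ‖mollify n (potential (d k)) z‖ₑ ^ (2 : ℝ) := by
        rw [lintegral_add_right _ (hmeas.const_mul 2), lintegral_const_mul' _ _ (by simp),
          lintegral_const_mul' _ _ (by simp)]
    _ ≤ ε / 2 + ε / 2 := by
        refine add_le_add (le_trans ?_ hn) hk
        gcongr
        exact (setLIntegral_le_lintegral _ _).trans (lintegral_mollify_potential_sub_le n (hR k))
    _ = ε := ENNReal.add_halves ε

/-- Weakly convergent sequences in `D^{1,2}(ℝ^N)` converge almost everywhere along a
subsequence. -/
theorem exists_subseq_ae_tendsto {x : ℕ → gradSpace N} {x₀ : gradSpace N} {R : ℝ}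
    (hR : ∀ k, ‖x k‖ ≤ R)
    (hx : ∀ z, Tendsto (fun k => inner ℝ (x k) z) atTop (𝓝 (inner ℝ x₀ z))) :
    ∃ σ : ℕ → ℕ, StrictMono σ ∧
      ∀ᵐ z, Tendsto (fun k => potential (x (σ k)) z) atTop (𝓝 (potential x₀ z)) := by
  have hd : ∀ z, Tendsto (fun k => inner ℝ (x k - x₀) z) atTop (𝓝 0) := fun z => by
    simpa [inner_sub_left] using (hx z).sub_const (inner ℝ x₀ z)
  have hdR : ∀ k, ‖x k - x₀‖ ≤ R + ‖x₀‖ := fun k =>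
    (norm_sub_le _ _).trans (by gcongr; exact hR k)
  have hev : ∀ j : ℕ, ∀ᶠ k in atTop,
      ∫⁻ z in ball 0 (j : ℝ), ‖potential (x k - x₀) z‖ₑ ^ (2 : ℝ) ≤ (2⁻¹ : ℝ≥0∞) ^ j := fun j =>
    (ENNReal.tendsto_nhds_zero.1 (tendsto_setLIntegral_potential hdR hd j)) _
      (ENNReal.pow_pos (by norm_num) j)
  obtain ⟨σ, hσ, hσ'⟩ := extraction_forall_of_eventually hev
  refine ⟨σ, hσ, ?_⟩
  -- The errors on growing balls are summable, so the series is finite almost everywhere and its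
  -- terms tend to 0; each point lies in all but finitely many of the balls.
  have hsum : ∫⁻ z, ∑' j : ℕ, (ball (0 : Eucl N) (j : ℝ)).indicator
      (fun z => ‖potential (x (σ j) - x₀) z‖ₑ ^ (2 : ℝ)) z ≠ ⊤ := by
    have hm : ∀ j : ℕ, Measurable fun z => ‖potential (x (σ j) - x₀) z‖ₑ ^ (2 : ℝ) := fun j => by
      have := measurable_lp (potential (x (σ j) - x₀)); fun_prop
    rw [lintegral_tsum fun j => ((hm j).indicator measurableSet_ball).aemeasurable]
    refine ne_top_of_le_ne_top ?_ (ENNReal.tsum_le_tsum fun j => ?_) (b := ∑' j : ℕ, (2⁻¹ : ℝ≥0∞) ^ j)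
    · rw [ENNReal.tsum_geometric]; norm_num
    · rw [lintegral_indicator measurableSet_ball]; exact hσ' j
  have hfin := ae_lt_top' (AEMeasurable.tsum fun j => by
    have := measurable_lp (potential (x (σ j) - x₀))
    exact (Measurable.indicator (by fun_prop) measurableSet_ball).aemeasurable) hsum
  have hsub : ∀ᵐ z, ∀ j, potential (x (σ j) - x₀) z = potential (x (σ j)) z - potential x₀ z := by
    refine ae_all_iff.2 fun j => ?_
    rw [map_sub]
    exact Lp.coeFn_sub _ _
  filter_upwards [hfin, hsub] with z hz hz'
  have h1 := ENNReal.tendsto_atTop_zero_of_tsum_ne_top hz.ne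
  obtain ⟨m, hm⟩ := exists_nat_gt ‖z‖
  have h2 : Tendsto (fun j => ‖potential (x (σ j) - x₀) z‖ₑ ^ (2 : ℝ)) atTop (𝓝 0) := by
    refine h1.congr' ?_
    filter_upwards [eventually_ge_atTop m] with j hj
    rw [Set.indicator_of_mem]
    have : (m : ℝ) ≤ j := by exact_mod_cast hj
    simp only [mem_ball_zero_iff]; linarith
  have h3 : Tendsto (fun j => ‖potential (x (σ j) - x₀) z‖ₑ) atTop (𝓝 0) := by
    have := (ENNReal.continuous_rpow_const (y := 2⁻¹)).tendsto _ |>.comp h2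
    rw [ENNReal.zero_rpow_of_pos (by norm_num)] at this
    refine this.congr fun j => ?_
    rw [Function.comp_apply, ← ENNReal.rpow_mul, mul_inv_cancel₀ two_ne_zero, ENNReal.rpow_one]
  rw [tendsto_iff_edist_tendsto_0]
  refine h3.congr fun j => ?_
  rw [hz', edist_eq_enorm_sub]

end Compactness

/-! ### Non-vanishing and passage to the limit -/

section Concentration

variable {N : ℕ} [hN : Fact (5 ≤ N)]

theorem integral_mollify_potential_sub_le (n : ℕ) {R : ℝ} {x : gradSpace N} (hx : ‖x‖ ≤ R) :
    (Integrable fun z => |potential x z - mollify n (potential x) z| ^ (2 : ℝ)) ∧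
      ∫ z, |potential x z - mollify n (potential x) z| ^ (2 : ℝ) ≤
        (1 / ((n : ℝ) + 1) * R) ^ (2 : ℝ) := by
  have h := lintegral_mollify_potential_sub_le n hx
  have hm : Measurable fun z => |potential x z - mollify n (potential x) z| ^ (2 : ℝ) := by
    have h1 := measurable_lp (potential x)
    have h2 := (contDiff_mollify n (locallyIntegrable_lcrit (potential x))).continuous.measurable
    exact (continuous_abs.measurable.comp (h1.sub h2)).pow_const _
  have he : ∀ z, ENNReal.ofReal (|potential x z - mollify n (potential x) z| ^ (2 : ℝ)) =
      ‖mollify n (potential x) z - potential x z‖ₑ ^ (2 : ℝ) := fun z => by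
    rw [← ENNReal.ofReal_rpow_of_nonneg (abs_nonneg _) zero_le_two, abs_sub_comm, ← Real.norm_eq_abs,
      ofReal_norm]
  have hnn : ∀ z, 0 ≤ |potential x z - mollify n (potential x) z| ^ (2 : ℝ) := fun z => by positivity
  have hR : 0 ≤ R := (norm_nonneg _).trans hx
  have hi : Integrable fun z => |potential x z - mollify n (potential x) z| ^ (2 : ℝ) := by
    refine ⟨hm.aestronglyMeasurable, ?_⟩
    rw [hasFiniteIntegral_iff_ofReal (ae_of_all _ hnn)]
    simp only [he]
    exact h.trans_lt ENNReal.ofReal_lt_top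
  refine ⟨hi, ?_⟩
  rw [← ENNReal.ofReal_le_ofReal_iff (by positivity), ofReal_integral_eq_lintegral_ofReal hi
    (ae_of_all _ hnn)]
  simpa only [he] using h

variable {A p q θ : ℝ} {f : ℝ → ℝ} (hf : IsAdmissible (critExp N) A p q θ f)

include hf

/-- If the mollifications of a bounded sequence vanish uniformly, then so do the nonlinear terms. -/
theorem exists_integral_mul_le (R : ℝ) {κ : ℝ} (hκ : 0 < κ) :
    ∃ (n : ℕ) (η : ℝ), 0 < η ∧ ∀ x : gradSpace N, ‖x‖ ≤ R →
      (∀ y, |mollify n (potential x) y| ≤ η) → ∫ z, f (potential x z) * potential x z ≤ κ := by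
  set S := (‖potential (N := N)‖ * |R|) ^ critExp N with hS
  have hS0 : 0 ≤ S := by positivity
  -- S bounds the integral of the critical power, so the first term contributes at most κ/2. The
  -- small number m will be the mollification, and the quadratic term its L² error, small for large
  -- n.
  obtain ⟨K, η, hK, hη, hpt⟩ := hf.exists_abs_mul_le (κ := κ / (2 * (S + 1))) (by positivity)
  have h1 : Tendsto (fun n : ℕ => K * (1 / ((n : ℝ) + 1) * R) ^ (2 : ℝ)) atTop (𝓝 0) := by
    have h2 := (tendsto_one_div_add_atTop_nhds_zero_nat (𝕜 := ℝ)).mul_const R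
    rw [zero_mul] at h2
    have h3 := (h2.rpow_const (p := 2) (Or.inr zero_le_two)).const_mul K
    simpa using h3
  obtain ⟨n, hn⟩ := (h1.eventually_lt_const (half_pos hκ)).exists
  refine ⟨n, η, hη, fun x hx hmol => ?_⟩
  obtain ⟨hi1, he1⟩ := integral_abs_rpow_critExp (potential x)
  obtain ⟨hi2, he2⟩ := integral_mollify_potential_sub_le n hx
  have h4 : ∫ z, f (potential x z) * potential x z ≤
      ∫ z, (κ / (2 * (S + 1)) * |potential x z| ^ critExp N +
        K * |potential x z - mollify n (potential x) z| ^ (2 : ℝ)) :=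
    integral_mono (hf.integrable_mul _ _) ((hi1.const_mul _).add (hi2.const_mul _)) fun z =>
      (le_abs_self _).trans (hpt _ _ (hmol z))
  rw [integral_add (hi1.const_mul _) (hi2.const_mul _), integral_const_mul, integral_const_mul,
    he1] at h4
  have h5 : ‖potential x‖ ^ critExp N ≤ S := by
    refine Real.rpow_le_rpow (norm_nonneg _) ?_ (critExp_pos N).le
    exact (potential.le_opNorm x).trans (by gcongr; exact hx.trans (le_abs_self R))
  have h6 : κ / (2 * (S + 1)) * ‖potential x‖ ^ critExp N ≤ κ / 2 := by
    calc κ / (2 * (S + 1)) * ‖potential x‖ ^ critExp N ≤ κ / (2 * (S + 1)) * (S + 1) := by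
          gcongr; linarith
      _ = κ / 2 := by field_simp
  have h7 := mul_le_mul_of_nonneg_left he2 hK.le
  linarith

/-- Palais-Smale sequences at a positive level do not vanish. -/
theorem exists_lt_abs_mollify {w : ℕ → gradSpace N} {R c : ℝ} (hc : 0 < c) (hR : ∀ k, ‖w k‖ ≤ R)
    (hgrad : Tendsto (fun k => ‖gradJ potential hf (w k)‖) atTop (𝓝 0))
    (hE : Tendsto (fun k => energyX potential f (w k)) atTop (𝓝 c)) :
    ∃ (n : ℕ) (η : ℝ), 0 < η ∧ ∀ᶠ k in atTop, ∃ y, η < |mollify n (potential (w k)) y| := by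
  obtain ⟨n, η, hη, h⟩ := exists_integral_mul_le hf R (half_pos hc)
  have h0 : Tendsto (fun k => ‖gradJ potential hf (w k)‖ * R) atTop (𝓝 0) := by
    simpa using hgrad.mul_const R
  refine ⟨n, η, hη, ?_⟩
  filter_upwards [h0.eventually_lt_const (half_pos hc), hE.eventually_const_lt (half_lt_self hc)]
    with k hk hk'
  -- If the mollification stayed below η, the nonlinear term would be at most c/2, hence ‖w‖² < c,
  -- and the energy, at most ‖w‖²/2, would fall below c/2.
  by_contra! hy
  have h1 := h (w k) (hR k) hy
  have h2 := energyX_le hf potential (w k)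
  have h3 := inner_gradJ_self potential hf (w k)
  have h4 := real_inner_le_norm (gradJ potential hf (w k)) (w k)
  have h5 : ‖gradJ potential hf (w k)‖ * ‖w k‖ ≤ ‖gradJ potential hf (w k)‖ * R := by
    gcongr; exact hR k
  linarith

/-- A Young inequality with a small constant on s, by comparing |h| with (κ/A)|s|. It allows
convergence of the nonlinear term without strong convergence. -/
theorem IsAdmissible.exists_abs_mul_le_rpow {κ : ℝ} (hκ : 0 < κ) :
    ∃ C : ℝ, ∀ s h : ℝ, |f s * h| ≤ κ * |s| ^ critExp N + C * |h| ^ critExp N := by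
  have hA := hf.A_pos
  have hr := two_lt_critExp N
  set r := critExp N
  set lam := κ / A
  have hl : 0 < lam := by positivity
  refine ⟨A * lam⁻¹ ^ (r - 1), fun s h => ?_⟩
  have hpow : ∀ a : ℝ, 0 ≤ a → a * a ^ (r - 2) = a ^ (r - 1) := fun a ha => by
    rw [mul_comm, ← Real.rpow_add_one' ha (by linarith)]; congr 1; ring
  have hpow' : ∀ a : ℝ, 0 ≤ a → a * a ^ (r - 1) = a ^ r := fun a ha => by
    rw [mul_comm, ← Real.rpow_add_one' ha (by linarith)]; congr 1; ring
  have h1 : |f s * h| ≤ A * |s| ^ (r - 1) * |h| := by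
    rw [abs_mul]
    gcongr
    refine (hf.abs_le s).trans (le_of_eq ?_)
    rw [mul_assoc, hpow _ (abs_nonneg _)]
  refine h1.trans ?_
  rcases le_total |h| (lam * |s|) with h2 | h2
  · have h3 : A * |s| ^ (r - 1) * |h| ≤ κ * |s| ^ r := by
      calc A * |s| ^ (r - 1) * |h| ≤ A * |s| ^ (r - 1) * (lam * |s|) := by gcongr
        _ = (A * lam) * (|s| * |s| ^ (r - 1)) := by ring
        _ = κ * |s| ^ r := by rw [hpow' _ (abs_nonneg _), mul_div_cancel₀ _ hA.ne']
    have h4 : 0 ≤ A * lam⁻¹ ^ (r - 1) * |h| ^ r := by positivity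
    linarith
  · have h5 : |s| ≤ lam⁻¹ * |h| := by rw [le_inv_mul_iff₀ hl]; exact h2
    have h3 : A * |s| ^ (r - 1) * |h| ≤ A * lam⁻¹ ^ (r - 1) * |h| ^ r := by
      calc A * |s| ^ (r - 1) * |h| ≤ A * (lam⁻¹ * |h|) ^ (r - 1) * |h| := by
            have : 0 ≤ r - 1 := by linarith
            gcongr
        _ = A * lam⁻¹ ^ (r - 1) * (|h| * |h| ^ (r - 1)) := by
            rw [Real.mul_rpow (by positivity) (abs_nonneg _)]; ring
        _ = _ := by rw [hpow' _ (abs_nonneg _)]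
    have h4 : 0 ≤ κ * |s| ^ r := by positivity
    linarith

/-- The nonlinear term passes to the limit under boundedness and convergence almost everywhere. -/
theorem IsAdmissible.tendsto_integral_mul {u : ℕ → LCrit N} {u₀ : LCrit N} {R : ℝ}
    (hR : ∀ k, ‖u k‖ ≤ R) (hu : ∀ᵐ z, Tendsto (fun k => u k z) atTop (𝓝 (u₀ z))) (h : LCrit N) :
    Tendsto (fun k => ∫ z, f (u k z) * h z) atTop (𝓝 (∫ z, f (u₀ z) * h z)) := by
  have hR0 : 0 ≤ R := (norm_nonneg _).trans (hR 0)
  set S := R ^ critExp N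
  have hS : 0 ≤ S := by positivity
  rw [Metric.tendsto_atTop']
  intro ε hε
  obtain ⟨C, hC⟩ := hf.exists_abs_mul_le_rpow (κ := ε / (2 * (S + 1))) (by positivity)
  set κ := ε / (2 * (S + 1))
  obtain ⟨hih, -⟩ := integral_abs_rpow_critExp h
  have hD : ∀ k, Integrable fun z => f (u k z) * h z - f (u₀ z) * h z := fun k =>
    (hf.integrable_mul (u k) h).sub (hf.integrable_mul u₀ h)
  have hGm : ∀ k, Integrable fun z => |f (u k z) * h z - f (u₀ z) * h z| - κ * |u k z| ^ critExp N :=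
    fun k => (hD k).abs.sub ((integral_abs_rpow_critExp (u k)).1.const_mul κ)
  have hκ0 : 0 ≤ κ := by positivity
  -- The argument is of Brezis-Lieb type: after subtracting κ|u_k|^{2*}, the positive part is
  -- dominated by a fixed integrable function. What was subtracted integrates to at most ε/2.
  have hlim : Tendsto (fun k => ∫ z, max (|f (u k z) * h z - f (u₀ z) * h z| -
      κ * |u k z| ^ critExp N) 0) atTop (𝓝 (∫ _ : Eucl N, (0 : ℝ))) := by
    refine tendsto_integral_of_dominated_convergence
      (fun z => |C| * |h z| ^ critExp N + |f (u₀ z) * h z|) (fun k => (hGm k).pos_part.1)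
      ((hih.const_mul _).add (hf.integrable_mul u₀ h).abs) (fun k => ae_of_all _ fun z => ?_) ?_
    · rw [Real.norm_of_nonneg (le_max_right _ _)]
      refine max_le ?_ (by positivity)
      have h1 := abs_sub (f (u k z) * h z) (f (u₀ z) * h z)
      have h2 := hC (u k z) (h z)
      have h3 : C * |h z| ^ critExp N ≤ |C| * |h z| ^ critExp N := by gcongr; exact le_abs_self C
      linarith
    · filter_upwards [hu] with z hz
      have h1 : Tendsto (fun k => |f (u k z) * h z - f (u₀ z) * h z|) atTop (𝓝 0) := by
        have := ((((hf.continuous.tendsto _).comp hz).mul_const (h z)).sub_const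
          (f (u₀ z) * h z)).abs
        simpa using this
      refine squeeze_zero (fun k => le_max_right _ _) (fun k => ?_) h1
      refine max_le ?_ (abs_nonneg _)
      have : 0 ≤ κ * |u k z| ^ critExp N := by positivity
      linarith
  rw [integral_zero] at hlim
  obtain ⟨n, hn⟩ := eventually_atTop.1 (hlim.eventually_lt_const (half_pos hε))
  refine ⟨n, fun k hk => ?_⟩
  have hn' := hn k hk.le
  obtain ⟨hik, hek⟩ := integral_abs_rpow_critExp (u k)
  rw [Real.dist_eq, ← integral_sub (hf.integrable_mul (u k) h) (hf.integrable_mul u₀ h)]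
  have h1 : |∫ z, f (u k z) * h z - f (u₀ z) * h z| ≤
      ∫ z, (max (|f (u k z) * h z - f (u₀ z) * h z| - κ * |u k z| ^ critExp N) 0 +
        κ * |u k z| ^ critExp N) := by
    refine abs_integral_le_integral_abs.trans (integral_mono (hD k).abs
      ((hGm k).pos_part.add (hik.const_mul κ)) fun z => ?_)
    have := le_max_left (|f (u k z) * h z - f (u₀ z) * h z| - κ * |u k z| ^ critExp N) 0
    simp only
    linarith
  rw [integral_add (hGm k).pos_part (hik.const_mul κ), integral_const_mul, hek] at h1
  have h2 : κ * ‖u k‖ ^ critExp N ≤ ε / 2 := by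
    have h3 : ‖u k‖ ^ critExp N ≤ S :=
      Real.rpow_le_rpow (norm_nonneg _) (hR k) (critExp_pos N).le
    calc κ * ‖u k‖ ^ critExp N ≤ κ * (S + 1) := by gcongr; linarith
      _ = ε / 2 := by simp only [κ]; field_simp
  linarith

/-- Weak limits of Palais-Smale sequences are critical points. -/
theorem gradJ_eq_zero_of_tendsto {v : ℕ → gradSpace N} {v₀ : gradSpace N} {R : ℝ}
    (hR : ∀ k, ‖v k‖ ≤ R)
    (hv : ∀ z, Tendsto (fun k => inner ℝ (v k) z) atTop (𝓝 (inner ℝ v₀ z)))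
    (hae : ∀ᵐ z, Tendsto (fun k => potential (v k) z) atTop (𝓝 (potential v₀ z)))
    (hgrad : ∀ y, Tendsto (fun k => inner ℝ (gradJ potential hf (v k)) y) atTop (𝓝 0)) :
    gradJ potential hf v₀ = 0 := by
  refine ext_inner_right ℝ fun y => ?_
  rw [inner_zero_left]
  refine tendsto_nhds_unique ?_ (hgrad y)
  simp only [inner_gradJ]
  refine (hv y).sub (hf.tendsto_integral_mul (R := ‖potential (N := N)‖ * R) (fun k => ?_) hae _)
  exact (potential.le_opNorm _).trans (by gcongr; exact hR k)

end Concentration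

/-! ### Equivariant functions and symmetric criticality -/

section Equivariance

variable {N : ℕ} [hN : Fact (5 ≤ N)]

/-- The `φ`-equivariant elements of `D^{1,2}(ℝ^N)`. -/
def equivSpace {G : Subgroup (OGroup N)} (φ : G →* ℤˣ) : Submodule ℝ (gradSpace N) where
  carrier := {x | ∀ g : G, ∀ᵐ z, potential x ((g : OGroup N) z) = ((φ g : ℤ) : ℝ) * potential x z}
  add_mem' := by
    intro x y hx hy g
    have h := Lp.coeFn_add (potential x) (potential y)
    have h' := (g : OGroup N).measurePreserving.quasiMeasurePreserving.ae h
    rw [map_add]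
    filter_upwards [hx g, hy g, h, h'] with z h1 h2 h3 h4
    rw [h3, h4, Pi.add_apply, Pi.add_apply, h1, h2, mul_add]
  zero_mem' := by
    intro g
    have h := Lp.coeFn_zero ℝ (ENNReal.ofReal (critExp N)) (volume : Measure (Eucl N))
    have h' := (g : OGroup N).measurePreserving.quasiMeasurePreserving.ae h
    rw [map_zero]
    filter_upwards [h, h'] with z h3 h4
    rw [h3, h4, Pi.zero_apply, Pi.zero_apply, mul_zero]
  smul_mem' := by
    intro c x hx g
    have h := Lp.coeFn_smul c (potential x)
    have h' := (g : OGroup N).measurePreserving.quasiMeasurePreserving.ae h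
    rw [map_smul]
    filter_upwards [hx g, h, h'] with z h1 h3 h4
    rw [h3, h4, Pi.smul_apply, Pi.smul_apply, h1, smul_eq_mul, smul_eq_mul, mul_left_comm]

theorem mem_equivSpace {G : Subgroup (OGroup N)} {φ : G →* ℤˣ} {x : gradSpace N} :
    x ∈ equivSpace φ ↔
      ∀ g : G, ∀ᵐ z, potential x ((g : OGroup N) z) = ((φ g : ℤ) : ℝ) * potential x z := Iff.rfl

variable {A p q θ : ℝ} {f : ℝ → ℝ} (hf : IsAdmissible (critExp N) A p q θ f)

include hf

/-- The gradient of the energy commutes with rigid motions. -/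
theorem gradJ_rigid (T : OGroup N) (b : Eucl N) (x : gradSpace N) :
    gradJ potential hf (rigid T b x) = rigid T b (gradJ potential hf x) := by
  refine ext_inner_right ℝ fun y => ?_
  rw [inner_rigid_left, inner_gradJ, inner_gradJ, inner_rigid_left]
  congr 1
  let e : Eucl N ≃ᵐ Eucl N := (T.toHomeomorph.trans (Homeomorph.addRight b)).toMeasurableEquiv
  have he : MeasurePreserving e volume volume := measurePreserving_rigid T b
  rw [← he.integral_comp' (fun z => f (potential x z) *
    potential (rigid T.symm (-(T.symm b)) y) z)]
  have h := potential_rigid T b (rigid T.symm (-(T.symm b)) y)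
  rw [rigid_rigid_symm] at h
  refine integral_congr_ae ?_
  filter_upwards [potential_rigid T b x, h] with z h1 h2
  rw [h1, h2]
  rfl

theorem gradJ_neg (x : gradSpace N) : gradJ potential hf (-x) = -gradJ potential hf x := by
  refine ext_inner_right ℝ fun y => ?_
  rw [inner_neg_left, inner_gradJ, inner_gradJ, inner_neg_left]
  have : ∫ z, f (potential (-x) z) * potential y z = -∫ z, f (potential x z) * potential y z := by
    rw [← integral_neg, map_neg]
    refine integral_congr_ae ?_
    filter_upwards [Lp.coeFn_neg (potential x)] with z hz
    rw [hz, Pi.neg_apply, hf.odd, neg_mul]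
  linarith

omit hf in
theorem mem_equivSpace_iff_rigid {G : Subgroup (OGroup N)} {φ : G →* ℤˣ} {x : gradSpace N} :
    x ∈ equivSpace φ ↔ ∀ g : G, rigid (g : OGroup N) 0 x = ((φ g : ℤ) : ℝ) • x := by
  rw [mem_equivSpace]
  refine forall_congr' fun g => ⟨fun h => potential_injective (Lp.ext ?_), fun h => ?_⟩
  · rw [map_smul]
    filter_upwards [potential_rigid (g : OGroup N) 0 x, h,
      Lp.coeFn_smul ((φ g : ℤ) : ℝ) (potential x)] with z h1 h2 h3
    rw [h1, add_zero, h2, h3, Pi.smul_apply, smul_eq_mul]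
  · have h4 := potential_rigid (g : OGroup N) 0 x
    rw [h, map_smul] at h4
    filter_upwards [h4, Lp.coeFn_smul ((φ g : ℤ) : ℝ) (potential x)] with z h1 h3
    rw [h3, Pi.smul_apply, smul_eq_mul, add_zero] at h1
    exact h1.symm

/-- The principle of symmetric criticality. -/
theorem gradJ_mem_equivSpace {G : Subgroup (OGroup N)} {φ : G →* ℤˣ} {x : gradSpace N}
    (hx : x ∈ equivSpace φ) : gradJ potential hf x ∈ equivSpace φ := by
  rw [mem_equivSpace_iff_rigid] at hx ⊢
  intro g
  -- The factor φ(g) is ±1, and the oddness of f lets it pass through the gradient.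
  rw [← gradJ_rigid, hx g]
  rcases Int.units_eq_one_or (φ g) with h | h <;> simp [h, gradJ_neg]

end Equivariance

/-! ### The profile at a concentration point -/

section Profile

variable {N : ℕ} [hN : Fact (5 ≤ N)]

omit hN in
/-- Mollifications are controlled by local `L^2` norms. -/
theorem exists_enorm_mollify_sq_le (n : ℕ) : ∃ C : ℝ, ∀ (u : Eucl N → ℝ), Measurable u →
    ∀ (B : ℝ) (b : Eucl N), ‖b‖ ≤ B → ‖mollify n u b‖ₑ ^ (2 : ℝ) ≤
      ENNReal.ofReal C * ∫⁻ z in ball 0 (B + 2), ‖u z‖ₑ ^ (2 : ℝ) := by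
  obtain ⟨K, hK⟩ := (hasCompactSupport_rho (N := N) n).exists_bound_of_continuous (continuous_rho n)
  refine ⟨K, fun u hum B b hb => ?_⟩
  have hind : Measurable ((ball (0 : Eucl N) (B + 2)).indicator fun z => ‖u z‖ₑ ^ (2 : ℝ)) :=
    Measurable.indicator (by fun_prop) measurableSet_ball
  calc ‖mollify n u b‖ₑ ^ (2 : ℝ) ≤ (∫⁻ z, ‖u (b - z)‖ₑ ∂rhoMeasure N n) ^ (2 : ℝ) :=
        ENNReal.rpow_le_rpow (enorm_mollify_le n hum b) zero_le_two
    _ ≤ ∫⁻ z, ‖u (b - z)‖ₑ ^ (2 : ℝ) ∂rhoMeasure N n :=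
        rpow_lintegral_le (by fun_prop) one_le_two
    -- Only ‖z‖ ≤ 1 matters, so b - z has norm at most B + 1, inside the open ball of radius B + 2.
    _ ≤ ∫⁻ z, (ball (0 : Eucl N) (B + 2)).indicator (fun z => ‖u z‖ₑ ^ (2 : ℝ)) (b - z)
          ∂rhoMeasure N n := by
        refine lintegral_mono_ae ?_
        filter_upwards [ae_rhoMeasure_norm_le n] with z hz
        rw [Set.indicator_of_mem]
        have h1 : 1 / ((n : ℝ) + 1) ≤ 1 := by
          rw [div_le_one (by positivity)]; linarith [(Nat.cast_nonneg n : (0 : ℝ) ≤ n)]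
        have := norm_sub_le b z
        simp only [mem_ball_zero_iff]; linarith
    _ = ∫⁻ z, ENNReal.ofReal (rho N n z) *
          (ball (0 : Eucl N) (B + 2)).indicator (fun z => ‖u z‖ₑ ^ (2 : ℝ)) (b - z) :=
        lintegral_rhoMeasure n _ (hind.comp (measurable_const.sub measurable_id))
    _ ≤ ∫⁻ z, ENNReal.ofReal K *
          (ball (0 : Eucl N) (B + 2)).indicator (fun z => ‖u z‖ₑ ^ (2 : ℝ)) (b - z) := by
        refine lintegral_mono fun z => ?_
        gcongr
        exact (le_abs_self _).trans (hK z)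
    _ = ENNReal.ofReal K * ∫⁻ z in ball 0 (B + 2), ‖u z‖ₑ ^ (2 : ℝ) := by
        rw [lintegral_const_mul' _ _ (by simp), lintegral_sub_left_eq_self
          ((ball (0 : Eucl N) (B + 2)).indicator fun z => ‖u z‖ₑ ^ (2 : ℝ)) b,
          lintegral_indicator measurableSet_ball]

theorem mollify_potential_rigid_one (n : ℕ) (ξ : Eucl N) (x : gradSpace N) (y : Eucl N) :
    mollify n (potential (rigid 1 ξ x)) y = mollify n (potential x) (y + ξ) := by
  rw [mollify_apply', mollify_apply',
    ← integral_add_right_eq_self (fun z => rho N n (y + ξ - z) * potential x z) ξ]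
  refine integral_congr_ae ?_
  filter_upwards [potential_rigid 1 ξ x] with z hz
  rw [hz, add_sub_add_right_eq_sub]
  rfl

/-- The density of the energy on the Nehari manifold. -/
def nehariDensity (f : ℝ → ℝ) (s : ℝ) : ℝ := 1 / 2 * (f s * s) - primF f s

instance : TopologicalSpace.SeparableSpace (gradSpace N) := by
  have : Fact ((2 : ℝ≥0∞) ≠ ⊤) := ⟨by simp⟩
  have : SecondCountableTopology (LGrad N) := Lp.SecondCountableTopology
  have : SecondCountableTopology (gradSpace N) :=
    TopologicalSpace.Subtype.secondCountableTopology (gradSpace N : Set (LGrad N))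
  exact TopologicalSpace.SecondCountableTopology.to_separableSpace

variable {A p q θ : ℝ} {f : ℝ → ℝ} (hf : IsAdmissible (critExp N) A p q θ f)

include hf

omit hN in
theorem IsAdmissible.nehariDensity_nonneg (s : ℝ) : 0 ≤ nehariDensity f s := by
  have := hf.two_mul_primF_le s
  rw [nehariDensity]; linarith

omit hN in
theorem IsAdmissible.continuous_nehariDensity : Continuous (nehariDensity f) :=
  ((hf.continuous.mul continuous_id).const_mul (1 / 2)).sub hf.continuous_primF

omit hN in
theorem IsAdmissible.nehariDensity_neg (s : ℝ) : nehariDensity f (-s) = nehariDensity f s := by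
  rw [nehariDensity, nehariDensity, hf.odd, hf.primF_neg]; ring

theorem IsAdmissible.integrable_nehariDensity (u : LCrit N) :
    Integrable fun z => nehariDensity f (u z) :=
  ((hf.integrable_mul u u).const_mul _).sub (hf.integrable_primF u)

/-- Translates of an equivariant function to the points of an orbit carry the same energy density;
when these points are far apart, the energies add up. -/
theorem sum_setLIntegral_le {G : Subgroup (OGroup N)} {φ : G →* ℤˣ} {x : gradSpace N}
    (hx : x ∈ equivSpace φ) (ξ : Eucl N) {m : ℕ} (g : Fin m → G) {ρ : ℝ}
    (hg : ∀ i j, i ≠ j → 2 * ρ ≤ ‖(g i : OGroup N) ξ - (g j : OGroup N) ξ‖) :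
    (m : ℝ≥0∞) * ∫⁻ z in ball 0 ρ, ENNReal.ofReal (nehariDensity f (potential (rigid 1 ξ x) z)) ≤
      ∫⁻ z, ENNReal.ofReal (nehariDensity f (potential x z)) := by
  set h : Eucl N → ℝ≥0∞ := fun z => ENNReal.ofReal (nehariDensity f (potential x z)) with hh
  have hone : ∀ i, ∫⁻ z in ball 0 ρ, ENNReal.ofReal (nehariDensity f (potential (rigid 1 ξ x) z)) =
      ∫⁻ z in ball ((g i : OGroup N) ξ) ρ, h z := by
    intro i
    -- The motion z ↦ g(z + ξ) carries the ball about 0 to the ball about gξ and changes the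
    -- function at most by a sign, which the even density does not see.
    have hT := measurePreserving_rigid (g i : OGroup N) ((g i : OGroup N) ξ)
    have hhm : Measurable h :=
      (hf.continuous_nehariDensity.measurable.comp (measurable_lp (potential x))).ennreal_ofReal
    rw [← hT.setLIntegral_comp_preimage measurableSet_ball hhm]
    have hpre : (fun z => (g i : OGroup N) z + (g i : OGroup N) ξ) ⁻¹'
        ball ((g i : OGroup N) ξ) ρ = ball 0 ρ := by
      ext z; simp [mem_ball, dist_eq_norm]
    rw [hpre]
    refine setLIntegral_congr_fun_ae measurableSet_ball ?_
    have h1 := (measurePreserving_add_right volume ξ).quasiMeasurePreserving.ae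
      (mem_equivSpace.1 hx (g i))
    filter_upwards [h1, potential_rigid 1 ξ x] with z hz hz' _
    rw [hz', hh]
    simp only
    rw [← map_add, hz]
    rcases Int.units_eq_one_or (φ (g i)) with h2 | h2
    · simp [h2]
    · simp [h2, hf.nehariDensity_neg]
  calc (m : ℝ≥0∞) * ∫⁻ z in ball 0 ρ, ENNReal.ofReal (nehariDensity f (potential (rigid 1 ξ x) z))
      = ∑ i : Fin m, ∫⁻ z in ball ((g i : OGroup N) ξ) ρ, h z := by
        rw [Finset.sum_congr rfl fun i _ => (hone i).symm]; simp
    _ = ∫⁻ z in ⋃ i ∈ (Finset.univ : Finset (Fin m)), ball ((g i : OGroup N) ξ) ρ, h z := by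
        refine (lintegral_biUnion_finset (fun i _ j _ hij => ?_)
          (fun i _ => measurableSet_ball) _).symm
        refine ball_disjoint_ball ?_
        rw [dist_eq_norm]; linarith [hg i j hij]
    _ ≤ ∫⁻ z, h z := setLIntegral_le_lintegral _ _

set_option maxHeartbeats 1600000 in
/-- The profile of a Palais-Smale sequence at points where it concentrates. -/
theorem exists_profile {G : Subgroup (OGroup N)} {φ : G →* ℤˣ} {w : ℕ → gradSpace N} {R c : ℝ}
    (hw : ∀ k, w k ∈ equivSpace φ) (hR : ∀ k, ‖w k‖ ≤ R)
    (hgrad : Tendsto (fun k => ‖gradJ potential hf (w k)‖) atTop (𝓝 0))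
    (hE : Tendsto (fun k => energyX potential f (w k)) atTop (𝓝 c))
    {n : ℕ} {η B : ℝ} (hη : 0 < η) {y ξ : ℕ → Eucl N}
    (hy : ∀ k, η < |mollify n (potential (w k)) (y k)|) (hξ : ∀ k, ‖y k - ξ k‖ ≤ B) :
    ∃ v : gradSpace N, v ≠ 0 ∧ gradJ potential hf v = 0 ∧
      (∀ g : G, (∀ k, (g : OGroup N) (ξ k) = ξ k) →
        ∀ᵐ z, potential v ((g : OGroup N) z) = ((φ g : ℤ) : ℝ) * potential v z) ∧
      ∀ (m : ℕ) (g : Fin m → G), (∀ i j, i ≠ j → Tendsto (fun k =>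
        ‖(g i : OGroup N) (ξ k) - (g j : OGroup N) (ξ k)‖) atTop atTop) →
          m * energyX potential f v ≤ c := by
  have hvR : ∀ k, ‖rigid 1 (ξ k) (w k)‖ ≤ R := fun k => by rw [norm_rigid]; exact hR k
  obtain ⟨v, σ, hσ, hweak⟩ := exists_subseq_tendsto_inner hvR
  obtain ⟨τ, hτ, hae⟩ := exists_subseq_ae_tendsto (fun k => hvR (σ k)) hweak
  set s : ℕ → ℕ := fun k => σ (τ k) with hs
  have hsm : StrictMono s := hσ.comp hτ
  have hst : Tendsto s atTop atTop := hsm.tendsto_atTop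
  set V : ℕ → gradSpace N := fun k => rigid 1 (ξ (s k)) (w (s k)) with hV
  have hVR : ∀ k, ‖V k‖ ≤ R := fun k => hvR (s k)
  have hVweak : ∀ z, Tendsto (fun k => inner ℝ (V k) z) atTop (𝓝 (inner ℝ v z)) := fun z =>
    (hweak z).comp hτ.tendsto_atTop
  have hVae : ∀ᵐ z, Tendsto (fun k => potential (V k) z) atTop (𝓝 (potential v z)) := hae
  have hcrit : gradJ potential hf v = 0 := by
    refine gradJ_eq_zero_of_tendsto hf hVR hVweak hVae fun x => ?_
    have h1 : Tendsto (fun k => ‖gradJ potential hf (w (s k))‖ * ‖x‖) atTop (𝓝 0) := by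
      simpa using (hgrad.comp hst).mul_const ‖x‖
    refine squeeze_zero_norm (fun k => ?_) h1
    rw [hV]
    simp only [gradJ_rigid]
    refine (norm_inner_le_norm _ _).trans ?_
    rw [norm_rigid]
  refine ⟨v, ?_, hcrit, fun g hg => ?_, fun m g hg => ?_⟩
  -- Were the limit zero, the translates would vanish locally in L², and with them the
  -- mollifications at y_k - ξ_k, points of norm at most B where these exceed η in absolute value.
  · rintro rfl
    obtain ⟨C, hC⟩ := exists_enorm_mollify_sq_le (N := N) n
    have h1 := tendsto_setLIntegral_potential hVR (by simpa using hVweak) (B + 2)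
    have h2 : Tendsto (fun k => ENNReal.ofReal C *
        ∫⁻ z in ball 0 (B + 2), ‖potential (V k) z‖ₑ ^ (2 : ℝ)) atTop (𝓝 0) := by
      simpa using ENNReal.Tendsto.const_mul (a := ENNReal.ofReal C) h1 (Or.inr (by simp))
    have hpos : 0 < ENNReal.ofReal η ^ (2 : ℝ) :=
      ENNReal.rpow_pos (by simpa using hη) (by simp)
    obtain ⟨k, hk⟩ := (h2.eventually_lt_const hpos).exists
    have h3 := hC _ (measurable_lp (potential (V k))) B (y (s k) - ξ (s k)) (hξ (s k))
    have h4 := h3.trans_lt hk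
    rw [hV, mollify_potential_rigid_one, sub_add_cancel, ENNReal.rpow_lt_rpow_iff two_pos,
      ← ofReal_norm, Real.norm_eq_abs] at h4
    exact absurd (hy (s k)) (not_lt.2 (ENNReal.lt_ofReal_iff_toReal_lt (by simp) |>.1 h4 |>.le |>.trans'
      (by rw [ENNReal.toReal_ofReal (abs_nonneg _)])))
  -- An isometry fixing ξ_k commutes with the translation by ξ_k, so the translates keep this
  -- symmetry, and the almost everywhere limit inherits it.
  · have hk : ∀ᵐ z, ∀ k, potential (V k) ((g : OGroup N) z) =
        ((φ g : ℤ) : ℝ) * potential (V k) z := by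
      refine ae_all_iff.2 fun k => ?_
      have h1 := potential_rigid 1 (ξ (s k)) (w (s k))
      have h2 := (g : OGroup N).measurePreserving.quasiMeasurePreserving.ae h1
      have h3 := (measurePreserving_add_right volume (ξ (s k))).quasiMeasurePreserving.ae
        (mem_equivSpace.1 (hw (s k)) g)
      filter_upwards [h1, h2, h3] with z hz1 hz2 hz3
      rw [hz1, hz2]
      have h4 : (g : OGroup N) (z + ξ (s k)) = (g : OGroup N) z + ξ (s k) := by
        rw [map_add, hg]
      rw [h4] at hz3
      exact hz3
    have h2 := (g : OGroup N).measurePreserving.quasiMeasurePreserving.ae hVae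
    filter_upwards [hVae, h2, hk] with z hz1 hz2 hz3
    refine tendsto_nhds_unique hz2 ?_
    simp only [hz3]
    exact hz1.const_mul _
  · have hvN : ‖v‖ ^ 2 = ∫ z, f (potential v z) * potential v z := by
      have := inner_gradJ_self potential hf v
      rw [hcrit, inner_zero_left] at this
      linarith
    rw [energyX_eq_of_nehari hf potential hvN]
    change (m : ℝ) * ∫ z, nehariDensity f (potential v z) ≤ c
    -- The density integrates to the energy minus half of ⟨∇J(w), w⟩, and the latter tends to 0.
    have hlim : Tendsto (fun k => ∫ z, nehariDensity f (potential (w (s k)) z)) atTop (𝓝 c) := by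
      have h1 : Tendsto (fun k => ‖gradJ potential hf (w k)‖ * R) atTop (𝓝 0) := by
        simpa using hgrad.mul_const R
      have h2 : Tendsto (fun k => inner ℝ (gradJ potential hf (w k)) (w k)) atTop (𝓝 0) := by
        refine squeeze_zero_norm (fun k => (norm_inner_le_norm _ _).trans ?_) h1
        gcongr; exact hR k
      have h3 : Tendsto (fun k => energyX potential f (w k) -
          1 / 2 * inner ℝ (gradJ potential hf (w k)) (w k)) atTop (𝓝 c) := by
        have h3 := hE.sub (h2.const_mul (1 / 2))
        rwa [mul_zero, sub_zero] at h3
      have h4 : Tendsto (fun k => ∫ z, nehariDensity f (potential (w k) z)) atTop (𝓝 c) := by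
        refine h3.congr fun k => ?_
        rw [inner_gradJ_self, energyX_sub_eq hf]
        rfl
      exact h4.comp hst
    have hmeas : ∀ x : gradSpace N, Measurable fun z =>
        ENNReal.ofReal (nehariDensity f (potential x z)) := fun x =>
      (hf.continuous_nehariDensity.measurable.comp (measurable_lp (potential x))).ennreal_ofReal
    have hlint : ∀ u : LCrit N, ENNReal.ofReal (∫ z, nehariDensity f (u z)) =
        ∫⁻ z, ENNReal.ofReal (nehariDensity f (u z)) := fun u =>
      ofReal_integral_eq_lintegral_ofReal (hf.integrable_nehariDensity u)
        (ae_of_all _ fun z => hf.nehariDensity_nonneg _)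
    have hc0 : 0 ≤ c := ge_of_tendsto' hlim fun k => integral_nonneg fun z =>
      hf.nehariDensity_nonneg _
    refine le_of_forall_pos_le_add fun ε hε => ?_
    -- With ρ fixed, the m balls of radius ρ are disjoint for large k, so `sum_setLIntegral_le`
    -- applies, and Fatou's lemma passes to v. Letting ρ grow then exhausts the space.
    have hball : ∀ ρ : ℝ, ∫⁻ z, (m : ℝ≥0∞) * (ball (0 : Eucl N) ρ).indicator
        (fun z => ENNReal.ofReal (nehariDensity f (potential v z))) z ≤ ENNReal.ofReal (c + ε) := by
      intro ρ
      have hev : ∀ᶠ k in atTop, ∫⁻ z, (m : ℝ≥0∞) * (ball (0 : Eucl N) ρ).indicator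
          (fun z => ENNReal.ofReal (nehariDensity f (potential (V k) z))) z ≤
            ENNReal.ofReal (c + ε) := by
        have hsep : ∀ᶠ k in atTop, ∀ i j, i ≠ j →
            2 * ρ ≤ ‖(g i : OGroup N) (ξ (s k)) - (g j : OGroup N) (ξ (s k))‖ := by
          refine eventually_all.2 fun i => eventually_all.2 fun j => ?_
          by_cases hij : i = j
          · exact Eventually.of_forall fun k h => absurd hij h
          · filter_upwards [((hg i j hij).comp hst).eventually_ge_atTop (2 * ρ)] with k hk _
            exact hk
        filter_upwards [hsep, hlim.eventually_lt_const (lt_add_of_pos_right c hε)] with k hk hk'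
        rw [lintegral_const_mul' _ _ (by simp), lintegral_indicator measurableSet_ball]
        refine (sum_setLIntegral_le hf (hw (s k)) (ξ (s k)) g hk).trans ?_
        rw [← hlint]
        exact ENNReal.ofReal_le_ofReal hk'.le
      obtain ⟨k₀, hk₀⟩ := eventually_atTop.1 hev
      refine lintegral_le_of_ae_tendsto (F := fun k z => (m : ℝ≥0∞) *
        (ball (0 : Eucl N) ρ).indicator
          (fun z => ENNReal.ofReal (nehariDensity f (potential (V (k + k₀)) z))) z)
        (fun k => (((hmeas _).indicator measurableSet_ball).const_mul _).aemeasurable) ?_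
        fun k => hk₀ _ (Nat.le_add_left _ _)
      filter_upwards [hVae] with z hz
      refine ENNReal.Tendsto.const_mul ?_ (Or.inr (by simp))
      by_cases hzb : z ∈ ball (0 : Eucl N) ρ
      · simp only [Set.indicator_of_mem hzb]
        have h1 := (hf.continuous_nehariDensity.tendsto _).comp hz
        exact ENNReal.tendsto_ofReal ((tendsto_add_atTop_iff_nat k₀).2 h1)
      · simp only [Set.indicator_of_notMem hzb]
        exact tendsto_const_nhds
    have hall : ∫⁻ z, (m : ℝ≥0∞) * ENNReal.ofReal (nehariDensity f (potential v z)) ≤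
        ENNReal.ofReal (c + ε) := by
      refine lintegral_le_of_ae_tendsto (fun j => (((hmeas v).indicator
        (measurableSet_ball (x := (0 : Eucl N)) (ε := (j : ℝ)))).const_mul _).aemeasurable)
        (ae_of_all _ fun z => ?_) fun j => hball j
      obtain ⟨j₀, hj₀⟩ := exists_nat_gt ‖z‖
      refine tendsto_const_nhds.congr' ?_
      filter_upwards [eventually_ge_atTop j₀] with j hj
      rw [Set.indicator_of_mem]
      have : (j₀ : ℝ) ≤ j := by exact_mod_cast hj
      simp only [mem_ball_zero_iff]; linarith
    rw [lintegral_const_mul' _ _ (by simp), ← hlint, ← ENNReal.ofReal_natCast,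
      ← ENNReal.ofReal_mul (by positivity), ENNReal.ofReal_le_ofReal_iff (by linarith)] at hall
    exact hall

end Profile

/-! ### Orbits of unbounded sequences of points -/

section Group

variable {N : ℕ}

/-- Points of a subspace move little under a linear isometry only if they are close to the
fixed points in this subspace. -/
theorem exists_norm_sub_fixed_le (W : Submodule ℝ (Eucl N)) (g : OGroup N) : ∃ C : ℝ, 0 ≤ C ∧
    ∀ ξ ∈ W, ∃ ξ' ∈ W, g ξ' = ξ' ∧ ‖ξ - ξ'‖ ≤ C * ‖g ξ - ξ‖ := by
  obtain ⟨T, hT⟩ : ∃ T : W →ₗ[ℝ] Eucl N, ∀ ξ : W, T ξ = g ξ - ξ :=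
    ⟨(g.toLinearEquiv.toLinearMap - LinearMap.id) ∘ₗ W.subtype, fun ξ => rfl⟩
  -- Subtracting S(Tξ) from ξ lands in the kernel of T, which consists of the fixed points in W. The
  -- constant is the norm of S, finite because the dimension is.
  obtain ⟨S, hS⟩ := T.rangeRestrict.exists_rightInverse_of_surjective T.range_rangeRestrict
  have hTS : ∀ z, T (S z) = z := fun z => congrArg Subtype.val (LinearMap.congr_fun hS z)
  refine ⟨‖LinearMap.toContinuousLinearMap S‖,
    (LinearMap.toContinuousLinearMap S).opNorm_nonneg, fun ξ hξ => ?_⟩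
  obtain ⟨ξ₁, rfl⟩ : ∃ ξ₁ : W, (ξ₁ : Eucl N) = ξ := ⟨⟨ξ, hξ⟩, rfl⟩
  refine ⟨((ξ₁ - S (T.rangeRestrict ξ₁) : W) : Eucl N), Subtype.property _, ?_, ?_⟩
  · rw [← sub_eq_zero, ← hT, map_sub, hTS, LinearMap.codRestrict_apply, sub_self]
  · have h := (LinearMap.toContinuousLinearMap S).le_opNorm (T.rangeRestrict ξ₁)
    rw [← hT]
    simpa using h

/-- A sequence of points has a subsequence which stays close to a subspace `W`, and whose points
are moved to infinity by every linear isometry not fixing `W`. -/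
theorem exists_subspace_near (y : ℕ → Eucl N) :
    ∃ (W : Submodule ℝ (Eucl N)) (σ : ℕ → ℕ) (ξ : ℕ → Eucl N) (B : ℝ), StrictMono σ ∧
      (∀ k, ξ k ∈ W) ∧ (∀ k, ‖y (σ k) - ξ k‖ ≤ B) ∧
      ∀ g : OGroup N, ¬ (∀ w ∈ W, g w = w) → Tendsto (fun k => ‖g (ξ k) - ξ k‖) atTop atTop := by
  classical
  have hex : ∃ d : ℕ, ∃ (W : Submodule ℝ (Eucl N)) (σ : ℕ → ℕ) (ξ : ℕ → Eucl N) (B : ℝ),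
      Module.finrank ℝ W = d ∧ StrictMono σ ∧ (∀ k, ξ k ∈ W) ∧ ∀ k, ‖y (σ k) - ξ k‖ ≤ B :=
    ⟨_, ⊤, id, y, 0, rfl, strictMono_id, fun _ => trivial, fun k => by simp⟩
  -- W has the least dimension among the subspaces that a subsequence stays close to.
  obtain ⟨W, σ, ξ, B, hd, hσ, hξ, hB⟩ := Nat.find_spec hex
  refine ⟨W, σ, ξ, B, hσ, hξ, hB, fun g hg => ?_⟩
  -- If g moved ξ_k only boundedly along a subsequence, these points would stay close to the fixed
  -- points of g in W, a strictly smaller subspace.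
  by_contra hnt
  rw [Filter.tendsto_atTop] at hnt
  push Not at hnt
  obtain ⟨M, hM⟩ := hnt
  obtain ⟨τ, hτ, hτM⟩ := extraction_of_frequently_atTop hM
  obtain ⟨C, hC, hfix⟩ := exists_norm_sub_fixed_le W g
  choose ξ' hξ'W hξ'g hξ' using fun k => hfix (ξ (τ k)) (hξ _)
  obtain ⟨W', hW'⟩ : ∃ W' : Submodule ℝ (Eucl N), ∀ w, w ∈ W' ↔ w ∈ W ∧ g w = w :=
    ⟨W ⊓ LinearMap.eqLocus g.toLinearEquiv.toLinearMap LinearMap.id, fun w => Iff.rfl⟩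
  have hlt : W' < W := by
    refine lt_of_le_of_ne (fun w hw => ((hW' w).1 hw).1) ?_
    rintro rfl
    exact hg fun w hw => ((hW' w).1 hw).2
  have hfr := Submodule.finrank_lt_finrank_of_lt hlt
  rw [hd] at hfr
  refine Nat.find_min hex hfr ⟨W', σ ∘ τ, ξ', B + C * M, rfl, hσ.comp hτ,
    fun k => (hW' _).2 ⟨hξ'W k, hξ'g k⟩, fun k => ?_⟩
  calc ‖y (σ (τ k)) - ξ' k‖ ≤ ‖y (σ (τ k)) - ξ (τ k)‖ + ‖ξ (τ k) - ξ' k‖ := norm_sub_le_norm_sub_add_norm_sub ..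
    _ ≤ B + C * M := by
      have := mul_le_mul_of_nonneg_left (hτM k).le hC
      linarith [hB (τ k), hξ' k]

/-- If the pointwise stabilizer of a subspace has finite index, then it is an isotropy group. -/
theorem exists_isotropy_subgroupOf_eq (G : Subgroup (OGroup N)) (W : Submodule ℝ (Eucl N))
    (K : Subgroup G) (hK : ∀ g : G, g ∈ K ↔ ∀ w ∈ W, (g : OGroup N) w = w) [Finite (G ⧸ K)] :
    ∃ w ∈ W, (isotropy G w).subgroupOf G = K := by
  have hfix : ∀ g : OGroup N, ∃ V : Submodule ℝ W, ∀ w : W, w ∈ V ↔ g w = w := fun g =>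
    ⟨LinearMap.eqLocus (g.toLinearEquiv.toLinearMap ∘ₗ W.subtype) W.subtype, fun w => Iff.rfl⟩
  choose V hV using hfix
  -- A real vector space is not a finite union of proper subspaces. One representative per
  -- nontrivial coset suffices, because K fixes W pointwise.
  have hex : ∃ w : W, ∀ a : {a : G ⧸ K // a ≠ (1 : G)}, w ∉ V (a.1.out : OGroup N) := by
    by_contra! hcon
    obtain ⟨a, ha⟩ := Subspace.exists_eq_top_of_iUnion_eq_univ
      (p := fun a : {a : G ⧸ K // a ≠ (1 : G)} => V (a.1.out : OGroup N))
      (Set.eq_univ_of_forall fun w => Set.mem_iUnion.2 (hcon w))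
    refine a.2 ?_
    rw [← QuotientGroup.out_eq' a.1, QuotientGroup.eq, mul_one, K.inv_mem_iff, hK]
    intro w hw
    have : (⟨w, hw⟩ : W) ∈ V (a.1.out : OGroup N) := ha ▸ Submodule.mem_top
    exact (hV _ _).1 this
  obtain ⟨w, hw⟩ := hex
  refine ⟨w, w.2, Subgroup.ext fun g => ?_⟩
  rw [Subgroup.mem_subgroupOf]
  refine ⟨fun h => ?_, fun h => ⟨g.2, (hK g).1 h w w.2⟩⟩
  by_contra hg
  have hne : ((g : G) : G ⧸ K) ≠ (1 : G) := by
    rwa [Ne, QuotientGroup.eq, mul_one, K.inv_mem_iff]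
  obtain ⟨k, hk⟩ := QuotientGroup.mk_out_eq_mul K g
  refine hw ⟨_, hne⟩ ((hV _ _).2 ?_)
  rw [hk]
  change (g : OGroup N) (((k : G) : OGroup N) w) = w
  rw [(hK _).1 k.2 w w.2]
  exact h.2

end Group

/-! ### The Nehari set in Hilbert space terms -/

section Nehari

variable {N : ℕ} [hN : Fact (5 ≤ N)]

theorem energyJ_potential (f : ℝ → ℝ) (x : gradSpace N) :
    energyJ f (potential x) = energyX potential f x := by
  rw [energyJ, energyX, normD_potential]

theorem potential_mem_nehari {f : ℝ → ℝ} {G : Subgroup (OGroup N)} {φ : G →* ℤˣ}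
    {x : gradSpace N} : potential x ∈ nehari f φ ↔ x ∈ equivSpace φ ∧ x ≠ 0 ∧
      ‖x‖ ^ 2 = ∫ z, f (potential x z) * potential x z := by
  have h0 : potential x ≠ 0 ↔ x ≠ 0 := by
    rw [← map_zero (potential (N := N)), potential_injective.ne_iff]
  have h1 : derivJ f (potential x) (potential x) = 0 ↔
      ‖x‖ ^ 2 = ∫ z, f (potential x z) * potential x z := by
    rw [derivJ, innerD_potential, real_inner_self_eq_norm_sq, sub_eq_zero]
  have h2 : potential x ∈ D12Equiv φ ↔ x ∈ equivSpace φ :=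
    ⟨fun h => h.2, fun h => ⟨potential_mem_D12 x, h⟩⟩
  change potential x ∈ D12Equiv φ ∧ potential x ≠ 0 ∧ _ ↔ _
  rw [h0, h1, h2]

theorem exists_of_mem_nehari {f : ℝ → ℝ} {G : Subgroup (OGroup N)} {φ : G →* ℤˣ} {u : LCrit N}
    (hu : u ∈ nehari f φ) : ∃ x ∈ equivSpace φ, x ≠ 0 ∧
      ‖x‖ ^ 2 = (∫ z, f (potential x z) * potential x z) ∧
      energyJ f u = energyX potential f x := by
  obtain ⟨x, rfl⟩ := exists_potential_eq hu.1.1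
  obtain ⟨h1, h2, h3⟩ := potential_mem_nehari.1 hu
  exact ⟨x, h1, h2, h3, energyJ_potential f x⟩

/-- A smooth cutoff serves as an example. It supplies a Nehari element when the group is trivial. -/
theorem exists_gradSpace_ne_zero : ∃ x : gradSpace N, x ≠ 0 := by
  set ψ : Eucl N → ℝ := cutoff 0 with hψ
  have hs : ContDiff ℝ ∞ ψ := contDiff_cutoff 0
  have hcs : HasCompactSupport ψ := hasCompactSupport_cutoff 0
  have hs1 : ContDiff ℝ 1 ψ := hs.of_le (by norm_num)
  have hu : MemLp ψ (ENNReal.ofReal (critExp N)) volume :=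
    hs.continuous.memLp_of_hasCompactSupport hcs
  have hg : MemLp (fun x => (InnerProductSpace.toDual ℝ (Eucl N)).symm (fderiv ℝ ψ x)) 2 volume := by
    refine Continuous.memLp_of_hasCompactSupport ?_ ?_
    · exact (LinearIsometryEquiv.continuous _).comp (hs1.continuous_fderiv one_ne_zero)
    · exact (hcs.fderiv (𝕜 := ℝ)).comp_left (map_zero _)
  have hweak : IsWeakGradient ψ
      (fun x => (InnerProductSpace.toDual ℝ (Eucl N)).symm (fderiv ℝ ψ x)) := by
    intro χ hχ hχc v
    have hχ1 : ContDiff ℝ 1 χ := hχ.of_le (by norm_num)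
    have hi : ∀ {a b : Eucl N → ℝ}, ContDiff ℝ 1 a → ContDiff ℝ 1 b → HasCompactSupport b →
        Integrable fun x => fderiv ℝ a x v * b x := fun ha hb hbc =>
      (((ha.continuous_fderiv one_ne_zero).clm_apply continuous_const).mul
        hb.continuous).integrable_of_hasCompactSupport hbc.mul_left
    simp only [InnerProductSpace.toDual_symm_apply]
    refine integral_mul_fderiv_eq_neg_fderiv_mul_of_integrable (hi hs1 hχ1 hχc) ?_ ?_
      (fun x _ => hs1.differentiable one_ne_zero x) (fun x _ => hχ1.differentiable one_ne_zero x)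
    · simpa only [mul_comm] using hi hχ1 hs1 hcs
    · exact (hs1.continuous.mul hχ1.continuous).integrable_of_hasCompactSupport hχc.mul_left
  have hweak' := hweak.congr hu.coeFn_toLp.symm hg.coeFn_toLp.symm
  refine ⟨⟨hg.toLp _, mem_gradSpace.2 ⟨_, hweak'⟩⟩, fun h => ?_⟩
  have h1 := potential_mk hweak'
  rw [h, map_zero] at h1
  have h2 : ψ =ᵐ[volume] fun _ => (0 : ℝ) := by
    filter_upwards [hu.coeFn_toLp, Lp.coeFn_zero ℝ (ENNReal.ofReal (critExp N))
      (volume : Measure (Eucl N))] with z hz hz0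
    rw [← hz, ← h1, hz0, Pi.zero_apply]
  have h3 := (Continuous.ae_eq_iff_eq volume hs.continuous continuous_const).1 h2
  have h4 : ψ 0 = 1 := cutoff_eq_one (by simp)
  rw [h3] at h4
  exact zero_ne_one h4

variable {A p q θ : ℝ} {f : ℝ → ℝ} (hf : IsAdmissible (critExp N) A p q θ f)

include hf

theorem integral_mul_pos {x : gradSpace N} (hx : x ≠ 0) :
    0 < ∫ z, f (potential x z) * potential x z := by
  refine lt_of_le_of_ne (integral_nonneg fun z => hf.mul_nonneg _) fun h => hx ?_
  have h1 := (integral_eq_zero_iff_of_nonneg (fun z => hf.mul_nonneg (potential x z))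
    (hf.integrable_mul _ _)).1 h.symm
  refine potential_injective ?_
  rw [map_zero]
  refine Lp.ext ?_
  filter_upwards [h1, Lp.coeFn_zero ℝ (ENNReal.ofReal (critExp N))
    (volume : Measure (Eucl N))] with z hz hz0
  rw [hz0]
  by_contra hne
  exact (hf.mul_pos hne).ne' hz

/-- Every ray from the origin meets the Nehari manifold. -/
theorem exists_smul_nehari {x : gradSpace N} (hx : x ≠ 0) : ∃ t : ℝ, t • x ≠ 0 ∧
    ‖t • x‖ ^ 2 = ∫ z, f (potential (t • x) z) * potential (t • x) z := by
  set I := ∫ z, f (potential x z) * potential x z with hI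
  have hIpos : 0 < I := integral_mul_pos hf hx
  have hθ := hf.two_lt_theta
  have hlim : Tendsto (fun t : ℝ => t ^ (θ - 2) * I) atTop atTop :=
    (tendsto_rpow_atTop (by linarith)).atTop_mul_const hIpos
  obtain ⟨t, ht, ht1⟩ := ((hlim.eventually_gt_atTop (2 * ‖x‖ ^ 2)).and
    (eventually_ge_atTop 1)).exists
  have hneg : energyX potential f ((2 * t) • x) < 0 := by
    refine (energyX_two_mul_smul_le hf potential x ht1).trans_lt ?_
    have ht0 : 0 < t := by linarith
    have h1 : t ^ θ = t ^ 2 * t ^ (θ - 2) := by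
      rw [← Real.rpow_natCast t 2, ← Real.rpow_add ht0]; congr 1; push_cast; ring
    rw [h1]
    nlinarith [mul_lt_mul_of_pos_left ht (pow_pos ht0 2)]
  obtain ⟨s, -, hs0, hs⟩ := exists_nehari_of_path hf potential (T := 2 * t) (by linarith)
    (γ := fun s => s • x) (by fun_prop) (zero_smul ℝ x) hneg
  exact ⟨s, hs0, hs⟩

end Nehari

/-! ### Existence of a minimizer -/

section Minimizer

variable {N : ℕ} [hN : Fact (5 ≤ N)] {A p q θ : ℝ} {f : ℝ → ℝ}
  (hf : IsAdmissible (critExp N) A p q θ f)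

include hf

/-- If the Nehari set were empty, its infimum would be ⊤, which is strictly below nothing; so any
point moved by G rules this out. If no point is moved, G is trivial and every function is
equivariant. -/
theorem nehari_nonempty {G : Subgroup (OGroup N)} {φ : G →* ℤˣ}
    (hc : ∀ ξ : Eucl N, isotropy G ξ ≠ G →
      leastEnergy f φ < orbitIndex G ξ * leastEnergy f (restrictIsotropy φ ξ)) :
    (nehari f φ).Nonempty := by
  by_cases hG : ∀ g : G, g = 1
  · obtain ⟨x, hx⟩ := exists_gradSpace_ne_zero (N := N)
    obtain ⟨t, ht0, ht⟩ := exists_smul_nehari hf hx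
    refine ⟨_, potential_mem_nehari.2 ⟨mem_equivSpace.2 fun g => ae_of_all _ fun z => ?_, ht0, ht⟩⟩
    rw [hG g, map_one]
    simp
  · push Not at hG
    obtain ⟨g, hg⟩ := hG
    obtain ⟨ξ, hξ⟩ : ∃ ξ, (g : OGroup N) ξ ≠ ξ := by
      by_contra! h
      exact hg (Subtype.ext (LinearIsometryEquiv.ext h))
    have h := hc ξ fun h => hξ (h.symm ▸ g.2 : (g : OGroup N) ∈ isotropy G ξ).2
    by_contra hne
    rw [Set.not_nonempty_iff_eq_empty] at hne
    rw [leastEnergy, hne] at h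
    simp at h

/-- The least energy is a positive real number and is approached by a Palais-Smale sequence. -/
theorem exists_palaisSmale_leastEnergy {G : Subgroup (OGroup N)} {φ : G →* ℤˣ}
    (hne : (nehari f φ).Nonempty) : ∃ c : ℝ, 0 < c ∧ leastEnergy f φ = (c : EReal) ∧
      ∃ (w : ℕ → gradSpace N) (R : ℝ), (∀ k, w k ∈ equivSpace φ) ∧ (∀ k, ‖w k‖ ≤ R) ∧
        Tendsto (fun k => ‖gradJ potential hf (w k)‖) atTop (𝓝 0) ∧
        Tendsto (fun k => energyX potential f (w k)) atTop (𝓝 c) := by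
  obtain ⟨m, hm, hmin⟩ := exists_pos_le_energyX_of_nehari hf (potential (N := N))
  have hlow : ((m : ℝ) : EReal) ≤ leastEnergy f φ := by
    refine le_iInf₂ fun u hu => EReal.coe_le_coe_iff.2 ?_
    obtain ⟨x, -, hx0, hxN, hxE⟩ := exists_of_mem_nehari hu
    rw [hxE]
    exact hmin x hx0 hxN
  obtain ⟨c, hc⟩ : ∃ c : ℝ, leastEnergy f φ = (c : EReal) := by
    obtain ⟨u, hu⟩ := hne
    have hup : leastEnergy f φ ≤ (energyJ f u : EReal) := iInf₂_le u hu
    refine ⟨_, (EReal.coe_toReal (ne_top_of_le_ne_top (EReal.coe_ne_top _) hup)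
      (ne_bot_of_le_ne_bot (EReal.coe_ne_bot _) hlow)).symm⟩
  have hle : ∀ x ∈ equivSpace φ, x ≠ 0 →
      ‖x‖ ^ 2 = (∫ z, f (potential x z) * potential x z) → c ≤ energyX potential f x := by
    intro x hx hx0 hxN
    rw [← EReal.coe_le_coe_iff, ← hc, ← energyJ_potential]
    exact iInf₂_le _ (potential_mem_nehari.2 ⟨hx, hx0, hxN⟩)
  have happ : ∀ k : ℕ, ∃ x ∈ equivSpace φ, x ≠ 0 ∧
      ‖x‖ ^ 2 = (∫ z, f (potential x z) * potential x z) ∧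
      energyX potential f x < c + 1 / ((k : ℝ) + 1) := by
    intro k
    have hk : leastEnergy f φ < ((c + 1 / ((k : ℝ) + 1) : ℝ) : EReal) := by
      rw [hc, EReal.coe_lt_coe_iff]
      exact lt_add_of_pos_right c (by positivity)
    obtain ⟨u, hu, hlt⟩ : ∃ u ∈ nehari f φ,
        (energyJ f u : EReal) < ((c + 1 / ((k : ℝ) + 1) : ℝ) : EReal) := by
      rw [leastEnergy] at hk
      simpa only [iInf_lt_iff, exists_prop] using hk
    obtain ⟨x, hx, hx0, hxN, hxE⟩ := exists_of_mem_nehari hu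
    rw [EReal.coe_lt_coe_iff, hxE] at hlt
    exact ⟨x, hx, hx0, hxN, hlt⟩
  choose u hu hu0 huN huE using happ
  have hlim : Tendsto (fun k => energyX potential f (u k)) atTop (𝓝 c) := by
    refine tendsto_of_tendsto_of_tendsto_of_le_of_le tendsto_const_nhds ?_
      (fun k => hle _ (hu k) (hu0 k) (huN k)) fun k => (huE k).le
    simpa using (tendsto_one_div_add_atTop_nhds_zero_nat (𝕜 := ℝ)).const_add c
  obtain ⟨w, hw, ⟨R, hR⟩, hgrad, hE⟩ := exists_palaisSmale hf potential (equivSpace φ)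
    (fun x hx => gradJ_mem_equivSpace hf hx) hle hu hu0 huN hlim
  refine ⟨c, hm.trans_le ?_, hc, w, R, hw, hR, hgrad, hE⟩
  rwa [hc, EReal.coe_le_coe_iff] at hlow

/-- Critical points of the energy lie on the Nehari manifold. -/
theorem norm_sq_eq_of_gradJ_eq_zero {v : gradSpace N} (hv : gradJ potential hf v = 0) :
    ‖v‖ ^ 2 = ∫ z, f (potential v z) * potential v z := by
  have h := inner_gradJ_self potential hf v
  rw [hv, inner_zero_left] at h
  exact (sub_eq_zero.1 h.symm)

/-- The dichotomy for the profile: it is equivariant under the pointwise stabilizer of a subspace,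
and its energy counts once for each coset of this stabilizer. -/
theorem exists_profile_stabilizer {G : Subgroup (OGroup N)} {φ : G →* ℤˣ} {c : ℝ} (hc : 0 < c)
    {w : ℕ → gradSpace N} {R : ℝ} (hw : ∀ k, w k ∈ equivSpace φ) (hR : ∀ k, ‖w k‖ ≤ R)
    (hgrad : Tendsto (fun k => ‖gradJ potential hf (w k)‖) atTop (𝓝 0))
    (hE : Tendsto (fun k => energyX potential f (w k)) atTop (𝓝 c)) :
    ∃ (W : Submodule ℝ (Eucl N)) (K : Subgroup G) (v : gradSpace N),
      (∀ g : G, g ∈ K ↔ ∀ ξ ∈ W, (g : OGroup N) ξ = ξ) ∧ v ≠ 0 ∧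
      ‖v‖ ^ 2 = (∫ z, f (potential v z) * potential v z) ∧
      (∀ g ∈ K, ∀ᵐ z, potential v ((g : OGroup N) z) = ((φ g : ℤ) : ℝ) * potential v z) ∧
      ∀ (m : ℕ) (a : Fin m → G ⧸ K), Function.Injective a → m * energyX potential f v ≤ c := by
  obtain ⟨n, η, hη, hev⟩ := exists_lt_abs_mollify hf hc hR hgrad hE
  obtain ⟨k₀, hk₀⟩ := eventually_atTop.1 hev
  choose y hy using fun k => hk₀ (k + k₀) (Nat.le_add_left _ _)
  obtain ⟨W, σ, ξ, B, hσ, hξ, hB, hW⟩ := exists_subspace_near y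
  have hst : Tendsto (fun k => σ k + k₀) atTop atTop :=
    tendsto_atTop_mono (fun k => Nat.le_add_right (σ k) k₀) hσ.tendsto_atTop
  obtain ⟨v, hv0, hvc, hveq, hvE⟩ := exists_profile hf (fun k => hw (σ k + k₀))
    (fun k => hR (σ k + k₀)) (hgrad.comp hst) (hE.comp hst) hη (fun k => hy (σ k)) hB
  obtain ⟨K, hK⟩ : ∃ K : Subgroup G, ∀ g : G, g ∈ K ↔ ∀ ξ ∈ W, (g : OGroup N) ξ = ξ :=
    ⟨{ carrier := {g | ∀ ξ ∈ W, (g : OGroup N) ξ = ξ}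
       mul_mem' := fun {a b} ha hb ξ hξ => by
         change (a : OGroup N) ((b : OGroup N) ξ) = ξ
         rw [hb ξ hξ, ha ξ hξ]
       one_mem' := fun ξ _ => rfl
       inv_mem' := fun {a} ha ξ hξ => by
         change (a : OGroup N).symm ξ = ξ
         rw [LinearIsometryEquiv.symm_apply_eq, ha ξ hξ] }, fun g => Iff.rfl⟩
  refine ⟨W, K, v, hK, hv0, ?_, fun g hg => hveq g fun k => (hK g).1 hg _ (hξ k),
    fun m a ha => hvE m (fun i => (a i).out) fun i j hij => ?_⟩
  · exact norm_sq_eq_of_gradJ_eq_zero hf hvc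
  -- For distinct cosets, g_j⁻¹g_i does not fix W pointwise and so moves ξ_k to infinity; applying
  -- the isometry g_j turns this into ‖g_iξ_k - g_jξ_k‖ → ∞.
  · have hnK : (a j).out⁻¹ * (a i).out ∉ K := by
      intro h
      rw [← QuotientGroup.eq, QuotientGroup.out_eq', QuotientGroup.out_eq'] at h
      exact hij (ha h.symm)
    rw [hK] at hnK
    refine (hW _ hnK).congr fun k => ?_
    change ‖((a j).out : OGroup N).symm (((a i).out : OGroup N) (ξ k)) - ξ k‖ = _
    rw [← ((a j).out : OGroup N).norm_map, map_sub, LinearIsometryEquiv.apply_symm_apply]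

end Minimizer

theorem exists_nehari_energyJ_eq {N : ℕ} [Fact (5 ≤ N)] {f : ℝ → ℝ}
    (hf1 : AssumptionF1 N f) (hf2 : AssumptionF2 f) (hf3 : AssumptionF3 f)
    {G : Subgroup (OGroup N)} {φ : G →* ℤˣ}
    (hc : ∀ ξ : Eucl N, isotropy G ξ ≠ G →
      leastEnergy f φ < orbitIndex G ξ * leastEnergy f (restrictIsotropy φ ξ)) :
    ∃ u ∈ nehari f φ, ((energyJ f u : ℝ) : EReal) = leastEnergy f φ := by
  obtain ⟨A, p, q, θ, hf⟩ := exists_isAdmissible hf1 hf2 hf3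
  obtain ⟨c, hcpos, hcE, w, R, hw, hR, hgrad, hE⟩ :=
    exists_palaisSmale_leastEnergy hf (nehari_nonempty hf hc)
  obtain ⟨W, K, v, hK, hv0, hvN, hveq, hvE⟩ := exists_profile_stabilizer hf hcpos hw hR hgrad hE
  have hvpos : 0 < energyX potential f v := by
    obtain ⟨m, hm, hmin⟩ := exists_pos_le_energyX_of_nehari hf (potential (N := N))
    exact hm.trans_le (hmin v hv0 hvN)
  have hfin : Finite (G ⧸ K) := by
    by_contra hinf
    rw [not_finite_iff_infinite] at hinf
    obtain ⟨m, hm⟩ := exists_nat_gt (c / energyX potential f v)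
    rw [div_lt_iff₀ hvpos] at hm
    exact hm.not_ge (hvE m (fun i => Infinite.natEmbedding (G ⧸ K) i) fun i j h =>
      Fin.ext ((Infinite.natEmbedding (G ⧸ K)).injective h))
  by_cases hKG : K = ⊤
  · have hmem : potential v ∈ nehari f φ := potential_mem_nehari.2
      ⟨mem_equivSpace.2 fun g => hveq g (hKG ▸ Subgroup.mem_top g), hv0, hvN⟩
    refine ⟨_, hmem, le_antisymm ?_ (iInf₂_le _ hmem)⟩
    rw [hcE, EReal.coe_le_coe_iff, energyJ_potential]
    -- The single trivial coset already gives J(v) ≤ c.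
    simpa using hvE 1 (fun _ => (1 : G)) fun _ _ _ => Subsingleton.elim _ _
  · obtain ⟨ζ, -, hζ⟩ := exists_isotropy_subgroupOf_eq G W K hK
    have hlt := hc ζ fun h => hKG (by rw [← hζ, h, Subgroup.subgroupOf_self])
    have hmem : potential v ∈ nehari f (restrictIsotropy φ ζ) := by
      refine potential_mem_nehari.2 ⟨mem_equivSpace.2 fun g => ?_, hv0, hvN⟩
      refine hveq (Subgroup.inclusion (isotropy_le G ζ) g) ?_
      rw [← hζ, Subgroup.mem_subgroupOf]
      exact g.2
    have hle : leastEnergy f (restrictIsotropy φ ζ) ≤ (energyX potential f v : EReal) := by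
      rw [← energyJ_potential]
      exact iInf₂_le _ hmem
    have hidx : orbitIndex G ζ = ((Nat.card (G ⧸ K) : ℝ) : EReal) := by
      rw [orbitIndex, hζ, ENat.card_eq_coe_natCard, ENat.toENNReal_coe,
        ← EReal.coe_ennreal_toReal (ENNReal.natCast_ne_top _), ENNReal.toReal_natCast]
    have hcard := hvE (Nat.card (G ⧸ K)) (Finite.equivFin (G ⧸ K)).symm
      (Finite.equivFin (G ⧸ K)).symm.injective
    -- Counting every coset of K = G_ζ contradicts the strict inequality at ζ.
    refine absurd hlt (not_lt.2 ?_)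
    calc orbitIndex G ζ * leastEnergy f (restrictIsotropy φ ζ)
        ≤ ((Nat.card (G ⧸ K) : ℝ) : EReal) * (energyX potential f v : EReal) := by
          rw [hidx]
          exact mul_le_mul_of_nonneg_left hle (by exact_mod_cast Nat.zero_le _)
      _ = ((Nat.card (G ⧸ K) * energyX potential f v : ℝ) : EReal) := (EReal.coe_mul _ _).symm
      _ ≤ leastEnergy f φ := by rw [hcE]; exact EReal.coe_le_coe_iff.2 hcard

end ScalarField

end

theorem proposition2p4 (N : ℕ) (hN : 5 ≤ N) (f : ℝ → ℝ)
    (hf1 : AssumptionF1 N f) (hf2 : AssumptionF2 f) (hf3 : AssumptionF3 f)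
    (G : Subgroup (OGroup N)) (hG : IsClosed (G : Set (OGroup N)))
    (φ : G →* ℤˣ) (hφ : Continuous φ) (hA : AssumptionA φ)
    (hc : ∀ ξ : Eucl N, isotropy G ξ ≠ G →
      leastEnergy f φ < orbitIndex G ξ * leastEnergy f (restrictIsotropy φ ξ)) :
    ∃ u ∈ nehari f φ, ((energyJ f u : ℝ) : EReal) = leastEnergy f φ := by
  have : Fact (5 ≤ N) := ⟨hN⟩
  exact exists_nehari_energyJ_eq hf1 hf2 hf3 hc
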